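/- **Definitions.** Let $f:(\mathbb C^d,0)\to(\mathbb C^d,0)$ be a holomorphic germ. It is *contracting* if every eigenvalue of $df_0$ has modulus $<1$. Its *generalized critical set* is $\mathcal C^\infty_f=\bigcup_{n\ge 0}f^{-n}(\mathcal C_f)$, where $\mathcal C_f=\{\det df=0\}$, and $f$ is *rigid* if $\mathcal C^\infty_f$ has simple normal crossings at $0$, i.e. $\mathcal C^\infty_f=\{w_1\cdots w_q=0\}$ near $0$ for some local holomorphic coordinates $w_1,\dots,w_d$ at $0$ and some $0\le q\le d$. Its *internal action* is the matrix $A=(a_l^k)\in\mathbb N^{q\times q}$ defined by $f^*W^k=\sum_l a_l^kW^l$, where $W^k=\{w_k=0\}$ $(1\le k\le q)$ are the irreducible components of $\mathcal C^\infty_f$ (so $w_k\circ f$ is a unit times $\prod_l w_l^{a_l^k}$); it is *injective* if $\det A\neq 0$. For a matrix $M=(m_l^k)$ of natural numbers, $x^M$ is the vector with $k$-th entry $\prod_l x_l^{m_l^k}$; products of vectors are taken componentwise, and $\mathbf 1=(1,\dots,1)$. **Theorem.** Let $f:(\mathbb C^d,0)\to(\mathbb C^d,0)$ be a contracting rigid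 germ with injective internal action. Then there are $r,e,p,m\ge 0$ with $r+e+p+m=d$ such that, with $s=r+e$, $f$ is analytically conjugate to a germ $\tilde f$ of the form $$(x,y,z)\mapsto\Big(\gamma x^P+\sigma(x),\ \beta x^Ey^D\big(\mathbf 1+g(x)\big),\ h(x,y,z)\Big),\qquad x=(u,v)\in\mathbb C^r\times\mathbb C^e,\ y\in\mathbb C^p,\ z\in\mathbb C^m,$$ where: * $\gamma\in(\mathbb C^*)^s$ and $\beta\in(\mathbb C^*)^p$; * $P=\begin{pmatrix}B&0\\0&\mathrm{Id}_e\end{pmatrix}$ with $B$ an $r\times r$ permutation matrix, $E=\begin{pmatrix}C\\0\end{pmatrix}\in\mathbb N^{s\times p}$ with $C\in\mathbb N^{r\times p}$, and $D\in\mathbb N^{p\times p}$ with $\det D\ne0$; * $\mathcal C^\infty_{\tilde f}=\{u_1\cdots u_r\,y_1\cdots y_p=0\}$ near $0$; in particular $\{y_1\cdots y_p=0\}\subseteq\mathcal C^\infty_{\tilde f}\subseteq\{x_1\cdots x_s\,y_1\cdots y_p=0\}$; * the non-zero eigenvalues of $df_0$, counted with multiplicity, can be listed as $\lambda=(\lambda_1,\dots,\lambda_s)$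 in such a way that, with $\eta\ge1$ the order of $P$, the $\eta$-th iterate of $x\mapsto\gamma x^P$ is $x\mapsto(\lambda_1^\eta x_1,\dots,\lambda_s^\eta x_s)$, and $\gamma_i=\lambda_i$ for $r<i\le s$; * $\sigma=(0,\rho):(\mathbb C^s,0)\to(\mathbb C^r\times\mathbb C^e,0)$ is a polynomial map with only *primary resonant* monomials: a monomial $x^n$ occurs in $\sigma_k$, $r<k\le s$, only if $\lambda^{\eta n}=\lambda_k^\eta$; moreover $v\mapsto\rho(0,v)$ has nilpotent linear part; * $g:(\mathbb C^s,0)\to(\mathbb C^p,0)$ is a polynomial map with only *secondary resonant* monomials: $x^n$ occurs in $g$ only if $\lambda^{\eta n}\in\operatorname{Spec}(D^\eta)$; * $h:(\mathbb C^d,0)\to(\mathbb C^m,0)$ is holomorphic, and $z\mapsto h(0,0,z)$ has nilpotent linear part. -/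

import Mathlib

open Filter Topology

/-- A germ of biholomorphism `(E, 0) → (F, 0)`, represented by a function `Φ`. -/
def IsLocalBiholomorphism {E F : Type*} [NormedAddCommGroup E] [NormedSpace ℂ E]
    [NormedAddCommGroup F] [NormedSpace ℂ F] (Φ : E → F) : Prop :=
  AnalyticAt ℂ Φ 0 ∧ Φ 0 = 0 ∧
    ∃ Ψ : F → E, AnalyticAt ℂ Ψ 0 ∧ Ψ 0 = 0 ∧
      (∀ᶠ x in 𝓝 (0 : E), Ψ (Φ x) = x) ∧ (∀ᶠ y in 𝓝 (0 : F), Φ (Ψ y) = y)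

/-- Analytic conjugacy of the germs at `0` of the self-maps `f` and `f'`. -/
def AnalyticallyConjugate {E F : Type*} [NormedAddCommGroup E] [NormedSpace ℂ E]
    [NormedAddCommGroup F] [NormedSpace ℂ F] (f : E → E) (f' : F → F) : Prop :=
  ∃ Φ : E → F, IsLocalBiholomorphism Φ ∧ ∀ᶠ x in 𝓝 (0 : E), Φ (f x) = f' (Φ x)

/-- All eigenvalues of the differential at `0` have modulus less than one. -/
def IsContracting {E : Type*} [NormedAddCommGroup E] [NormedSpace ℂ E] (f : E → E) : Prop :=
  ∀ c : ℂ, Module.End.HasEigenvalue (fderiv ℂ f 0 : E →ₗ[ℂ] E) c → ‖c‖ < 1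

/-- The critical set of `f`. -/
def critSet {E : Type*} [NormedAddCommGroup E] [NormedSpace ℂ E] (f : E → E) : Set E :=
  {x | LinearMap.det (fderiv ℂ f x : E →ₗ[ℂ] E) = 0}

/-- The generalized critical set `⋃ₙ f⁻ⁿ (crit f)`. If `f` is a contracting germ, then `0` has
arbitrarily small forward invariant neighbourhoods, so that the germ at `0` of this set depends
only on the germ of `f`. -/
def critInf {E : Type*} [NormedAddCommGroup E] [NormedSpace ℂ E] (f : E → E) : Set E :=
  ⋃ n : ℕ, f^[n] ⁻¹' critSet f

/-- `w` is a system of local holomorphic coordinates at `0` in which the generalized critical set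
of `f` is `{w₁ ⋯ w_q = 0}`; the irreducible components are then `W^k = {w_k = 0}`, `k < q`. -/
def IsAdaptedCoord {d q : ℕ} (hq : q ≤ d) (f w : (Fin d → ℂ) → (Fin d → ℂ)) : Prop :=
  IsLocalBiholomorphism w ∧
    ∀ᶠ x in 𝓝 (0 : Fin d → ℂ), x ∈ critInf f ↔ ∃ k : Fin q, w x (Fin.castLE hq k) = 0

/-- A rigid germ: the generalized critical set has simple normal crossings at `0`. -/
def IsRigid {d : ℕ} (f : (Fin d → ℂ) → (Fin d → ℂ)) : Prop :=
  ∃ (q : ℕ) (hq : q ≤ d) (w : (Fin d → ℂ) → (Fin d → ℂ)), IsAdaptedCoord hq f w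

/-- `f^* W^k = ∑ₗ A l k • W^l` for all `k`, where `W^k = {w_k = 0}`, `k < q`. -/
def IsInternalAction {d q : ℕ} (hq : q ≤ d) (f w : (Fin d → ℂ) → (Fin d → ℂ))
    (A : Matrix (Fin q) (Fin q) ℕ) : Prop :=
  ∀ k : Fin q, ∃ v : (Fin d → ℂ) → ℂ, AnalyticAt ℂ v 0 ∧ v 0 ≠ 0 ∧
    ∀ᶠ x in 𝓝 (0 : Fin d → ℂ),
      w (f x) (Fin.castLE hq k) = v x * ∏ l : Fin q, w x (Fin.castLE hq l) ^ A l k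

/-- The internal action of `f` is injective. (The matrix is unique up to a simultaneous permutation
of rows and columns, which comes from the numbering of the components.) -/
def HasInjectiveInternalAction {d : ℕ} (f : (Fin d → ℂ) → (Fin d → ℂ)) : Prop :=
  ∃ (q : ℕ) (hq : q ≤ d) (w : (Fin d → ℂ) → (Fin d → ℂ)) (A : Matrix (Fin q) (Fin q) ℕ),
    IsAdaptedCoord hq f w ∧ IsInternalAction hq f w A ∧ (A.map (Nat.cast : ℕ → ℤ)).det ≠ 0

/-- The monomial map `x ↦ x ^ M`, with components `(x ^ M)ᵏ = ∏ₗ xₗ ^ M l k`. -/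
def matPow {ι κ : Type*} [Fintype ι] (x : ι → ℂ) (M : Matrix ι κ ℕ) : κ → ℂ :=
  fun k => ∏ l, x l ^ M l k

/-- Permutation matrices. -/
def IsPermMatrix {ι : Type*} [DecidableEq ι] (M : Matrix ι ι ℕ) : Prop :=
  ∃ τ : Equiv.Perm ι, M = τ.permMatrix ℕ

/-- `lam` lists the non-zero eigenvalues of the endomorphism `T`, with algebraic multiplicity. -/
def ListsNonzeroEigenvalues {ι E : Type*} [Fintype ι] [AddCommGroup E] [Module ℂ E]
    [FiniteDimensional ℂ E] (T : E →ₗ[ℂ] E) (lam : ι → ℂ) : Prop :=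
  Multiset.map lam Finset.univ.val = T.charpoly.roots.filter (fun c => c ≠ 0)

/-- The powers `lam i ^ η` are the eigenvalues, coordinate by coordinate, of the (diagonal) `η`-th
iterate of the linear map `x ↦ γ x ^ P`. -/
def IsCompatible {ι : Type*} [Fintype ι] (γ : ι → ℂ) (P : Matrix ι ι ℕ) (η : ℕ) (lam : ι → ℂ) :
    Prop :=
  ∀ (x : ι → ℂ) (i : ι), ((fun t : ι → ℂ => γ * matPow t P)^[η] x) i = lam i ^ η * x i

/-- The monomial `x ^ n` is primary resonant with respect to the coordinate `k`:
`lam ^ (η n) = (lam k) ^ η`. -/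
def IsPrimaryResonant {ι : Type*} [Fintype ι] (lam : ι → ℂ) (η : ℕ) (n : ι →₀ ℕ) (k : ι) : Prop :=
  ∏ i, lam i ^ (η * n i) = lam k ^ η

/-- The monomial `x ^ n` is secondary resonant: `lam ^ (η n)` is an eigenvalue of `D ^ η`. -/
def IsSecondaryResonant {ι κ : Type*} [Fintype ι] [Fintype κ] [DecidableEq κ] (lam : ι → ℂ)
    (η : ℕ) (D : Matrix κ κ ℕ) (n : ι →₀ ℕ) : Prop :=
  ∏ i, lam i ^ (η * n i) ∈ spectrum ℂ ((D ^ η).map (Nat.cast : ℕ → ℂ))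

/-- The map `(x, y, z) ↦ (γ x ^ P + σ(x), β x ^ E y ^ D (1 + g(x)), h(x, y, z))`. -/
noncomputable def normalForm {ι κ ν : Type*} [Fintype ι] [Fintype κ]
    (γ : ι → ℂ) (P : Matrix ι ι ℕ) (σ : ι → MvPolynomial ι ℂ)
    (β : κ → ℂ) (E : Matrix ι κ ℕ) (D : Matrix κ κ ℕ) (g : κ → MvPolynomial ι ℂ)
    (h : (ι → ℂ) × (κ → ℂ) × (ν → ℂ) → (ν → ℂ)) :
    (ι → ℂ) × (κ → ℂ) × (ν → ℂ) → (ι → ℂ) × (κ → ℂ) × (ν → ℂ) :=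
  fun t =>
    (fun i => γ i * matPow t.1 P i + MvPolynomial.eval t.1 (σ i),
     fun k => β k * matPow t.1 E k * matPow t.2.1 D k * (1 + MvPolynomial.eval t.1 (g k)),
     h t)

/-! Let `C` be the pullback `φ ↦ φ ∘ f` on functions holomorphic at 0. Normalizing `f` means finding
coordinate functions on which `C` acts simply. `C` preserves vanishing to order `N`. On jets of
order `N` it is finite-dimensional linear algebra. On functions of high order it is so contracting
that `L ∘ f = T L - e` has the solution `∑ T⁻⁽ⁱ⁺¹⁾ (e ∘ fⁱ)`, convergent and unique as soon as
`‖T⁻¹‖ c ^ N < 1`, where `c` is a contraction rate (`IsContractingGerm.exists_comp_eq`,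
`ContractsWith.eventually_eq_zero`). Each problem below splits into a jet part, solved by
generalized eigenspaces, and a remainder, solved by this series.

Combinatorics of the internal action (`exists_block_decomposition`): follow the columns that are
unit vectors. The components on which this never stops are permuted and give the `u`. The others
give the `y`, and their differentials are nilpotent under the transpose of `df₀`.

Primary form (`IsContractingGerm.exists_primary_normal_form`): after multiplication by units the `u`
are permuted up to constants. They are completed by generalized eigenvectors `v` of `C` with
non-zero eigenvalues and, at the level of jets only, by nilpotent functions. `C` is an algebra
homomorphism, so a monomial in generalized eigenvectors is one too, with the product eigenvalue
(`IsGenEig.mul`). Since `C v_k` is a generalized eigenvector for the eigenvalue of `v_k`, its jet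
contains resonant monomials in `(u, v)` only, and uniqueness promotes this equality of jets to one
of germs. The `u` are eigenvectors only of `C ^ η`, hence the exponent `η` in the resonance
conditions.

Secondary form (`IsContractingGerm.exists_secondary_normal_form`): replacing `y_k` by `exp(L_k) y_k`
changes the logarithm `Φ` of the unit into `Φ + C L - Dᵀ L`. The adjugate of `X - Dᵀ` removes the
part of the jet of `Φ` on which the characteristic polynomial of `D` is invertible. What is left
consists of secondary resonant monomials, and the remainder of high order is removed by the series,
`D` being invertible.

The differentials of `x` and `y` are independent because they belong to non-zero and zero
eigenvalues. The coordinates `z` complete them arbitrarily. The fibre part `h(0, 0, z)` is nilpotent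
because a power of the transpose of `df₀` maps all covectors into the span of the `dx_i`. -/

/-! ### Majorants of power series and composition -/

section Majorant

open scoped ENNReal NNReal

variable {E F G : Type*} [NormedAddCommGroup E] [NormedSpace ℂ E]
  [NormedAddCommGroup F] [NormedSpace ℂ F] [NormedAddCommGroup G] [NormedSpace ℂ G]

/-- The weighted `ℓ¹` norm `∑ ‖pₙ‖ rⁿ` of a formal multilinear series. -/
noncomputable def FormalMultilinearSeries.majorant (p : FormalMultilinearSeries ℂ E F)
    (r : ℝ≥0∞) : ℝ≥0∞ :=
  ∑' n, (‖p n‖₊ : ℝ≥0∞) * r ^ n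

theorem ENNReal.tsum_prod_fin (a : ℕ → ℝ≥0∞) (k : ℕ) :
    ∑' v : Fin k → ℕ, ∏ i, a (v i) = (∑' n, a n) ^ k := by
  induction k with
  | zero => simp
  | succ k ih =>
    rw [← (Fin.consEquiv (fun _ => ℕ)).tsum_eq, pow_succ', ← ENNReal.tsum_mul_right]
    refine (ENNReal.tsum_prod' (f := fun c : ℕ × (Fin k → ℕ) =>
      ∏ i, a (Fin.consEquiv (fun _ => ℕ) c i))).trans (tsum_congr fun n => ?_)
    simp only [Fin.consEquiv_apply, Fin.prod_univ_succ, Fin.cons_zero, Fin.cons_succ]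
    rw [ENNReal.tsum_mul_left, ih]

/-- A composition of `n` contributes at most `‖q_k‖ ∏ ‖p_{v i}‖ r ^ v i`, where `v` is its tuple of
blocks. Distinct compositions have distinct tuples, and the sum over all tuples of natural numbers
is the expanded right-hand side. -/
theorem FormalMultilinearSeries.majorant_comp_le (q : FormalMultilinearSeries ℂ F G)
    (p : FormalMultilinearSeries ℂ E F) (r : ℝ≥0∞) :
    (q.comp p).majorant r ≤ q.majorant (p.majorant r) := by
  let g : (Σ k : ℕ, Fin k → ℕ) → ℝ≥0∞ := fun v =>
    (‖q v.1‖₊ : ℝ≥0∞) * ∏ i, ((‖p (v.2 i)‖₊ : ℝ≥0∞) * r ^ v.2 i)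
  let φ : (Σ n : ℕ, Composition n) → (Σ k : ℕ, Fin k → ℕ) := fun c => ⟨c.2.length, c.2.blocksFun⟩
  have hφ : Function.Injective φ := by
    intro c c' h
    rw [Composition.sigma_eq_iff_blocks_eq, ← Composition.ofFn_blocksFun, ← Composition.ofFn_blocksFun]
    exact congrArg (fun v : (Σ k : ℕ, Fin k → ℕ) => List.ofFn v.2) h
  calc (q.comp p).majorant r ≤ ∑' n, ∑' c : Composition n, g (φ ⟨n, c⟩) := by
        refine ENNReal.tsum_le_tsum fun n => ?_
        rw [tsum_fintype]
        calc (‖(q.comp p) n‖₊ : ℝ≥0∞) * r ^ n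
            ≤ (∑ c : Composition n, (‖q.compAlongComposition p c‖₊ : ℝ≥0∞)) * r ^ n := by
              gcongr
              exact_mod_cast nnnorm_sum_le Finset.univ fun c => q.compAlongComposition p c
          _ = ∑ c : Composition n, (‖q.compAlongComposition p c‖₊ : ℝ≥0∞) * r ^ n := Finset.sum_mul _ _ _
          _ ≤ _ := by
              refine Finset.sum_le_sum fun c _ => ?_
              have h1 : (‖q.compAlongComposition p c‖₊ : ℝ≥0∞) ≤
                  (‖q c.length‖₊ : ℝ≥0∞) * ∏ i, (‖p (c.blocksFun i)‖₊ : ℝ≥0∞) := by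
                have := q.compAlongComposition_nnnorm p c
                exact_mod_cast this
              have h2 : r ^ n = ∏ i, r ^ c.blocksFun i := by
                rw [Finset.prod_pow_eq_pow_sum, c.sum_blocksFun]
              calc _ ≤ ((‖q c.length‖₊ : ℝ≥0∞) * ∏ i, (‖p (c.blocksFun i)‖₊ : ℝ≥0∞)) * r ^ n := by gcongr
                _ = _ := by
                  simp only [g, φ]
                  rw [Finset.prod_mul_distrib, h2, mul_assoc]
    _ = ∑' c : (Σ n : ℕ, Composition n), g (φ c) := (ENNReal.tsum_sigma' fun c => g (φ c)).symm
    _ ≤ ∑' v, g v := ENNReal.tsum_comp_le_tsum_of_injective hφ g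
    _ = ∑' k, ∑' v : Fin k → ℕ, g ⟨k, v⟩ := ENNReal.tsum_sigma' _
    _ = q.majorant (p.majorant r) := by
        refine tsum_congr fun k => ?_
        have hg : ∀ v : Fin k → ℕ, g ⟨k, v⟩ =
          (‖q k‖₊ : ℝ≥0∞) * ∏ i, ((‖p (v i)‖₊ : ℝ≥0∞) * r ^ v i) := fun _ => rfl
        rw [tsum_congr hg, ENNReal.tsum_mul_left, ENNReal.tsum_prod_fin (fun n => (‖p n‖₊ : ℝ≥0∞) * r ^ n) k]
        rfl

theorem FormalMultilinearSeries.majorant_mono (q : FormalMultilinearSeries ℂ F G) {r s : ℝ≥0∞}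
    (h : r ≤ s) : q.majorant r ≤ q.majorant s :=
  ENNReal.tsum_le_tsum fun n => by gcongr

/-- The gain `a ^ N` at each composition with a contraction is what makes the series for the
cohomological equation geometric. -/
theorem FormalMultilinearSeries.majorant_mul_le (q : FormalMultilinearSeries ℂ F G) {N : ℕ}
    (hq : ∀ k < N, q k = 0) {a : ℝ≥0∞} (ha : a ≤ 1) (s : ℝ≥0∞) :
    q.majorant (a * s) ≤ a ^ N * q.majorant s := by
  unfold majorant
  rw [← ENNReal.tsum_mul_left]
  refine ENNReal.tsum_le_tsum fun n => ?_
  by_cases h : n < N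
  · have : (‖q n‖₊ : ℝ≥0∞) = 0 := by simp [hq n h]
    simp [this]
  · have : a ^ n ≤ a ^ N := pow_le_pow_right_of_le_one' ha (not_lt.mp h)
    calc _ = a ^ n * ((‖q n‖₊ : ℝ≥0∞) * s ^ n) := by rw [mul_pow]; ring
      _ ≤ _ := by gcongr

theorem FormalMultilinearSeries.exists_majorant_lt_top (p : FormalMultilinearSeries ℂ E F)
    (hp : 0 < p.radius) : ∃ r : ℝ≥0, 0 < r ∧ p.majorant r < ∞ := by
  obtain ⟨r, hr0, hr⟩ := ENNReal.lt_iff_exists_nnreal_btwn.1 hp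
  refine ⟨r, by exact_mod_cast hr0, ?_⟩
  have := p.summable_nnnorm_mul_pow hr
  have h2 : p.majorant r = ∑' n, ((‖p n‖₊ * r ^ n : ℝ≥0) : ℝ≥0∞) := by
    unfold majorant
    refine tsum_congr fun n => ?_
    simp
  rw [h2]
  exact (ENNReal.tsum_coe_ne_top_iff_summable.2 this).lt_top

/-- All terms of degree at least two are quadratically small in the radius, so they fit into the gap
between `‖p 1‖` and `a`. -/
theorem FormalMultilinearSeries.exists_majorant_le_mul (p : FormalMultilinearSeries ℂ E F)
    (hp : 0 < p.radius) (h0 : p 0 = 0) {a : ℝ≥0} (h1 : ‖p 1‖₊ < a) :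
    ∃ R : ℝ≥0, 0 < R ∧ ∀ r ≤ R, p.majorant r ≤ a * r := by
  obtain ⟨ρ, hρ, hK⟩ := p.exists_majorant_lt_top hp
  lift p.majorant ρ to ℝ≥0 using hK.ne with K hKe
  -- for `r = t ρ`, the majorant is at most `‖p 1‖ r + t ^ 2 K`
  have key : ∀ t : ℝ≥0, t ≤ 1 →
      p.majorant ((t * ρ : ℝ≥0) : ℝ≥0∞) ≤ ((‖p 1‖₊ * (t * ρ) + t ^ 2 * K : ℝ≥0) : ℝ≥0∞) := by
    intro t ht
    push_cast
    rw [hKe]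
    unfold majorant
    rw [← ENNReal.tsum_mul_left]
    have hterm : ∀ n, (‖p n‖₊ : ℝ≥0∞) * ((t : ℝ≥0∞) * ρ) ^ n ≤
        (if n = 1 then (‖p 1‖₊ : ℝ≥0∞) * (t * ρ) else 0) + (t : ℝ≥0∞) ^ 2 * ((‖p n‖₊ : ℝ≥0∞) * ρ ^ n) := by
      intro n
      rcases n with _ | _ | n
      · have : (‖p 0‖₊ : ℝ≥0∞) = 0 := by simp [h0]
        simp [this]
      · simp
      · have ht' : (t : ℝ≥0∞) ^ (n + 2) ≤ t ^ 2 :=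
          pow_le_pow_right_of_le_one' (by exact_mod_cast ht) (by omega)
        simp only [show n + 1 + 1 ≠ 1 by omega, if_false, zero_add]
        calc _ = (t : ℝ≥0∞) ^ (n + 2) * ((‖p (n + 1 + 1)‖₊ : ℝ≥0∞) * ρ ^ (n + 1 + 1)) := by
              rw [mul_pow]; ring
          _ ≤ _ := by gcongr
    refine (ENNReal.tsum_le_tsum hterm).trans ?_
    rw [ENNReal.tsum_add, tsum_ite_eq]
  obtain ⟨b, hb, rfl⟩ : ∃ b : ℝ≥0, 0 < b ∧ ‖p 1‖₊ + b = a :=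
    ⟨a - ‖p 1‖₊, tsub_pos_of_lt h1, add_tsub_cancel_of_le h1.le⟩
  -- The bound on `t` makes `t * K ≤ b * ρ`, so the quadratic term is absorbed by the gap `b`. The
  -- `+ 1` avoids division by zero.
  refine ⟨min 1 (b * ρ / (K + 1)) * ρ, by positivity, fun r hr => ?_⟩
  obtain ⟨t, rfl⟩ : ∃ t, r = t * ρ := ⟨r / ρ, by field_simp⟩
  have ht : t ≤ min 1 (b * ρ / (K + 1)) := le_of_mul_le_mul_right hr hρ
  refine (key t (ht.trans (min_le_left _ _))).trans ?_
  rw [← ENNReal.coe_mul]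
  have h3 : t * K ≤ b * ρ := by
    have h4 : t * (K + 1) ≤ b * ρ := by
      have := ht.trans (min_le_right _ _)
      rwa [le_div_iff₀ (by positivity)] at this
    exact le_trans (by gcongr; exact le_self_add) h4
  refine ENNReal.coe_le_coe.2 ?_
  calc ‖p 1‖₊ * (t * ρ) + t ^ 2 * K = ‖p 1‖₊ * (t * ρ) + t * (t * K) := by ring
    _ ≤ ‖p 1‖₊ * (t * ρ) + t * (b * ρ) := by gcongr
    _ = _ := by ring

end Majorant

/-! ### Order of vanishing and power series coefficients -/

section VanishingOrder

variable {E F : Type*} [NormedAddCommGroup E] [NormedSpace ℂ E]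
  [NormedAddCommGroup F] [NormedSpace ℂ F]

/-- The growth bound forces only the diagonal values `q k (y, …, y)` to vanish. The multilinear
coefficients need not be symmetric and may survive, so they are replaced by zero, which does not
change the sum. -/
theorem HasFPowerSeriesAt.exists_eq_zero_of_isBigO {φ : E → F} {q : FormalMultilinearSeries ℂ E F}
    (hq : HasFPowerSeriesAt φ q 0) (N : ℕ) (hφ : φ =O[𝓝 0] fun w => ‖w‖ ^ N) :
    ∃ q' : FormalMultilinearSeries ℂ E F, HasFPowerSeriesAt φ q' 0 ∧ ∀ k < N, q' k = 0 := by
  have hzero : ∀ k < N, ∀ y : E, (q k fun _ => y) = 0 := by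
    intro k
    induction k using Nat.strong_induction_on with
    | _ k ih =>
      intro hk
      refine Asymptotics.IsBigO.continuousMultilinearMap_apply_eq_zero ?_
      have h1 := hq.isBigO_sub_partialSum_pow (k + 1)
      have h2 : φ =O[𝓝 0] fun w => ‖w‖ ^ (k + 1) :=
        hφ.trans (Asymptotics.IsBigO.of_norm_eventuallyLE (by
          filter_upwards [Metric.ball_mem_nhds (0 : E) one_pos] with w hw
          have : ‖w‖ < 1 := by simpa using hw
          simpa using pow_le_pow_of_le_one (norm_nonneg w) this.le hk))
      have h3 : (fun y : E => (q k fun _ => y)) = fun y => φ y - (φ (0 + y) - q.partialSum (k + 1) y) := by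
        funext y
        rw [FormalMultilinearSeries.partialSum, Finset.sum_range_succ,
          Finset.sum_eq_zero fun j hj => ih j (Finset.mem_range.1 hj)
            ((Finset.mem_range.1 hj).trans hk) y]
        simp
      rw [h3]
      exact h2.sub h1
  obtain ⟨r, hr⟩ := hq
  refine ⟨fun k => if k < N then 0 else q k, ⟨r, ?_, hr.r_pos, fun {y} hy => ?_⟩,
    fun k hk => by simp [hk]⟩
  · refine hr.r_le.trans (FormalMultilinearSeries.radius_le_of_le fun n => ?_)
    split_ifs <;> simp
  · convert hr.hasSum hy using 2 with k
    split_ifs with h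
    · simp [hzero k h]
    · rfl

theorem HasFPowerSeriesAt.isBigO_of_eq_zero {φ : E → F} {q : FormalMultilinearSeries ℂ E F}
    (hq : HasFPowerSeriesAt φ q 0) {N : ℕ} (h : ∀ k < N, q k = 0) :
    φ =O[𝓝 0] fun w => ‖w‖ ^ N := by
  have h1 := hq.isBigO_sub_partialSum_pow N
  refine h1.congr_left fun y => ?_
  rw [FormalMultilinearSeries.partialSum, Finset.sum_eq_zero fun j hj => by
    simp [h j (Finset.mem_range.1 hj)]]
  simp

theorem HasFPowerSeriesAt.eventuallyEq {φ ψ : E → F} {q : FormalMultilinearSeries ℂ E F}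
    (hφ : HasFPowerSeriesAt φ q 0) (hψ : HasFPowerSeriesAt ψ q 0) : φ =ᶠ[𝓝 0] ψ := by
  filter_upwards [hφ.eventually_hasSum, hψ.eventually_hasSum] with y h1 h2
  simpa using h1.unique h2

end VanishingOrder

/-! ### The cohomological equation for a germ whose differential has norm less than one -/

section Cohomological

open scoped ENNReal NNReal

variable {E G : Type*} [NormedAddCommGroup E] [NormedSpace ℂ E]
  [NormedAddCommGroup G] [NormedSpace ℂ G] [CompleteSpace G]

/-- With `S = T⁻¹`, the solution is `L = ∑ S ^ (i + 1) (q ∘ pⁱ)`. Each composition with `p`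
multiplies the majorant at a small radius by at most `a ^ N`, so the series is dominated by a
geometric one of ratio `‖S‖ a ^ N`. -/
theorem FormalMultilinearSeries.exists_comp_eq {p : FormalMultilinearSeries ℂ E E}
    (hp : 0 < p.radius) (h0 : p 0 = 0) {a : ℝ≥0} (h1 : ‖p 1‖₊ < a) (ha : a ≤ 1)
    {q : FormalMultilinearSeries ℂ E G} (hq : 0 < q.radius) {N : ℕ} (hqN : ∀ k < N, q k = 0)
    (T : G ≃L[ℂ] G) (hT : ‖(T.symm : G →L[ℂ] G)‖₊ * a ^ N < 1) :
    ∃ L : FormalMultilinearSeries ℂ E G, 0 < L.radius ∧ (∀ k < N, L k = 0) ∧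
      ∀ n v, (L.comp p) n v = T (L n v) - q n v := by
  set S : G →L[ℂ] G := (T.symm : G →L[ℂ] G) with hS
  obtain ⟨Q, hQ0, hQs⟩ : ∃ Q : ℕ → FormalMultilinearSeries ℂ E G,
      Q 0 = q ∧ ∀ i, Q (i + 1) = (Q i).comp p :=
    ⟨fun i => Nat.rec q (fun _ Q' => Q'.comp p) i, rfl, fun _ => rfl⟩
  have hQN : ∀ i, ∀ k < N, Q i k = 0 := by
    intro i
    induction i with
    | zero => exact fun k hk => by rw [hQ0, hqN k hk]
    | succ i ih =>
      intro k hk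
      rw [hQs]
      ext v
      simp only [FormalMultilinearSeries.comp, sum_apply]
      refine Finset.sum_eq_zero fun c _ => ?_
      rw [compAlongComposition_apply, ih _ (c.length_le.trans_lt hk)]
      rfl
  obtain ⟨R, hR, hpR⟩ := p.exists_majorant_le_mul hp h0 h1
  obtain ⟨R', hR', hqR⟩ := q.exists_majorant_lt_top hq
  obtain ⟨r, hr, hrR, hrR'⟩ : ∃ r : ℝ≥0, 0 < r ∧ r ≤ R ∧ r ≤ R' :=
    ⟨min R R', lt_min hR hR', min_le_left _ _, min_le_right _ _⟩
  have hqr : q.majorant r < ∞ := (q.majorant_mono (by exact_mod_cast hrR')).trans_lt hqR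
  lift q.majorant r to ℝ≥0 using hqr.ne with K hK
  have hmaj : ∀ i, (Q i).majorant r ≤ ((a ^ N) ^ i * K : ℝ≥0) := by
    intro i
    induction i with
    | zero => simp [hQ0, hK]
    | succ i ih =>
      rw [hQs]
      refine (majorant_comp_le _ _ _).trans (((Q i).majorant_mono (hpR r hrR)).trans ?_)
      refine ((Q i).majorant_mul_le (hQN i) (by exact_mod_cast ha) _).trans ?_
      calc (a : ℝ≥0∞) ^ N * (Q i).majorant r ≤ (a : ℝ≥0∞) ^ N * ((a ^ N) ^ i * K : ℝ≥0) := by gcongr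
        _ = _ := by push_cast; ring
  have hnorm : ∀ i n, ‖Q i n‖₊ * r ^ n ≤ (a ^ N) ^ i * K := by
    intro i n
    have := (ENNReal.le_tsum n).trans (hmaj i)
    exact_mod_cast this
  obtain ⟨W, hWQ⟩ : ∃ W : ℕ → FormalMultilinearSeries ℂ E G,
      ∀ i n, W i n = (S ^ (i + 1)).compContinuousMultilinearMap (Q i n) :=
    ⟨_, fun _ _ => rfl⟩
  have hW : ∀ i n, ‖W i n‖₊ * r ^ n ≤ ‖S‖₊ * K * (‖S‖₊ * a ^ N) ^ i := by
    intro i n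
    have h2 : ‖W i n‖₊ ≤ ‖S ^ (i + 1)‖₊ * ‖Q i n‖₊ := by
      rw [hWQ]
      exact ContinuousLinearMap.norm_compContinuousMultilinearMap_le _ _
    calc ‖W i n‖₊ * r ^ n ≤ (‖S‖₊ ^ (i + 1) * ‖Q i n‖₊) * r ^ n := by
          gcongr
          exact h2.trans (by gcongr; exact nnnorm_pow_le' S (Nat.succ_pos i))
      _ = ‖S‖₊ ^ (i + 1) * (‖Q i n‖₊ * r ^ n) := by ring
      _ ≤ ‖S‖₊ ^ (i + 1) * ((a ^ N) ^ i * K) := mul_le_mul_right (hnorm i n) _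
      _ = _ := by rw [mul_pow]; ring
  have hgeo : Summable fun i => ‖S‖₊ * K * (‖S‖₊ * a ^ N) ^ i :=
    (NNReal.summable_geometric hT).mul_left _
  have hWs : ∀ n, Summable fun i => ‖W i n‖₊ := by
    intro n
    have : Summable fun i => (‖S‖₊ * K * (‖S‖₊ * a ^ N) ^ i) * (r ^ n)⁻¹ := hgeo.mul_right _
    refine NNReal.summable_of_le (fun i => ?_) this
    rw [← div_eq_mul_inv, le_div_iff₀ (by positivity)]
    exact hW i n
  obtain ⟨L, hLW⟩ : ∃ L : FormalMultilinearSeries ℂ E G, ∀ n, L n = ∑' i, W i n :=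
    ⟨_, fun _ => rfl⟩
  have hL : ∀ n v, HasSum (fun i => (S ^ (i + 1)) (Q i n v)) (L n v) := by
    intro n v
    have h3 : HasSum (fun i => W i n) (L n) := by
      rw [hLW]
      exact (Summable.of_nnnorm (hWs n)).hasSum
    have h4 := (ContinuousMultilinearMap.apply ℂ (fun _ : Fin n => E) G v).hasSum h3
    simpa [hWQ] using h4
  refine ⟨L, ?_, ?_, ?_⟩
  · refine (show (0 : ℝ≥0∞) < r by exact_mod_cast hr).trans_le
      (L.le_radius_of_bound_nnreal (∑' i, ‖S‖₊ * K * (‖S‖₊ * a ^ N) ^ i) fun n => ?_)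
    calc ‖L n‖₊ * r ^ n ≤ (∑' i, ‖W i n‖₊) * r ^ n := by
          rw [hLW]
          exact mul_le_mul_left (nnnorm_tsum_le (hWs n)) _
      _ = ∑' i, ‖W i n‖₊ * r ^ n := (NNReal.tsum_mul_right _ _).symm
      _ ≤ _ := Summable.tsum_le_tsum (fun i => hW i n) ((hWs n).mul_right _) hgeo
  · intro k hk
    ext v
    refine (hL k v).unique ?_
    simp [hQN _ k hk]
  · intro n v
    have h4 : HasSum (fun i => (S ^ (i + 1)) (Q (i + 1) n v)) ((L.comp p) n v) := by
      have h5 : HasSum (fun i => ∑ c : Composition n,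
          (S ^ (i + 1)) (Q i c.length (p.applyComposition c v))) ((L.comp p) n v) := by
        simp only [FormalMultilinearSeries.comp, sum_apply,
          compAlongComposition_apply]
        exact hasSum_sum fun c _ => hL _ _
      convert h5 using 2 with i
      rw [hQs]
      simp only [FormalMultilinearSeries.comp, sum_apply,
        compAlongComposition_apply, map_sum]
    -- Removing the term `S q` from the series of `L` and applying `T` yields the series of `L ∘ p`.
    have h6 := (hasSum_nat_add_iff' 1).2 (hL n v)
    have h7 := (T : G →L[ℂ] G).hasSum h6
    refine h4.unique ?_
    convert h7 using 1
    · funext i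
      have : (S ^ (i + 1 + 1)) = S * S ^ (i + 1) := pow_succ' _ _
      rw [this]
      simp [hS]
    · simp [hS, hQ0]

theorem exists_comp_eq_of_nnnorm_lt {F : E → E} (hF : AnalyticAt ℂ F 0) (hF0 : F 0 = 0) {a : ℝ≥0}
    (h1 : ‖fderiv ℂ F 0‖₊ < a) (ha : a ≤ 1) {err : E → G} (herr : AnalyticAt ℂ err 0) {N : ℕ}
    (hN : err =O[𝓝 0] fun w => ‖w‖ ^ N)
    (T : G ≃L[ℂ] G) (hT : ‖(T.symm : G →L[ℂ] G)‖₊ * a ^ N < 1) :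
    ∃ L : E → G, AnalyticAt ℂ L 0 ∧ (L =O[𝓝 0] fun w => ‖w‖ ^ N) ∧
      ∀ᶠ w in 𝓝 0, L (F w) = T (L w) - err w := by
  obtain ⟨p, hp⟩ := hF
  obtain ⟨q₀, hq₀⟩ := herr
  obtain ⟨q, hq, hqN⟩ := hq₀.exists_eq_zero_of_isBigO N hN
  have hp0 : p 0 = 0 := by
    ext v
    simpa [hF0] using hp.coeff_zero v
  have hp1 : ‖p 1‖₊ < a := by
    have : ‖fderiv ℂ F 0‖ = ‖p 1‖ := by
      rw [hp.fderiv_eq]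
      exact LinearIsometryEquiv.norm_map _ _
    rw [← NNReal.coe_lt_coe, coe_nnnorm] at h1 ⊢
    rwa [← this]
  obtain ⟨L, hL, hLN, hLp⟩ := FormalMultilinearSeries.exists_comp_eq hp.radius_pos hp0 hp1 ha
    hq.radius_pos hqN T hT
  have hLs : HasFPowerSeriesAt L.sum L 0 := (L.hasFPowerSeriesOnBall hL).hasFPowerSeriesAt
  refine ⟨L.sum, hLs.analyticAt, hLs.isBigO_of_eq_zero hLN, ?_⟩
  have hc : HasFPowerSeriesAt (L.sum ∘ F) (L.comp p) 0 := by
    refine HasFPowerSeriesAt.comp ?_ hp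
    rwa [hF0]
  have hd : HasFPowerSeriesAt (fun w => T (L.sum w) - err w)
      ((T : G →L[ℂ] G).compFormalMultilinearSeries L - q) 0 := by
    refine HasFPowerSeriesAt.sub ?_ hq
    obtain ⟨r, hr⟩ := hLs
    exact ⟨r, (T : G →L[ℂ] G).comp_hasFPowerSeriesOnBall hr⟩
  have : L.comp p = (T : G →L[ℂ] G).compFormalMultilinearSeries L - q := by
    ext n v
    simpa using hLp n v
  rw [this] at hc
  exact hc.eventuallyEq hd

end Cohomological

/-! ### Contraction rates and uniqueness for the homogeneous equation -/

section Contraction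

open scoped ENNReal NNReal

/-- The iterates of `f` contract a neighbourhood of `0` at the geometric rate `c`. -/
def ContractsWith {E : Type*} [NormedAddCommGroup E] (f : E → E) (c : ℝ) : Prop :=
  ∃ K > 0, ∃ δ > 0, ∀ (n : ℕ) (w : E), ‖w‖ < δ → ‖f^[n] w‖ ≤ K * c ^ n * ‖w‖

theorem ContractsWith.iterate {E : Type*} [NormedAddCommGroup E] {f : E → E} {c : ℝ} (h : ContractsWith f c) (m : ℕ) :
    ContractsWith (f^[m]) (c ^ m) := by
  obtain ⟨K, hK, δ, hδ, H⟩ := h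
  refine ⟨K, hK, δ, hδ, fun n w hw => ?_⟩
  rw [← Function.iterate_mul, ← pow_mul]
  exact H _ _ hw

variable {E : Type*} [NormedAddCommGroup E] [NormedSpace ℂ E]

theorem AnalyticAt.iterate_of_map_zero {f : E → E} (hf : AnalyticAt ℂ f 0) (hf0 : f 0 = 0) (n : ℕ) :
    AnalyticAt ℂ (f^[n]) 0 := by
  induction n with
  | zero => exact analyticAt_id
  | succ n ih =>
    rw [Function.iterate_succ]
    exact ih.comp_of_eq hf hf0

theorem fderiv_iterate_zero {f : E → E} (hf : AnalyticAt ℂ f 0) (hf0 : f 0 = 0) (n : ℕ) :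
    fderiv ℂ (f^[n]) 0 = (fderiv ℂ f 0) ^ n :=
  (HasFDerivAt.iterate hf.differentiableAt.hasFDerivAt hf0 n).fderiv

/-- By linearization `f^[m]` contracts a ball by the factor `c ^ m`. After division of `n` by `m`,
fewer than `m` iterations are left over, and they cost only a constant. -/
theorem contractsWith_of_norm_pow_lt {f : E → E} (hf : AnalyticAt ℂ f 0) (hf0 : f 0 = 0) {c : ℝ}
    (hc0 : 0 < c) (hc1 : c < 1) {m : ℕ} (hm : 0 < m) (h : ‖(fderiv ℂ f 0) ^ m‖ < c ^ m) :
    ContractsWith f c := by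
  have hbound : ∀ᶠ w in 𝓝 (0 : E), ‖f^[m] w‖ ≤ c ^ m * ‖w‖ := by
    have hd := (hf.iterate_of_map_zero hf0 m).differentiableAt.hasFDerivAt
    rw [fderiv_iterate_zero hf hf0] at hd
    have hε : 0 < c ^ m - ‖(fderiv ℂ f 0) ^ m‖ := sub_pos.2 h
    have := (hasFDerivAt_iff_isLittleO_nhds_zero.1 hd).def hε
    filter_upwards [this] with w hw
    have h0 : f^[m] 0 = 0 := Function.iterate_fixed hf0 m
    simp only [zero_add, h0, sub_zero] at hw
    calc ‖f^[m] w‖ = ‖(f^[m] w - ((fderiv ℂ f 0) ^ m) w) + ((fderiv ℂ f 0) ^ m) w‖ := by simp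
      _ ≤ (c ^ m - ‖(fderiv ℂ f 0) ^ m‖) * ‖w‖ + ‖(fderiv ℂ f 0) ^ m‖ * ‖w‖ :=
        (norm_add_le _ _).trans (add_le_add hw (ContinuousLinearMap.le_opNorm _ _))
      _ = _ := by ring
  have hO : ∀ j, ∃ K > 0, ∀ᶠ w in 𝓝 (0 : E), ‖f^[j] w‖ ≤ K * ‖w‖ := by
    intro j
    have hd := (hf.iterate_of_map_zero hf0 j).differentiableAt.isBigO_sub
    obtain ⟨K, hK, hw⟩ := hd.exists_pos
    refine ⟨K, hK, ?_⟩
    filter_upwards [hw.bound] with w hw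
    have h0 : f^[j] 0 = 0 := Function.iterate_fixed hf0 j
    simpa [h0] using hw
  choose Kj hKj hj using hO
  have hall : ∀ᶠ w in 𝓝 (0 : E), ‖f^[m] w‖ ≤ c ^ m * ‖w‖ ∧
      ∀ j ∈ Finset.range m, ‖f^[j] w‖ ≤ Kj j * ‖w‖ :=
    hbound.and ((Finset.range m).eventually_all.2 fun j _ => hj j)
  obtain ⟨δ, hδ, hball⟩ := Metric.eventually_nhds_iff.1 hall
  have hK : 0 < ∑ j ∈ Finset.range m, Kj j :=
    Finset.sum_pos (fun j _ => hKj j) ⟨0, Finset.mem_range.2 hm⟩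
  -- The factor `(c ^ m)⁻¹` pays for rounding `n` down to a multiple of `m`.
  refine ⟨(∑ j ∈ Finset.range m, Kj j) * (c ^ m)⁻¹, by positivity, δ, hδ, fun n w hw => ?_⟩
  have hiter : ∀ k, ‖(f^[m])^[k] w‖ ≤ (c ^ m) ^ k * ‖w‖ := by
    intro k
    induction k with
    | zero => simp
    | succ k ih =>
      rw [Function.iterate_succ_apply']
      have hlt : ‖(f^[m])^[k] w‖ < δ := by
        refine lt_of_le_of_lt (ih.trans ?_) hw
        exact mul_le_of_le_one_left (norm_nonneg _) (pow_le_one₀ (by positivity)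
          (pow_le_one₀ hc0.le hc1.le))
      refine ((hball (by simpa using hlt)).1).trans ?_
      rw [pow_succ', mul_assoc]
      gcongr
  have hsplit : f^[n] w = f^[n % m] ((f^[m])^[n / m] w) := by
    rw [← Function.iterate_mul, ← Function.iterate_add_apply, Nat.mod_add_div]
  have hlt : ‖(f^[m])^[n / m] w‖ < δ := by
    refine lt_of_le_of_lt ((hiter _).trans ?_) hw
    exact mul_le_of_le_one_left (norm_nonneg _) (pow_le_one₀ (by positivity)
      (pow_le_one₀ hc0.le hc1.le))
  have hmem : n % m ∈ Finset.range m := Finset.mem_range.2 (Nat.mod_lt _ hm)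
  have hle : (c ^ m) ^ (n / m) ≤ (c ^ m)⁻¹ * c ^ n := by
    rw [← pow_mul, le_inv_mul_iff₀ (by positivity), ← pow_add]
    refine pow_le_pow_of_le_one hc0.le hc1.le ?_
    have := Nat.mod_lt n hm
    have := Nat.mod_add_div n m
    omega
  calc ‖f^[n] w‖ ≤ Kj (n % m) * ‖(f^[m])^[n / m] w‖ := by
        rw [hsplit]
        exact (hball (by simpa using hlt)).2 _ hmem
    _ ≤ (∑ j ∈ Finset.range m, Kj j) * ((c ^ m) ^ (n / m) * ‖w‖) := by
        gcongr
        · exact Finset.single_le_sum (f := Kj) (fun j _ => (hKj j).le) hmem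
        · exact hiter _
    _ ≤ (∑ j ∈ Finset.range m, Kj j) * (((c ^ m)⁻¹ * c ^ n) * ‖w‖) := by gcongr
    _ = _ := by ring

/-- Gelfand's formula: the spectral radius is less than one, although the norm of the differential
itself need not be. Hence only a power is controlled. -/
theorem IsContracting.exists_norm_pow_lt [FiniteDimensional ℂ E] {f : E → E}
    (h : IsContracting f) :
    ∃ c : ℝ, 0 < c ∧ c < 1 ∧ ∃ m > 0, ‖(fderiv ℂ f 0) ^ m‖ < c ^ m := by
  have : CompleteSpace E := FiniteDimensional.complete ℂ E
  set A : E →L[ℂ] E := fderiv ℂ f 0 with hA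
  have hρ : spectralRadius ℂ A < 1 := by
    rcases subsingleton_or_nontrivial E with hE | hE
    · have : A = 0 := by ext x; exact Subsingleton.elim _ _
      rw [this]
      have : Subsingleton (E →L[ℂ] E) := ⟨fun a b => by ext x; exact Subsingleton.elim _ _⟩
      simp [spectralRadius, spectrum.of_subsingleton]
    · refine spectrum.spectralRadius_lt_of_forall_lt A (r := 1) fun k hk => ?_
      have h1 : k ∈ spectrum ℂ (A : E →ₗ[ℂ] E) := by
        have := AlgEquiv.spectrum_eq (Module.End.toContinuousLinearMap (𝕜 := ℂ) E).symm A
        rw [← this] at hk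
        exact hk
      have h2 := h k (Module.End.hasEigenvalue_iff_mem_spectrum.2 h1)
      rw [← NNReal.coe_lt_coe]
      simpa using h2
  obtain ⟨c, hc1, hc2⟩ := ENNReal.lt_iff_exists_nnreal_btwn.1 hρ
  have ht := spectrum.pow_nnnorm_pow_one_div_tendsto_nhds_spectralRadius A
  obtain ⟨m, hm1, hm2⟩ := ((ht.eventually_lt_const hc1).and (eventually_gt_atTop 0)).exists
  have hc0 : 0 < c := by
    have : (0 : ℝ≥0∞) < c := lt_of_le_of_lt (zero_le) hc1
    exact_mod_cast this
  refine ⟨c, hc0, by exact_mod_cast hc2, m, hm2, ?_⟩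
  have h3 : ((‖A ^ m‖₊ : ℝ≥0∞) ^ (1 / m : ℝ)) ^ m < (c : ℝ≥0∞) ^ m :=
    ENNReal.pow_lt_pow_left hm2.ne' hm1
  rw [← ENNReal.rpow_natCast, ← ENNReal.rpow_mul, one_div,
    inv_mul_cancel₀ (by exact_mod_cast hm2.ne'), ENNReal.rpow_one] at h3
  have h4 : ‖A ^ m‖₊ < c ^ m := by exact_mod_cast h3
  exact_mod_cast h4

variable {G : Type*} [NormedAddCommGroup G] [NormedSpace ℂ G]

/-- Iterating the equation gives `φ = T⁻ⁿ (φ ∘ Fⁿ)`, whose norm is at most a constant times `(‖T⁻¹‖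
c ^ N) ^ n`. -/
theorem ContractsWith.eventually_eq_zero {F : E → E} {c : ℝ} (hF : ContractsWith F c)
    (hc0 : 0 ≤ c) (hc1 : c < 1) (T : G ≃L[ℂ] G) {N : ℕ}
    (hT : ‖(T.symm : G →L[ℂ] G)‖ * c ^ N < 1) {φ : E → G}
    (hφ : φ =O[𝓝 0] fun w => ‖w‖ ^ N) (h : ∀ᶠ w in 𝓝 0, φ (F w) = T (φ w)) :
    ∀ᶠ w in 𝓝 0, φ w = 0 := by
  obtain ⟨K, hK, δ, hδ, H⟩ := hF
  obtain ⟨B, hB, hφB⟩ := hφ.exists_pos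
  obtain ⟨ε, hε, hball⟩ := Metric.eventually_nhds_iff.1 (h.and hφB.bound)
  rw [Metric.eventually_nhds_iff]
  -- This radius keeps the whole orbit in the `ε`-ball, where both the equation and the growth bound
  -- hold.
  refine ⟨min δ (ε / K), lt_min hδ (by positivity), fun w hw => ?_⟩
  rw [dist_zero_right] at hw
  have hwδ : ‖w‖ < δ := hw.trans_le (min_le_left _ _)
  have hwε : K * ‖w‖ < ε := by
    have := hw.trans_le (min_le_right _ _)
    rwa [lt_div_iff₀ hK, mul_comm] at this
  have horb : ∀ n, ‖F^[n] w‖ < ε := by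
    intro n
    refine (H n w hwδ).trans_lt (lt_of_le_of_lt ?_ hwε)
    have : c ^ n ≤ 1 := pow_le_one₀ hc0 hc1.le
    calc K * c ^ n * ‖w‖ ≤ K * 1 * ‖w‖ := by gcongr
      _ = _ := by ring
  set S : G →L[ℂ] G := (T.symm : G →L[ℂ] G) with hS
  have hiter : ∀ n, φ w = (S ^ n) (φ (F^[n] w)) := by
    intro n
    induction n with
    | zero => simp
    | succ n ih =>
      have h1 := (hball (y := F^[n] w) (by simpa using horb n)).1
      rw [Function.iterate_succ_apply', h1, pow_succ, ih]
      simp [hS]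
  have hle : ∀ n, ‖φ w‖ ≤ (B * (K * ‖w‖) ^ N) * (‖S‖ * c ^ N) ^ n := by
    intro n
    have h2 := (hball (y := F^[n] w) (by simpa using horb n)).2
    rw [norm_pow, norm_norm] at h2
    rw [hiter n]
    have hSn : ‖S ^ n‖ ≤ ‖S‖ ^ n := by
      rcases n with _ | n
      · exact (ContinuousLinearMap.norm_id_le (𝕜 := ℂ) (E := G))
      · exact norm_pow_le' S (Nat.succ_pos n)
    calc ‖(S ^ n) (φ (F^[n] w))‖ ≤ ‖S ^ n‖ * ‖φ (F^[n] w)‖ := ContinuousLinearMap.le_opNorm _ _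
      _ ≤ ‖S‖ ^ n * (B * (K * c ^ n * ‖w‖) ^ N) := by
          gcongr
          exact h2.trans (by gcongr; exact H n w hwδ)
      _ = _ := by simp only [mul_pow]; ring
  have hlim : Tendsto (fun n : ℕ => (B * (K * ‖w‖) ^ N) * (‖S‖ * c ^ N) ^ n) atTop (𝓝 0) := by
    simpa using (tendsto_pow_atTop_nhds_zero_of_lt_one (by positivity) hT).const_mul
      (B * (K * ‖w‖) ^ N)
  exact norm_le_zero_iff.1 (ge_of_tendsto' hlim hle)

end Contraction

/-! ### Generalized eigenvectors modulo an invariant subspace -/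

section GenEig

open Polynomial
open scoped Matrix

variable {K A : Type*} [Field K] [AddCommGroup A] [Module K A]

theorem aeval_mem_of_forall_mem {C : A →ₗ[K] A} {I : Submodule K A} (hI : ∀ a ∈ I, C a ∈ I)
    (χ : K[X]) {a : A} (ha : a ∈ I) : aeval C χ a ∈ I := by
  induction χ using Polynomial.induction_on' with
  | add p q hp hq => simpa using I.add_mem hp hq
  | monomial n c =>
    rw [aeval_monomial]
    have : (C ^ n) a ∈ I := by
      induction n with
      | zero => simpa using ha
      | succ n ih => rw [pow_succ']; exact hI _ ih
    simpa [Algebra.algebraMap_eq_smul_one] using I.smul_mem c this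

theorem aeval_mem_of_dvd {C : A →ₗ[K] A} {I : Submodule K A} (hI : ∀ a ∈ I, C a ∈ I)
    {χ χ' : K[X]} (h : χ ∣ χ') {a : A} (ha : aeval C χ a ∈ I) : aeval C χ' a ∈ I := by
  obtain ⟨r, rfl⟩ := h
  rw [mul_comm, map_mul]
  exact aeval_mem_of_forall_mem hI r ha

theorem mem_of_aeval_mem_of_isCoprime {C : A →ₗ[K] A} {I : Submodule K A}
    (hI : ∀ a ∈ I, C a ∈ I) {χ ψ : K[X]} (h : IsCoprime χ ψ) {a : A} (h1 : aeval C χ a ∈ I)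
    (h2 : aeval C ψ a ∈ I) : a ∈ I := by
  obtain ⟨s, t, hst⟩ := h
  have h3 : a = aeval C (s * χ) a + aeval C (t * ψ) a := by
    rw [← LinearMap.add_apply, ← map_add, hst, map_one, Module.End.one_apply]
  rw [h3]
  exact I.add_mem (aeval_mem_of_dvd hI (Dvd.intro_left _ rfl) h1)
    (aeval_mem_of_dvd hI (Dvd.intro_left _ rfl) h2)

/-- `a` is a generalized eigenvector of `C` modulo the subspace `I`. -/
def IsGenEig (C : A →ₗ[K] A) (I : Submodule K A) (μ : K) (a : A) : Prop :=
  ∃ n : ℕ, aeval C ((X - Polynomial.C μ) ^ n) a ∈ I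

theorem IsGenEig.mono {C : A →ₗ[K] A} {I J : Submodule K A} (h : I ≤ J) {μ : K} {a : A}
    (ha : IsGenEig C I μ a) : IsGenEig C J μ a :=
  ha.imp fun _ hn => h hn

theorem IsGenEig.apply {C : A →ₗ[K] A} {I : Submodule K A} (hI : ∀ a ∈ I, C a ∈ I) {μ : K} {a : A}
    (ha : IsGenEig C I μ a) : IsGenEig C I μ (C a) := by
  obtain ⟨n, hn⟩ := ha
  refine ⟨n, ?_⟩
  have : aeval C ((X - Polynomial.C μ) ^ n) (C a) = aeval C (X * (X - Polynomial.C μ) ^ n) a := by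
    rw [mul_comm, map_mul, aeval_X]; rfl
  rw [this]
  exact aeval_mem_of_dvd hI (Dvd.intro_left _ rfl) hn

theorem IsGenEig.add {C : A →ₗ[K] A} {I : Submodule K A} (hI : ∀ a ∈ I, C a ∈ I) {μ : K} {a b : A}
    (ha : IsGenEig C I μ a) (hb : IsGenEig C I μ b) : IsGenEig C I μ (a + b) := by
  obtain ⟨n, hn⟩ := ha
  obtain ⟨m, hm⟩ := hb
  refine ⟨n + m, ?_⟩
  rw [map_add]
  exact I.add_mem (aeval_mem_of_dvd hI (pow_dvd_pow _ (Nat.le_add_right _ _)) hn)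
    (aeval_mem_of_dvd hI (pow_dvd_pow _ (Nat.le_add_left _ _)) hm)

theorem IsGenEig.smul {C : A →ₗ[K] A} {I : Submodule K A} {μ : K} {a : A}
    (ha : IsGenEig C I μ a) (c : K) : IsGenEig C I μ (c • a) := by
  obtain ⟨n, hn⟩ := ha
  exact ⟨n, by rw [map_smul]; exact I.smul_mem c hn⟩

theorem isGenEig_zero (C : A →ₗ[K] A) (I : Submodule K A) (μ : K) : IsGenEig C I μ 0 :=
  ⟨0, by simp⟩

theorem IsGenEig.sum {C : A →ₗ[K] A} {I : Submodule K A} (hI : ∀ a ∈ I, C a ∈ I) {μ : K}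
    {ι : Type*} (s : Finset ι) {a : ι → A} (h : ∀ i ∈ s, IsGenEig C I μ (a i)) :
    IsGenEig C I μ (∑ i ∈ s, a i) := by
  classical
  induction s using Finset.induction_on with
  | empty => exact isGenEig_zero _ _ _
  | insert i s hi ih =>
    rw [Finset.sum_insert hi]
    exact (h i (Finset.mem_insert_self _ _)).add hI
      (ih fun j hj => h j (Finset.mem_insert_of_mem hj))

theorem IsGenEig.pow {C : A →ₗ[K] A} {I : Submodule K A} (hI : ∀ a ∈ I, C a ∈ I) {μ : K} {a : A}
    (ha : IsGenEig C I μ a) (k : ℕ) : IsGenEig (C ^ k) I (μ ^ k) a := by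
  obtain ⟨n, hn⟩ := ha
  refine ⟨n, ?_⟩
  have h1 : aeval (C ^ k) ((X - Polynomial.C (μ ^ k)) ^ n) =
      aeval C ((X ^ k - Polynomial.C μ ^ k) ^ n) := by simp
  rw [h1]
  exact aeval_mem_of_dvd hI (pow_dvd_pow_of_dvd (sub_dvd_pow_sub_pow _ _ _) n) hn

/-- Generalized eigenvectors lift along an intertwining map. -/
theorem exists_isGenEig_of_intertwining {V : Type*} [AddCommGroup V] [Module K V]
    {C : A →ₗ[K] A} {I : Submodule K A} (hI : ∀ a ∈ I, C a ∈ I)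
    {P : K[X]} (hP0 : P ≠ 0) (hP : ∀ a, aeval C P a ∈ I) {M : Module.End K V} {δ : A →ₗ[K] V}
    (hδ : ∀ a, δ (C a) = M (δ a)) {μ : K} {a₀ : A} {k : ℕ}
    (hy : aeval M ((X - Polynomial.C μ) ^ k) (δ a₀) = 0) :
    ∃ a, IsGenEig C I μ a ∧ δ a = δ a₀ := by
  have hint : ∀ (χ : K[X]) (a : A), δ (aeval C χ a) = aeval M χ (δ a) := by
    intro χ a
    induction χ using Polynomial.induction_on' with
    | add p q hp hq => simp [hp, hq]
    | monomial n c =>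
      have : δ ((C ^ n) a) = (M ^ n) (δ a) := by
        induction n with
        | zero => simp
        | succ n ih => rw [pow_succ', pow_succ', Module.End.mul_apply, Module.End.mul_apply, hδ, ih]
      simp [aeval_monomial, Algebra.algebraMap_eq_smul_one, this]
  -- Let `Q` be the part of `P` prime to `X - μ` and `s (X - μ) ^ k + t Q = 1`. Then `t Q` projects
  -- `a₀` onto its `μ`-component, and it fixes `δ a₀` because `(X - μ) ^ k` kills that vector.
  obtain ⟨Q, hQ, hQμ⟩ := Polynomial.exists_eq_pow_rootMultiplicity_mul_and_not_dvd P hP0 μ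
  have hcop : IsCoprime ((X - Polynomial.C μ) ^ k) Q :=
    IsCoprime.pow_left ((irreducible_X_sub_C μ).coprime_iff_not_dvd.2 hQμ)
  obtain ⟨s, t, hst⟩ := hcop
  refine ⟨aeval C (t * Q) a₀, ⟨P.rootMultiplicity μ, ?_⟩, ?_⟩
  · rw [← Module.End.mul_apply, ← map_mul]
    refine aeval_mem_of_dvd hI ?_ (hP a₀)
    exact ⟨t, by nth_rewrite 2 [hQ]; ring⟩
  · rw [hint]
    have h1 : aeval M (t * Q) (δ a₀) = aeval M (s * (X - Polynomial.C μ) ^ k + t * Q) (δ a₀) := by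
      rw [map_add, LinearMap.add_apply, map_mul _ s, Module.End.mul_apply, hy, map_zero, zero_add]
    rw [h1, hst, map_one, Module.End.one_apply]

/-- If `C - μ` maps `I` onto itself modulo `J`, then a generalized eigenvector modulo `I` can be
corrected to a generalized eigenvector modulo `J`. -/
theorem IsGenEig.exists_sub_mem {C : A →ₗ[K] A} {I J : Submodule K A}
    (hJ : ∀ a ∈ J, C a ∈ J) {μ : K} {a : A} (ha : IsGenEig C I μ a)
    (hsurj : ∀ e ∈ I, ∃ L ∈ I, C L - μ • L - e ∈ J) :
    ∃ a', IsGenEig C J μ a' ∧ a - a' ∈ I := by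
  obtain ⟨n, hn⟩ := ha
  have key : ∀ n : ℕ, ∀ e ∈ I, ∃ L ∈ I, aeval C ((X - Polynomial.C μ) ^ n) L - e ∈ J := by
    intro n
    induction n with
    | zero => exact fun e he => ⟨e, he, by simp⟩
    | succ n ih =>
      intro e he
      obtain ⟨L, hL, hLe⟩ := ih e he
      obtain ⟨L', hL', hLe'⟩ := hsurj L hL
      refine ⟨L', hL', ?_⟩
      have h1 : aeval C ((X - Polynomial.C μ) ^ (n + 1)) L' - e =
          aeval C ((X - Polynomial.C μ) ^ n) (C L' - μ • L' - L) +
            (aeval C ((X - Polynomial.C μ) ^ n) L - e) := by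
        rw [pow_succ, map_mul, Module.End.mul_apply]
        simp [Algebra.algebraMap_eq_smul_one]
      rw [h1]
      exact J.add_mem (aeval_mem_of_forall_mem hJ _ hLe') hLe
  obtain ⟨L, hL, hLe⟩ := key n _ hn
  refine ⟨a - L, ⟨n, ?_⟩, by simpa using hL⟩
  rw [map_sub, ← neg_sub]
  exact J.neg_mem hLe

/-- The factors `C - μ` are peeled off one at a time, and the vectors stay in `I`. This is the
uniqueness that complements `IsGenEig.exists_sub_mem`. -/
theorem IsGenEig.mem_of_injective {C : A →ₗ[K] A} {I J : Submodule K A} (hI : ∀ a ∈ I, C a ∈ I)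
    {μ : K} (hinj : ∀ a ∈ I, C a - μ • a ∈ J → a ∈ J) {a : A} (haI : a ∈ I)
    (ha : IsGenEig C J μ a) : a ∈ J := by
  obtain ⟨n, hn⟩ := ha
  induction n with
  | zero => simpa using hn
  | succ n ih =>
    refine ih (hinj _ (aeval_mem_of_forall_mem hI _ haI) ?_)
    rw [pow_succ', map_mul, Module.End.mul_apply] at hn
    simpa [Algebra.algebraMap_eq_smul_one] using hn

/-- Divide `P` by its gcd with `χ` until nothing in common is left; the degree drops each time.
Applied to an annihilator of jets, this separates the resonant part `P₁` from the part `P₂` on which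
`χ` can be inverted. -/
theorem Polynomial.exists_eq_mul_dvd_pow_isCoprime (χ : K[X]) {P : K[X]} (hP : P ≠ 0) :
    ∃ P₁ P₂ : K[X], ∃ n : ℕ, P = P₁ * P₂ ∧ P₁ ∣ χ ^ n ∧ IsCoprime P₂ χ := by
  classical
  induction hd : P.natDegree using Nat.strong_induction_on generalizing P with
  | _ d ih =>
    by_cases hcop : IsCoprime P χ
    · exact ⟨1, P, 0, by simp, by simp, hcop⟩
    · have hg : ¬ IsUnit (EuclideanDomain.gcd P χ) := fun h =>
        hcop (EuclideanDomain.gcd_isUnit_iff.1 h)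
      obtain ⟨P', hP'⟩ := EuclideanDomain.gcd_dvd_left P χ
      set g := EuclideanDomain.gcd P χ with hgdef
      have hg0 : g ≠ 0 := by rintro h0; rw [h0, zero_mul] at hP'; exact hP hP'
      have hP'0 : P' ≠ 0 := by rintro rfl; rw [mul_zero] at hP'; exact hP hP'
      have hgd : 0 < g.natDegree := by
        rw [Nat.pos_iff_ne_zero]
        intro h
        exact hg (isUnit_iff_degree_eq_zero.2 (by rw [degree_eq_natDegree hg0, h]; rfl))
      have hlt : P'.natDegree < d := by
        rw [← hd, hP', natDegree_mul hg0 hP'0]; omega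
      obtain ⟨P₁, P₂, n, h1, h2, h3⟩ := ih _ hlt hP'0 rfl
      refine ⟨g * P₁, P₂, n + 1, by rw [mul_assoc, ← h1, ← hP'], ?_, h3⟩
      rw [pow_succ']
      exact mul_dvd_mul (EuclideanDomain.gcd_dvd_right P χ) h2

/-- The cohomological equation `C L - Dᵀ L + e = b`, with `b` killed modulo `I` by a power of the
characteristic polynomial of `D`. -/
theorem exists_cohomological_solution {C : A →ₗ[K] A} {I : Submodule K A}
    (hI : ∀ a ∈ I, C a ∈ I) {P : K[X]} (hP0 : P ≠ 0) (hP : ∀ a, aeval C P a ∈ I)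
    {κ : Type*} [Fintype κ] [DecidableEq κ] (D : Matrix κ κ K) (e : κ → A) :
    ∃ L b : κ → A, (∀ k, C (L k) - ∑ l, D l k • L l + e k = b k) ∧
      (∃ n : ℕ, ∀ k, aeval C (D.charpoly ^ n) (b k) ∈ I) ∧
      ∀ J : Submodule K A, (∀ a ∈ J, C a ∈ J) → (∀ k, e k ∈ J) → (∀ k, L k ∈ J) ∧ ∀ k, b k ∈ J := by
  obtain ⟨P₁, P₂, n, hP12, hP1, hP2⟩ := Polynomial.exists_eq_mul_dvd_pow_isCoprime D.charpoly hP0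
  obtain ⟨t, s, hst⟩ := hP2
  -- The matrix `X - Dᵀ` divides its determinant. Substituting `C` for `X`, the adjugate inverts `C
  -- - Dᵀ` up to the characteristic polynomial of `D`.
  have hadj : Dᵀ.charmatrix * Dᵀ.charmatrix.adjugate = D.charpoly • (1 : Matrix κ κ K[X]) := by
    rw [Matrix.mul_adjugate, ← Matrix.charpoly, Matrix.charpoly_transpose]
  set R := Dᵀ.charmatrix.adjugate with hR
  have hrow : ∀ k j, X * R k j - ∑ l, Polynomial.C (D l k) * R l j =
      if k = j then D.charpoly else 0 := by
    intro k j
    have h1 := congrFun (congrFun hadj k) j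
    rw [Matrix.mul_apply, Matrix.smul_apply, Matrix.one_apply, smul_eq_mul, mul_ite, mul_one,
      mul_zero] at h1
    rw [← h1]
    simp only [Matrix.charmatrix_apply, sub_mul, Finset.sum_sub_distrib, Matrix.diagonal_apply,
      ite_mul, zero_mul, Finset.sum_ite_eq, Finset.mem_univ, if_true, Matrix.transpose_apply]
  -- By Bézout, `e = t P₂ e + s χ e` with `χ = D.charpoly`. The second summand is cancelled by `L`.
  -- The first is `b`, and `χ ^ n` kills it modulo `I` because `P = P₁ P₂` divides `χ ^ n P₂`.
  refine ⟨fun k => - ∑ j, aeval C (R k j * s) (e j), fun k => aeval C (t * P₂) (e k), ?_,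
    ⟨n, fun k => ?_⟩, ?_⟩
  · intro k
    have h2 : C (∑ j, aeval C (R k j * s) (e j)) - ∑ l, D l k • ∑ j, aeval C (R l j * s) (e j) =
        ∑ j, aeval C ((X * R k j - ∑ l, Polynomial.C (D l k) * R l j) * s) (e j) := by
      simp only [Finset.smul_sum, map_sum]
      rw [Finset.sum_comm, ← Finset.sum_sub_distrib]
      refine Finset.sum_congr rfl fun j _ => ?_
      simp only [sub_mul, Finset.sum_mul, map_sub, map_mul, map_sum, aeval_X, aeval_C,
        LinearMap.sub_apply, Module.End.mul_apply, LinearMap.sum_apply,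
        Module.algebraMap_end_apply]
    have h3 : ∑ j, aeval C ((X * R k j - ∑ l, Polynomial.C (D l k) * R l j) * s) (e j) =
        aeval C (s * D.charpoly) (e k) := by
      rw [Finset.sum_eq_single k]
      · rw [hrow, if_pos rfl, mul_comm]
      · intro j _ hj
        rw [hrow, if_neg hj.symm]
        simp
      · simp
    have h4 : e k = aeval C (t * P₂) (e k) + aeval C (s * D.charpoly) (e k) := by
      rw [← LinearMap.add_apply, ← map_add, hst, map_one, Module.End.one_apply]
    simp only [map_neg, smul_neg, Finset.sum_neg_distrib]
    rw [h3] at h2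
    have h5 : aeval C (t * P₂) (e k) = e k - aeval C (s * D.charpoly) (e k) :=
      eq_sub_of_add_eq h4.symm
    rw [h5, ← h2]
    abel
  · rw [← Module.End.mul_apply, ← map_mul]
    refine aeval_mem_of_dvd hI ?_ (hP (e k))
    rw [hP12, mul_comm t, ← mul_assoc]
    exact Dvd.dvd.mul_right (mul_dvd_mul hP1 dvd_rfl) _
  · exact fun J hJ he => ⟨fun k => J.neg_mem (J.sum_mem fun j _ =>
      aeval_mem_of_forall_mem hJ _ (he j)), fun k => aeval_mem_of_forall_mem hJ _ (he k)⟩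

end GenEig

/-! ### Products of generalized eigenvectors and resonant monomials -/

section GenEigAlgebra

open Polynomial

variable {K A : Type*} [Field K] [CommRing A] [Algebra K A]

/-- A twisted Leibniz rule for `C - μ ν`: each of its two terms lowers one of the two nilpotency
exponents, so induction on their sum applies. -/
theorem IsGenEig.mul {C : A →ₐ[K] A} {I : Ideal A}
    (hI : ∀ a ∈ I, C a ∈ I) {μ ν : K} {a b : A}
    (ha : IsGenEig C.toLinearMap (I.restrictScalars K) μ a)
    (hb : IsGenEig C.toLinearMap (I.restrictScalars K) ν b) :
    IsGenEig C.toLinearMap (I.restrictScalars K) (μ * ν) (a * b) := by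
  have hI' : ∀ a ∈ I.restrictScalars K, C.toLinearMap a ∈ I.restrictScalars K := hI
  obtain ⟨n, hn⟩ := ha
  obtain ⟨m, hm⟩ := hb
  induction hk : n + m generalizing n m a b with
  | zero =>
    obtain ⟨rfl, rfl⟩ : n = 0 ∧ m = 0 := by omega
    exact ⟨0, by simpa using I.mul_mem_left a (by simpa using hm)⟩
  | succ k ih =>
    have hmem : ∀ {a b : A}, a * b ∈ I →
        IsGenEig C.toLinearMap (I.restrictScalars K) (μ * ν) (a * b) :=
      fun h => ⟨0, by simpa using h⟩
    rcases n with _ | n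
    · exact hmem (I.mul_mem_right _ (by simpa using hn))
    rcases m with _ | m
    · exact hmem (I.mul_mem_left _ (by simpa using hm))
    -- `(C - μ ν) (a b) = ((C - μ) a) (C b) + μ a ((C - ν) b)`
    have key : C.toLinearMap (a * b) - (μ * ν) • (a * b) =
        (C a - μ • a) * C b + μ • (a * (C b - ν • b)) := by
      simp only [AlgHom.toLinearMap_apply, map_mul, Algebra.smul_def]
      ring
    have h1 : IsGenEig C.toLinearMap (I.restrictScalars K) (μ * ν) ((C a - μ • a) * C b) := by
      refine ih (n := n) ?_ (m := m + 1) ?_ (by omega)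
      · have : aeval C.toLinearMap ((X - Polynomial.C μ) ^ (n + 1)) a =
            aeval C.toLinearMap ((X - Polynomial.C μ) ^ n) (C a - μ • a) := by
          rw [pow_succ, map_mul, Module.End.mul_apply]
          simp [Algebra.algebraMap_eq_smul_one]
        rwa [← this]
      · have : aeval C.toLinearMap ((X - Polynomial.C ν) ^ (m + 1)) (C b) =
            aeval C.toLinearMap (X * (X - Polynomial.C ν) ^ (m + 1)) b := by
          rw [mul_comm, map_mul, aeval_X]; rfl
        rw [this]
        exact aeval_mem_of_dvd hI' (Dvd.intro_left _ rfl) hm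
    have h2 : IsGenEig C.toLinearMap (I.restrictScalars K) (μ * ν) (a * (C b - ν • b)) := by
      refine ih (n := n + 1) hn (m := m) ?_ (by omega)
      have : aeval C.toLinearMap ((X - Polynomial.C ν) ^ (m + 1)) b =
          aeval C.toLinearMap ((X - Polynomial.C ν) ^ m) (C b - ν • b) := by
        rw [pow_succ, map_mul, Module.End.mul_apply]
        simp [Algebra.algebraMap_eq_smul_one]
      rwa [← this]
    obtain ⟨N, hN⟩ := h1.add hI' (h2.smul μ)
    refine ⟨N + 1, ?_⟩
    rw [pow_succ, map_mul (aeval C.toLinearMap), Module.End.mul_apply]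
    have h3 : aeval C.toLinearMap (X - Polynomial.C (μ * ν)) (a * b) =
        C.toLinearMap (a * b) - (μ * ν) • (a * b) := by
      rw [map_sub, aeval_X, aeval_C, LinearMap.sub_apply, Module.algebraMap_end_apply]
    rw [h3, key]
    exact hN

theorem isGenEig_one (C : A →ₐ[K] A) (I : Ideal A) :
    IsGenEig C.toLinearMap (I.restrictScalars K) 1 1 :=
  ⟨1, by simp⟩

theorem IsGenEig.prod {C : A →ₐ[K] A} {I : Ideal A} (hI : ∀ a ∈ I, C a ∈ I) {ι : Type*}
    {ω : ι → K} {ξ : ι → A}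
    (h : ∀ i, IsGenEig C.toLinearMap (I.restrictScalars K) (ω i) (ξ i)) (n : ι →₀ ℕ) :
    IsGenEig C.toLinearMap (I.restrictScalars K) (n.prod fun i k => ω i ^ k)
      (n.prod fun i k => ξ i ^ k) := by
  have hpow : ∀ i k, IsGenEig C.toLinearMap (I.restrictScalars K) (ω i ^ k) (ξ i ^ k) := by
    intro i k
    induction k with
    | zero => simpa using isGenEig_one C I
    | succ k ih => rw [pow_succ, pow_succ]; exact ih.mul hI (h i)
  unfold Finsupp.prod
  classical
  induction n.support using Finset.induction_on with
  | empty => simpa using isGenEig_one C I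
  | insert i s hi ih =>
    rw [Finset.prod_insert hi, Finset.prod_insert hi]
    exact (hpow i _).mul hI ih

/-- If the algebra is generated, modulo `I`, by generalized eigenvectors `ξ i` of an endomorphism,
then an element killed by a polynomial `χ` in the endomorphism is a combination of monomials whose
eigenvalues are roots of `χ`. -/
theorem exists_mvPolynomial_of_aeval_mem {C : A →ₐ[K] A} {I : Ideal A} (hI : ∀ a ∈ I, C a ∈ I)
    {ι : Type*} {ω : ι → K} {ξ : ι → A}
    (h : ∀ i, IsGenEig C.toLinearMap (I.restrictScalars K) (ω i) (ξ i)) {a : A}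
    (hgen : ∃ P₀ : MvPolynomial ι K, a - MvPolynomial.aeval ξ P₀ ∈ I) {χ : K[X]}
    (ha : aeval C.toLinearMap χ a ∈ I) :
    ∃ P : MvPolynomial ι K, a - MvPolynomial.aeval ξ P ∈ I ∧
      ∀ n ∈ P.support, χ.eval (n.prod fun i k => ω i ^ k) = 0 := by
  classical
  have hI' : ∀ a ∈ I.restrictScalars K, C.toLinearMap a ∈ I.restrictScalars K := hI
  obtain ⟨P₀, hP₀⟩ := hgen
  set w : (ι →₀ ℕ) → K := fun n => n.prod fun i k => ω i ^ k with hw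
  have hmon : ∀ n (c : K), MvPolynomial.aeval ξ (MvPolynomial.monomial n c) =
      c • n.prod fun i k => ξ i ^ k := by
    intro n c
    rw [MvPolynomial.aeval_monomial, Algebra.smul_def]
  choose m hm using fun n => IsGenEig.prod hI h n
  -- The monomials of `P₀` are sorted by whether their eigenvalue is a root of `χ`. The claim is
  -- that the non-resonant part `P'` lies in the ideal.
  set s := P₀.support.filter fun n => χ.eval (w n) = 0 with hs
  set s' := P₀.support.filter fun n => ¬ χ.eval (w n) = 0 with hs'
  set P : MvPolynomial ι K := ∑ n ∈ s, MvPolynomial.monomial n (P₀.coeff n) with hP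
  set P' : MvPolynomial ι K := ∑ n ∈ s', MvPolynomial.monomial n (P₀.coeff n) with hP'
  have hsum : P₀ = P + P' := by
    rw [hP, hP', hs, hs', Finset.sum_filter_add_sum_filter_not]
    exact P₀.as_sum
  refine ⟨P, ?_, ?_⟩
  -- Modulo `I`, `a - P` equals `P'`, which is killed by the product over the non-resonant
  -- eigenvalues. It is also killed by a power of `χ`, since both `a` and `P` are. The two
  -- polynomials are coprime.
  · have hcop : IsCoprime (∏ n ∈ s', (X - Polynomial.C (w n)) ^ m n)
        (χ ^ (∑ n ∈ s, m n + 1)) := by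
      refine IsCoprime.prod_left fun n hn => (IsCoprime.pow ?_)
      rw [(irreducible_X_sub_C (w n)).coprime_iff_not_dvd, dvd_iff_isRoot]
      exact (Finset.mem_filter.1 hn).2
    refine mem_of_aeval_mem_of_isCoprime hI' hcop (a := a - MvPolynomial.aeval ξ P) ?_ ?_
    · have h1 : a - MvPolynomial.aeval ξ P =
          (a - MvPolynomial.aeval ξ P₀) + MvPolynomial.aeval ξ P' := by
        rw [hsum, map_add]; ring
      rw [h1, map_add]
      refine Submodule.add_mem _ (aeval_mem_of_forall_mem hI' _ hP₀) ?_
      rw [hP', map_sum, map_sum]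
      refine Submodule.sum_mem _ fun n hn => ?_
      rw [hmon, map_smul]
      refine Submodule.smul_mem _ _ (aeval_mem_of_dvd hI' ?_ (hm n))
      exact Finset.dvd_prod_of_mem (fun n => (X - Polynomial.C (w n)) ^ m n) hn
    · rw [map_sub]
      refine Submodule.sub_mem _ (aeval_mem_of_dvd hI' (dvd_pow_self _ (Nat.succ_ne_zero _)) ha) ?_
      rw [hP, map_sum, map_sum]
      refine Submodule.sum_mem _ fun n hn => ?_
      rw [hmon, map_smul]
      refine Submodule.smul_mem _ _ (aeval_mem_of_dvd hI' ?_ (hm n))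
      refine (pow_dvd_pow_of_dvd (dvd_iff_isRoot.2 (Finset.mem_filter.1 hn).2) (m n)).trans
        (pow_dvd_pow _ ?_)
      exact (Finset.single_le_sum (f := m) (fun _ _ => Nat.zero_le _) hn).trans (Nat.le_succ _)
  · intro n hn
    have : n ∈ s := by
      by_contra hns
      refine (MvPolynomial.mem_support_iff.1 hn) ?_
      rw [hP, MvPolynomial.coeff_sum]
      refine Finset.sum_eq_zero fun n' hn' => ?_
      rw [MvPolynomial.coeff_monomial, if_neg]
      rintro rfl
      exact hns hn'
    exact (Finset.mem_filter.1 this).2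

end GenEigAlgebra

/-! ### The cohomological equation for contracting germs -/

section ContractingGerm

open scoped ENNReal NNReal

/-- A holomorphic germ fixing `0` whose differential contracts at a rate better than `c`. -/
structure IsContractingGerm {E : Type*} [NormedAddCommGroup E] [NormedSpace ℂ E] (f : E → E)
    (c : ℝ) : Prop where
  analyticAt : AnalyticAt ℂ f 0
  map_zero : f 0 = 0
  pos : 0 < c
  lt_one : c < 1
  exists_norm_pow_lt : ∃ m > 0, ‖(fderiv ℂ f 0) ^ m‖ < c ^ m

variable {E G : Type*} [NormedAddCommGroup E] [NormedSpace ℂ E]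
  [NormedAddCommGroup G] [NormedSpace ℂ G] {f : E → E} {c : ℝ}

theorem IsContractingGerm.contractsWith (hf : IsContractingGerm f c) : ContractsWith f c := by
  obtain ⟨m, hm, h⟩ := hf.exists_norm_pow_lt
  exact contractsWith_of_norm_pow_lt hf.analyticAt hf.map_zero hf.pos hf.lt_one hm h

theorem AnalyticAt.isBigO_norm {F : Type*} [NormedAddCommGroup F] [NormedSpace ℂ F] {g : E → F}
    (hg : AnalyticAt ℂ g 0) (hg0 : g 0 = 0) : g =O[𝓝 0] fun w => ‖w‖ := by
  have := hg.differentiableAt.isBigO_sub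
  simpa [hg0] using this.norm_right

theorem tendsto_zero_of_analyticAt {F : Type*} [NormedAddCommGroup F] [NormedSpace ℂ F] {g : E → F}
    (hg : AnalyticAt ℂ g 0) (hg0 : g 0 = 0) : Tendsto g (𝓝 0) (𝓝 0) := by
  have := hg.continuousAt.tendsto
  rwa [hg0] at this

theorem Asymptotics.IsBigO.comp_analyticAt {F : Type*} [NormedAddCommGroup F] [NormedSpace ℂ F]
    {H : Type*} [NormedAddCommGroup H] {g : E → F} (hg : AnalyticAt ℂ g 0) (hg0 : g 0 = 0) {φ : F → H} {N : ℕ}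
    (hφ : φ =O[𝓝 0] fun w => ‖w‖ ^ N) : (fun w => φ (g w)) =O[𝓝 0] fun w => ‖w‖ ^ N :=
  (hφ.comp_tendsto (tendsto_zero_of_analyticAt hg hg0)).trans
    ((hg.isBigO_norm hg0).norm_left.pow N)

/-- The cohomological equation for a contracting germ, for data vanishing to sufficiently high
order. -/
theorem IsContractingGerm.exists_comp_eq [CompleteSpace G] (hf : IsContractingGerm f c) {N : ℕ}
    (T : G ≃L[ℂ] G) (hT : ‖(T.symm : G →L[ℂ] G)‖ * c ^ N < 1) {err : E → G}
    (herr : AnalyticAt ℂ err 0) (hN : err =O[𝓝 0] fun w => ‖w‖ ^ N) :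
    ∃ L : E → G, AnalyticAt ℂ L 0 ∧ (L =O[𝓝 0] fun w => ‖w‖ ^ N) ∧
      ∀ᶠ w in 𝓝 0, L (f w) = T (L w) - err w := by
  obtain ⟨m, hm, h⟩ := hf.exists_norm_pow_lt
  set S : G →L[ℂ] G := (T.symm : G →L[ℂ] G) with hS
  set U : G →L[ℂ] G := (T : G →L[ℂ] G) with hU
  have hSU : ∀ n x, (S ^ n) ((U ^ n) x) = x := by
    intro n
    induction n with
    | zero => simp
    | succ n ih =>
      intro x
      rw [pow_succ, pow_succ']
      simp only [mul_apply_eq_comp]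
      have : S (U ((U ^ n) x)) = (U ^ n) x := by simp [hS, hU]
      rw [this, ih]
  have hUS : ∀ n x, (U ^ n) ((S ^ n) x) = x := by
    intro n
    induction n with
    | zero => simp
    | succ n ih =>
      intro x
      rw [pow_succ, pow_succ']
      simp only [mul_apply_eq_comp]
      have : U (S ((S ^ n) x)) = (S ^ n) x := by simp [hS, hU]
      rw [this, ih]
  let Tm : G ≃L[ℂ] G := ContinuousLinearEquiv.equivOfInverse (U ^ m) (S ^ m) (hSU m) (hUS m)
  have hTm : ∀ x, Tm x = (U ^ m) x := fun _ => rfl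
  -- the datum for the `m`-th iterate
  obtain ⟨er, her0, hers⟩ : ∃ er : ℕ → E → G, er 0 = 0 ∧
      ∀ n w, er (n + 1) w = U (er n w) + err (f^[n] w) :=
    ⟨fun n => Nat.rec 0 (fun n e w => U (e w) + err (f^[n] w)) n, rfl, fun _ _ => rfl⟩
  have hiter := fun n => hf.analyticAt.iterate_of_map_zero hf.map_zero n
  have hiter0 : ∀ n, f^[n] 0 = 0 := fun n => Function.iterate_fixed hf.map_zero n
  have her : ∀ n, AnalyticAt ℂ (er n) 0 ∧ er n =O[𝓝 0] fun w => ‖w‖ ^ N := by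
    intro n
    induction n with
    | zero =>
      rw [her0]
      exact ⟨analyticAt_const, Asymptotics.isBigO_zero _ _⟩
    | succ n ih =>
      have h1 : er (n + 1) = fun w => U (er n w) + err (f^[n] w) := funext (hers n)
      rw [h1]
      exact ⟨((U.analyticAt _).comp ih.1).add (herr.comp_of_eq (hiter n) (hiter0 n)),
        ((U.isBigO_comp _ _).trans ih.2).add (hN.comp_analyticAt (hiter n) (hiter0 n))⟩
  -- `er n` is the sum of `U ^ (n - 1 - i) (err ∘ fⁱ)` over `i < n`, so this difference telescopes.
  have htel : ∀ n w, U (er n w) - er n (f w) = (U ^ n) (err w) - err (f^[n] w) := by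
    intro n
    induction n with
    | zero => simp [her0]
    | succ n ih =>
      intro w
      have h2 := ih w
      rw [hers, hers, map_add, pow_succ', mul_apply_eq_comp,
        ← Function.iterate_succ_apply f, ← sub_eq_zero]
      rw [← sub_eq_zero] at h2
      have h3 := congrArg U h2
      rw [_root_.map_zero, map_sub, map_sub, map_sub] at h3
      rw [← h3]
      abel
  have hTmS : (Tm.symm : G →L[ℂ] G) = S ^ m := rfl
  have hSm : ‖S ^ m‖ * (c ^ m) ^ N < 1 := by
    calc ‖S ^ m‖ * (c ^ m) ^ N ≤ ‖S‖ ^ m * (c ^ m) ^ N := by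
          gcongr
          · exact pow_nonneg (pow_nonneg hf.pos.le _) _
          · exact norm_pow_le' S hm
      _ = (‖S‖ * c ^ N) ^ m := by rw [mul_pow, ← pow_mul, ← pow_mul, mul_comm m]
      _ < 1 := pow_lt_one₀ (mul_nonneg (norm_nonneg _) (pow_nonneg hf.pos.le _)) hT hm.ne'
  have hcm : c ^ m ≤ 1 := pow_le_one₀ hf.pos.le hf.lt_one.le
  obtain ⟨a, ha⟩ : ∃ a : ℝ≥0, (a : ℝ) = c ^ m := ⟨⟨c ^ m, pow_nonneg hf.pos.le _⟩, rfl⟩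
  obtain ⟨L, hL, hLN, hLeq⟩ := exists_comp_eq_of_nnnorm_lt (hiter m) (hiter0 m)
    (a := a) (by rw [fderiv_iterate_zero hf.analyticAt hf.map_zero, ← NNReal.coe_lt_coe, ha]; exact h)
    (by rw [← NNReal.coe_le_coe, ha]; exact hcm) (her m).1 (her m).2 Tm
    (by rw [hTmS, ← NNReal.coe_lt_coe]; push_cast; rw [ha]; exact hSm)
  refine ⟨L, hL, hLN, ?_⟩
  have hft := tendsto_zero_of_analyticAt hf.analyticAt hf.map_zero
  -- `L` solves the equation for `f^[m]` only. Its defect for `f` satisfies the homogeneous equation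
  -- of `f^[m]` by `htel`, and it has order `N`, so it vanishes by uniqueness.
  have hzero : ∀ᶠ w in 𝓝 (0 : E), L (f w) - U (L w) + err w = 0 := by
    refine (hf.contractsWith.iterate m).eventually_eq_zero (pow_nonneg hf.pos.le _)
      (pow_lt_one₀ hf.pos.le hf.lt_one hm.ne') Tm (N := N) hSm ?_ ?_
    · exact ((hLN.comp_analyticAt hf.analyticAt hf.map_zero).sub
        ((U.isBigO_comp _ _).trans hLN)).add hN
    · filter_upwards [hLeq, hft.eventually hLeq] with w h1 h2
      have h3 : f (f^[m] w) = f^[m] (f w) := by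
        rw [← Function.iterate_succ_apply' f, Function.iterate_succ_apply f]
      rw [h3, h1, h2]
      simp only [hTm, map_add, map_sub]
      have h4 := htel m w
      have h5 : U ((U ^ m) (L w)) = (U ^ m) (U (L w)) := by
        rw [← mul_apply_eq_comp, ← mul_apply_eq_comp, ← pow_succ, pow_succ']
      have h6 : er m (f w) = U (er m w) - ((U ^ m) (err w) - err (f^[m] w)) := by
        rw [← h4]; abel
      rw [h6, h5]
      abel
  filter_upwards [hzero] with w hw
  have : L (f w) = (L (f w) - U (L w) + err w) + (U (L w) - err w) := by abel
  rw [this, hw, zero_add]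
  rfl

end ContractingGerm

/-! ### The algebra of functions holomorphic at the origin, with its pullback and differential -/

section GermAlgebra

variable (E : Type*) [NormedAddCommGroup E] [NormedSpace ℂ E]

/-- The algebra of functions that are holomorphic at `0`. -/
def germAlg : Subalgebra ℂ (E → ℂ) where
  carrier := {φ | AnalyticAt ℂ φ 0}
  mul_mem' := fun h h' => AnalyticAt.mul h h'
  add_mem' := fun h h' => AnalyticAt.add h h'
  algebraMap_mem' := fun _ => analyticAt_const

variable {E}

theorem germAlg.analyticAt (φ : germAlg E) : AnalyticAt ℂ (φ : E → ℂ) 0 := φ.2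

/-- The functions vanishing to order `N` at `0`. -/
def ordIdeal (E : Type*) [NormedAddCommGroup E] [NormedSpace ℂ E] (N : ℕ) : Ideal (germAlg E) where
  carrier := {φ | (φ : E → ℂ) =O[𝓝 0] fun w => ‖w‖ ^ N}
  add_mem' := fun h h' => Asymptotics.IsBigO.add h h'
  zero_mem' := Asymptotics.isBigO_zero _ _
  smul_mem' := fun φ ψ h => by
    have h1 : (φ : E → ℂ) =O[𝓝 0] fun _ => (1 : ℝ) := (germAlg.analyticAt φ).continuousAt.isBigO_one ℝ
    exact (h1.mul h).congr_right fun w => one_mul _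

/-- The functions vanishing near `0`. -/
def nullIdeal (E : Type*) [NormedAddCommGroup E] [NormedSpace ℂ E] : Ideal (germAlg E) where
  carrier := {φ | (φ : E → ℂ) =ᶠ[𝓝 0] 0}
  add_mem' := fun {a b} h h' => by
    filter_upwards [h, h'] with w h h'
    simp [h, h']
  zero_mem' := by simp
  smul_mem' := fun φ ψ h => by
    filter_upwards [h] with w h
    simp [h]

theorem mem_ordIdeal {N : ℕ} {φ : germAlg E} :
    φ ∈ ordIdeal E N ↔ (φ : E → ℂ) =O[𝓝 0] fun w => ‖w‖ ^ N := Iff.rfl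

theorem mem_nullIdeal {φ : germAlg E} : φ ∈ nullIdeal E ↔ ∀ᶠ w in 𝓝 0, (φ : E → ℂ) w = 0 := Iff.rfl

theorem nullIdeal_le_ordIdeal (N : ℕ) : nullIdeal E ≤ ordIdeal E N := fun _ h =>
  mem_ordIdeal.2 ((Asymptotics.isBigO_zero _ _).congr' (mem_nullIdeal.1 h |>.mono fun _ h => h.symm)
    EventuallyEq.rfl)

theorem ordIdeal_anti {N N' : ℕ} (h : N ≤ N') : ordIdeal E N' ≤ ordIdeal E N := fun φ hφ =>
  (mem_ordIdeal.1 hφ).trans (Asymptotics.IsBigO.of_norm_eventuallyLE (by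
    filter_upwards [Metric.ball_mem_nhds (0 : E) one_pos] with w hw
    have : ‖w‖ < 1 := by simpa using hw
    simpa using pow_le_pow_of_le_one (norm_nonneg w) this.le h))

theorem mul_mem_ordIdeal {N N' : ℕ} {φ ψ : germAlg E} (hφ : φ ∈ ordIdeal E N)
    (hψ : ψ ∈ ordIdeal E N') : φ * ψ ∈ ordIdeal E (N + N') := by
  rw [mem_ordIdeal] at *
  exact (hφ.mul hψ).congr_right fun w => (pow_add _ _ _).symm

theorem mem_ordIdeal_one {φ : germAlg E} : φ ∈ ordIdeal E 1 ↔ (φ : E → ℂ) 0 = 0 := by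
  rw [mem_ordIdeal]
  refine ⟨fun h => ?_, fun h => by simpa using (germAlg.analyticAt φ).isBigO_norm h⟩
  have := h.eq_zero_imp.self_of_nhds
  simpa using this

theorem mem_ordIdeal_zero (φ : germAlg E) : φ ∈ ordIdeal E 0 := by
  rw [mem_ordIdeal]
  simpa using (germAlg.analyticAt φ).continuousAt.isBigO_one ℝ

theorem pow_mem_ordIdeal {φ : germAlg E} (hφ : φ ∈ ordIdeal E 1) (k : ℕ) :
    φ ^ k ∈ ordIdeal E k := by
  induction k with
  | zero => exact mem_ordIdeal_zero _
  | succ k ih => rw [pow_succ]; exact mul_mem_ordIdeal ih hφ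

theorem prod_pow_mem_ordIdeal {ι : Type*} (s : Finset ι) {φ : ι → germAlg E}
    (hφ : ∀ i, φ i ∈ ordIdeal E 1) (n : ι → ℕ) :
    ∏ i ∈ s, φ i ^ n i ∈ ordIdeal E (∑ i ∈ s, n i) := by
  classical
  induction s using Finset.induction_on with
  | empty => exact mem_ordIdeal_zero _
  | insert i s hi ih =>
    rw [Finset.prod_insert hi, Finset.sum_insert hi]
    exact mul_mem_ordIdeal (pow_mem_ordIdeal (hφ i) _) ih

/-- Composition with a germ fixing `0`. -/
def germPullback (f : E → E) (hf : AnalyticAt ℂ f 0) (hf0 : f 0 = 0) :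
    germAlg E →ₐ[ℂ] germAlg E where
  toFun φ := ⟨fun w => (φ : E → ℂ) (f w), (germAlg.analyticAt φ).comp_of_eq hf hf0⟩
  map_one' := rfl
  map_mul' _ _ := rfl
  map_zero' := rfl
  map_add' _ _ := rfl
  commutes' _ := rfl

@[simp]
theorem germPullback_apply (f : E → E) (hf : AnalyticAt ℂ f 0) (hf0 : f 0 = 0) (φ : germAlg E)
    (w : E) : (germPullback f hf hf0 φ : E → ℂ) w = (φ : E → ℂ) (f w) := rfl

theorem germPullback_mem_ordIdeal {f : E → E} (hf : AnalyticAt ℂ f 0) (hf0 : f 0 = 0) {N : ℕ}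
    (φ : germAlg E) (hφ : φ ∈ ordIdeal E N) : germPullback f hf hf0 φ ∈ ordIdeal E N :=
  (mem_ordIdeal.1 hφ).comp_analyticAt hf hf0

theorem germPullback_mem_nullIdeal {f : E → E} (hf : AnalyticAt ℂ f 0) (hf0 : f 0 = 0)
    (φ : germAlg E) (hφ : φ ∈ nullIdeal E) : germPullback f hf hf0 φ ∈ nullIdeal E :=
  (tendsto_zero_of_analyticAt hf hf0).eventually (mem_nullIdeal.1 hφ)

theorem germPullback_pow_apply (f : E → E) (hf : AnalyticAt ℂ f 0) (hf0 : f 0 = 0) (n : ℕ)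
    (φ : germAlg E) (w : E) :
    ((germPullback f hf hf0 ^ n) φ : E → ℂ) w = (φ : E → ℂ) (f^[n] w) := by
  induction n generalizing φ with
  | zero => rfl
  | succ n ih =>
    rw [pow_succ, AlgHom.mul_apply, ih, Function.iterate_succ_apply']
    rfl

theorem AlgHom.toLinearMap_pow {A : Type*} [CommRing A] [Algebra ℂ A] (C : A →ₐ[ℂ] A) (n : ℕ) :
    (C ^ n).toLinearMap = C.toLinearMap ^ n := by
  induction n with
  | zero => rfl
  | succ n ih => rw [pow_succ, pow_succ, ← ih]; rfl

/-- The differential at `0`. -/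
noncomputable def germDeriv (E : Type*) [NormedAddCommGroup E] [NormedSpace ℂ E] :
    germAlg E →ₗ[ℂ] Module.Dual ℂ E where
  toFun φ := (fderiv ℂ (φ : E → ℂ) 0 : E →ₗ[ℂ] ℂ)
  map_add' φ ψ := by
    ext v
    have : fderiv ℂ ((φ + ψ : germAlg E) : E → ℂ) 0 = fderiv ℂ (φ : E → ℂ) 0 + fderiv ℂ (ψ : E → ℂ) 0 :=
      fderiv_add (germAlg.analyticAt φ).differentiableAt (germAlg.analyticAt ψ).differentiableAt
    rw [this]; rfl
  map_smul' c φ := by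
    ext v
    have : fderiv ℂ ((c • φ : germAlg E) : E → ℂ) 0 = c • fderiv ℂ (φ : E → ℂ) 0 :=
      fderiv_const_smul (germAlg.analyticAt φ).differentiableAt c
    rw [this]; rfl

theorem germDeriv_apply (φ : germAlg E) (v : E) : germDeriv E φ v = fderiv ℂ (φ : E → ℂ) 0 v := rfl

theorem germDeriv_mul (φ ψ : germAlg E) : germDeriv E (φ * ψ) =
    (φ : E → ℂ) 0 • germDeriv E ψ + (ψ : E → ℂ) 0 • germDeriv E φ := by
  ext v
  have : fderiv ℂ ((φ * ψ : germAlg E) : E → ℂ) 0 =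
      (φ : E → ℂ) 0 • fderiv ℂ (ψ : E → ℂ) 0 + (ψ : E → ℂ) 0 • fderiv ℂ (φ : E → ℂ) 0 :=
    fderiv_mul (germAlg.analyticAt φ).differentiableAt (germAlg.analyticAt ψ).differentiableAt
  rw [germDeriv_apply, this]
  rfl

theorem germDeriv_germPullback {f : E → E} (hf : AnalyticAt ℂ f 0) (hf0 : f 0 = 0) (φ : germAlg E) :
    germDeriv E (germPullback f hf hf0 φ) =
      Module.Dual.transpose (R := ℂ) (fderiv ℂ f 0 : E →ₗ[ℂ] E) (germDeriv E φ) := by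
  ext v
  have hφ : DifferentiableAt ℂ (φ : E → ℂ) (f 0) := by
    rw [hf0]; exact (germAlg.analyticAt φ).differentiableAt
  have : fderiv ℂ ((germPullback f hf hf0 φ : germAlg E) : E → ℂ) 0 =
      (fderiv ℂ (φ : E → ℂ) (f 0)).comp (fderiv ℂ f 0) :=
    fderiv_comp (0 : E) hφ hf.differentiableAt
  rw [germDeriv_apply, this, hf0]
  rfl

theorem germDeriv_eq_zero {φ : germAlg E} (hφ : φ ∈ ordIdeal E 2) : germDeriv E φ = 0 := by
  ext v
  have : HasFDerivAt (φ : E → ℂ) (0 : E →L[ℂ] ℂ) 0 := by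
    have h0 : (φ : E → ℂ) 0 = 0 := mem_ordIdeal_one.1 (ordIdeal_anti one_le_two hφ)
    rw [hasFDerivAt_iff_isLittleO_nhds_zero]
    simp only [zero_add, h0, sub_zero, zero_apply]
    exact (mem_ordIdeal.1 hφ).trans_isLittleO (Asymptotics.isLittleO_norm_pow_id one_lt_two)
  rw [germDeriv_apply, this.fderiv]
  rfl

theorem germAlg.aeval_apply {ι : Type*} (ξ : ι → germAlg E) (P : MvPolynomial ι ℂ) (w : E) :
    (MvPolynomial.aeval ξ P : germAlg E).1 w = MvPolynomial.eval (fun i => (ξ i : E → ℂ) w) P := by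
  induction P using MvPolynomial.induction_on with
  | C a => rw [MvPolynomial.aeval_C]; simp
  | add p q hp hq => rw [map_add, map_add, ← hp, ← hq]; rfl
  | mul_X p i hp => rw [map_mul, map_mul, ← hp, MvPolynomial.aeval_X, MvPolynomial.eval_X]; rfl

theorem germDeriv_aeval {ι : Type*} [Fintype ι] {ξ : ι → germAlg E}
    (hξ : ∀ i, (ξ i : E → ℂ) 0 = 0) (P : MvPolynomial ι ℂ) :
    germDeriv E (MvPolynomial.aeval ξ P) =
      ∑ i, P.coeff (Finsupp.single i 1) • germDeriv E (ξ i) := by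
  classical
  induction P using MvPolynomial.induction_on with
  | C a =>
    have h1 : germDeriv E (MvPolynomial.aeval ξ (MvPolynomial.C a)) = 0 := by
      rw [MvPolynomial.aeval_C]
      ext v
      have : fderiv ℂ ((algebraMap ℂ (germAlg E) a : germAlg E) : E → ℂ) 0 = 0 :=
        (hasFDerivAt_const a (0 : E)).fderiv
      rw [germDeriv_apply, this]
      rfl
    rw [h1]
    refine (Finset.sum_eq_zero fun i _ => ?_).symm
    rw [MvPolynomial.coeff_C, if_neg, zero_smul]
    intro h
    have := DFunLike.congr_fun h i
    simp at this
  | add p q hp hq => simp [hp, hq, add_smul, Finset.sum_add_distrib]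
  | mul_X p i hp =>
    rw [map_mul, germDeriv_mul, MvPolynomial.aeval_X, hξ i, zero_smul, add_zero, germAlg.aeval_apply]
    simp only [hξ]
    rw [Finset.sum_eq_single i]
    · congr 1
      rw [MvPolynomial.coeff_mul_X', if_pos (by simp), tsub_self]
      have : (fun _ : ι => (0 : ℂ)) = 0 := rfl
      rw [this, MvPolynomial.eval_zero]
      rfl
    · intro j _ hj
      rw [MvPolynomial.coeff_mul_X', if_neg, zero_smul]
      simp [hj.symm]
    · simp

end GermAlgebra

/-! ### Local coordinates, Taylor expansion and finite-dimensionality of jets -/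

section Coordinates

variable {E F : Type*} [NormedAddCommGroup E] [NormedSpace ℂ E]
  [NormedAddCommGroup F] [NormedSpace ℂ F]

/-- The inverse function theorem, together with analyticity of the local inverse. -/
theorem isLocalBiholomorphism_of_bijective [FiniteDimensional ℂ E] [FiniteDimensional ℂ F]
    {Φ : E → F} (hΦ : AnalyticAt ℂ Φ 0)
    (h0 : Φ 0 = 0) (hbij : Function.Bijective (fderiv ℂ Φ 0)) : IsLocalBiholomorphism Φ := by
  have : CompleteSpace E := FiniteDimensional.complete ℂ E
  have : CompleteSpace F := FiniteDimensional.complete ℂ F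
  let e : E ≃L[ℂ] F :=
    (LinearEquiv.ofBijective (fderiv ℂ Φ 0 : E →ₗ[ℂ] F) hbij).toContinuousLinearEquiv
  have he : (e : E →L[ℂ] F) = fderiv ℂ Φ 0 := by ext x; rfl
  have hst : HasStrictFDerivAt Φ (e : E →L[ℂ] F) 0 := by
    rw [he]
    exact hΦ.hasStrictFDerivAt
  set H := hst.toOpenPartialHomeomorph Φ with hH
  have hcoe : (H : E → F) = Φ := hst.toOpenPartialHomeomorph_coe
  have hmem : (0 : E) ∈ H.source := hst.mem_toOpenPartialHomeomorph_source
  have hsymm0 : H.symm 0 = 0 := by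
    have := H.left_inv hmem
    rwa [hcoe, h0] at this
  have htgt : (0 : F) ∈ H.target := by
    have := H.map_source hmem
    rwa [hcoe, h0] at this
  refine ⟨hΦ, h0, H.symm, ?_, hsymm0, ?_, ?_⟩
  · refine H.analyticAt_symm (i := e) htgt ?_ ?_
    · rw [hsymm0, hcoe]; exact hΦ
    · rw [hsymm0, hcoe, he]
  · filter_upwards [H.open_source.mem_nhds hmem] with x hx
    have := H.left_inv hx
    rwa [hcoe] at this
  · filter_upwards [H.open_target.mem_nhds htgt] with y hy
    have := H.right_inv hy
    rwa [hcoe] at this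

theorem IsLocalBiholomorphism.fderiv_injective {Φ : E → F} (h : IsLocalBiholomorphism Φ) :
    Function.Injective (fderiv ℂ Φ 0) := by
  obtain ⟨hΦ, h0, Ψ, hΨ, hΨ0, hl, -⟩ := h
  have h1 : HasFDerivAt (fun x => Ψ (Φ x)) ((fderiv ℂ Ψ 0).comp (fderiv ℂ Φ 0)) 0 := by
    refine HasFDerivAt.comp (0 : E) ?_ hΦ.differentiableAt.hasFDerivAt
    rw [h0]
    exact hΨ.differentiableAt.hasFDerivAt
  have h2 : HasFDerivAt (fun x => Ψ (Φ x)) (ContinuousLinearMap.id ℂ E) 0 :=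
    (hasFDerivAt_id (0 : E)).congr_of_eventuallyEq hl
  have h3 := h1.unique h2
  intro x y hxy
  have h4 := DFunLike.congr_fun h3 x
  have h5 := DFunLike.congr_fun h3 y
  simp only [ContinuousLinearMap.comp_apply, ContinuousLinearMap.id_apply] at h4 h5
  rw [← h4, ← h5, hxy]

/-- Taylor expansion in coordinates, with words in the coordinates as monomials. -/
theorem exists_taylor {ι : Type*} [Fintype ι] {φ : (ι → ℂ) → ℂ} (hφ : AnalyticAt ℂ φ 0) (N : ℕ) :
    ∃ a : ∀ k : Fin N, (Fin k → ι) → ℂ,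
      (fun y => φ y - ∑ k : Fin N, ∑ i : Fin k → ι, a k i * ∏ j, y (i j)) =O[𝓝 0]
        fun y => ‖y‖ ^ N := by
  classical
  obtain ⟨p, hp⟩ := hφ
  refine ⟨fun k i => p k fun j => Pi.single (i j) 1, ?_⟩
  refine (hp.isBigO_sub_partialSum_pow N).congr_left fun y => ?_
  rw [zero_add, FormalMultilinearSeries.partialSum, ← Fin.sum_univ_eq_sum_range fun k => p k fun _ => y]
  congr 1
  refine Finset.sum_congr rfl fun k _ => ?_
  have hy : (fun _ : Fin k => y) = fun _ => ∑ i, y i • Pi.single i (1 : ℂ) := by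
    funext _
    exact pi_eq_sum_univ' y
  rw [hy]
  have := (p k).toMultilinearMap.map_sum (fun (_ : Fin k) (i : ι) => y i • Pi.single i (1 : ℂ))
  refine this.trans (Finset.sum_congr rfl fun i _ => ?_)
  have h2 := (p k).toMultilinearMap.map_smul_univ (fun j => y (i j)) fun j => Pi.single (i j) (1 : ℂ)
  refine h2.trans ?_
  rw [smul_eq_mul, mul_comm]
  rfl

theorem exists_word_expansion {ι : Type*} [Fintype ι] {ξ : ι → germAlg E}
    (hξ : IsLocalBiholomorphism fun w i => (ξ i : E → ℂ) w) (φ : germAlg E) (N : ℕ) :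
    ∃ a : ∀ k : Fin N, (Fin k → ι) → ℂ,
      φ - ∑ k : Fin N, ∑ i : Fin k → ι, a k i • ∏ j, ξ (i j) ∈ ordIdeal E N := by
  obtain ⟨hΦ, h0, Ψ, hΨ, hΨ0, hl, -⟩ := hξ
  have hφΨ : AnalyticAt ℂ (fun y => (φ : E → ℂ) (Ψ y)) 0 :=
    (germAlg.analyticAt φ).comp_of_eq hΨ hΨ0
  obtain ⟨a, ha⟩ := exists_taylor hφΨ N
  refine ⟨a, mem_ordIdeal.2 ?_⟩
  refine (ha.comp_analyticAt hΦ h0).congr' ?_ EventuallyEq.rfl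
  filter_upwards [hl] with w hw
  simp only [hw]
  simp

theorem exists_aeval_sub_mem_ordIdeal {ι : Type*} [Fintype ι] {ξ : ι → germAlg E}
    (hξ : IsLocalBiholomorphism fun w i => (ξ i : E → ℂ) w) (φ : germAlg E) (N : ℕ) :
    ∃ P : MvPolynomial ι ℂ, φ - MvPolynomial.aeval ξ P ∈ ordIdeal E N := by
  obtain ⟨a, ha⟩ := exists_word_expansion hξ φ N
  refine ⟨∑ k : Fin N, ∑ i : Fin k → ι, a k i • ∏ j, MvPolynomial.X (i j), ?_⟩
  simpa [map_sum, map_prod] using ha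

/-- The jets of order `N` form a finite-dimensional space, so that every endomorphism of it is
killed by a polynomial. -/
theorem exists_aeval_mem_ordIdeal [FiniteDimensional ℂ E] (C : germAlg E →ₗ[ℂ] germAlg E) (N : ℕ)
    (hC : ∀ φ ∈ ordIdeal E N, C φ ∈ ordIdeal E N) :
    ∃ P : Polynomial ℂ, P ≠ 0 ∧ ∀ φ, Polynomial.aeval C P φ ∈ ordIdeal E N := by
  set I := (ordIdeal E N).restrictScalars ℂ with hI
  let b := Module.finBasis ℂ E
  let ξ : Fin (Module.finrank ℂ E) → germAlg E := fun i =>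
    ⟨fun w => b.repr w i, (LinearMap.toContinuousLinearMap (b.coord i)).analyticAt 0⟩
  have hξ : IsLocalBiholomorphism fun w i => (ξ i : E → ℂ) w := by
    have h1 : (fun w i => (ξ i : E → ℂ) w) = b.equivFun.toContinuousLinearEquiv := rfl
    rw [h1]
    refine isLocalBiholomorphism_of_bijective (ContinuousLinearEquiv.analyticAt _ _) (map_zero _) ?_
    rw [ContinuousLinearEquiv.fderiv]
    exact b.equivFun.toContinuousLinearEquiv.bijective
  -- By Taylor expansion, the words of length less than `N` in the linear coordinates span the jets.
  have hfin : Module.Finite ℂ (germAlg E ⧸ I) := by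
    refine ⟨Submodule.fg_def.2 ⟨Set.range fun x : (Σ k : Fin N, Fin k → Fin (Module.finrank ℂ E)) =>
      I.mkQ (∏ j, ξ (x.2 j)), Set.finite_range _, ?_⟩⟩
    rw [eq_top_iff]
    rintro x -
    obtain ⟨φ, rfl⟩ := I.mkQ_surjective x
    obtain ⟨a, ha⟩ := exists_word_expansion hξ φ N
    have h2 : I.mkQ φ = I.mkQ (∑ k : Fin N, ∑ i : Fin k → _, a k i • ∏ j, ξ (i j)) := by
      rw [← sub_eq_zero, ← map_sub]
      exact (Submodule.Quotient.mk_eq_zero I).2 ha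
    rw [h2, map_sum]
    refine Submodule.sum_mem _ fun k _ => ?_
    rw [map_sum]
    refine Submodule.sum_mem _ fun i _ => ?_
    rw [map_smul]
    exact Submodule.smul_mem _ _ (Submodule.subset_span ⟨⟨k, i⟩, rfl⟩)
  let C' : Module.End ℂ (germAlg E ⧸ I) := I.mapQ I C fun φ hφ => hC φ hφ
  -- Cayley–Hamilton for the endomorphism induced on jets.
  refine ⟨C'.charpoly, C'.charpoly_monic.ne_zero, fun φ => ?_⟩
  have hint : ∀ (χ : Polynomial ℂ), I.mkQ (Polynomial.aeval C χ φ) =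
      Polynomial.aeval C' χ (I.mkQ φ) := by
    intro χ
    induction χ using Polynomial.induction_on' with
    | add p q hp hq => rw [map_add, map_add, LinearMap.add_apply, LinearMap.add_apply, map_add, hp, hq]
    | monomial n c =>
      have : I.mkQ ((C ^ n) φ) = (C' ^ n) (I.mkQ φ) := by
        induction n with
        | zero => rfl
        | succ n ih => rw [pow_succ', pow_succ', Module.End.mul_apply, Module.End.mul_apply, ← ih]; rfl
      rw [Polynomial.aeval_monomial, Polynomial.aeval_monomial, Module.End.mul_apply,
        Module.End.mul_apply, ← this, Module.algebraMap_end_apply, Module.algebraMap_end_apply, map_smul]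
  have h3 := hint C'.charpoly
  rw [LinearMap.aeval_self_charpoly, LinearMap.zero_apply] at h3
  exact (Submodule.Quotient.mk_eq_zero I).1 h3

end Coordinates

/-! ### Bases of generalized eigenvectors -/

section Eigenbasis

open Polynomial

theorem Multiset.exists_equiv_of_map_univ_eq {ι κ α : Type*} [Fintype ι] [Fintype κ] {f : ι → α}
    {g : κ → α} (h : Multiset.map f Finset.univ.val = Multiset.map g Finset.univ.val) :
    ∃ e : ι ≃ κ, ∀ i, g (e i) = f i := by
  classical
  have hcard : ∀ c, Fintype.card {i // f i = c} = Fintype.card {j // g j = c} := by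
    intro c
    have h1 := congrArg (Multiset.count c) h
    rw [Multiset.count_map, Multiset.count_map] at h1
    rw [Fintype.card_subtype, Fintype.card_subtype]
    simpa [Finset.card, eq_comm] using h1
  exact ⟨Equiv.ofFiberEquiv fun c => Fintype.equivOfCardEq (hcard c),
    fun i => Equiv.ofFiberEquiv_map _ i⟩

variable {V : Type*} [AddCommGroup V] [Module ℂ V]

theorem isGenEig_bot_iff {M : Module.End ℂ V} {μ : ℂ} {x : V} :
    IsGenEig M ⊥ μ x ↔ x ∈ M.maxGenEigenspace μ := by
  rw [Module.End.mem_maxGenEigenspace]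
  refine exists_congr fun n => ?_
  rw [Submodule.mem_bot, map_pow, map_sub, aeval_X, aeval_C, Algebra.algebraMap_eq_smul_one]

theorem bot_invariant (M : Module.End ℂ V) : ∀ a ∈ (⊥ : Submodule ℂ V), M a ∈ (⊥ : Submodule ℂ V) := by
  rintro a ha
  rw [Submodule.mem_bot] at ha ⊢
  rw [ha, map_zero]

/-- The basis vectors with eigenvalue `c` are independent in the generalized eigenspace of `c`, so
they number at most the multiplicity of `c`. Comparing the totals with the degree forces equality.
-/
theorem roots_charpoly_of_isGenEig [FiniteDimensional ℂ V] {M : Module.End ℂ V} {ι : Type*}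
    [Fintype ι] (b : Module.Basis ι ℂ V) {μ : ι → ℂ} (h : ∀ i, IsGenEig M ⊥ (μ i) (b i)) :
    M.charpoly.roots = Multiset.map μ Finset.univ.val := by
  classical
  refine (Multiset.eq_of_le_of_card_le (Multiset.le_iff_count.2 fun c => ?_) ?_).symm
  · rw [count_roots, ← LinearMap.finrank_maxGenEigenspace_eq, Multiset.count_map]
    have hli : LinearIndependent ℂ fun i : {i // c = μ i} =>
        (⟨b i, isGenEig_bot_iff.1 (cast (congrArg (IsGenEig M ⊥ · (b i)) i.2.symm) (h i))⟩ :
          M.maxGenEigenspace c) := by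
      refine LinearIndependent.of_comp (M.maxGenEigenspace c).subtype ?_
      exact b.linearIndependent.comp _ Subtype.val_injective
    have := hli.fintype_card_le_finrank
    rw [Fintype.card_subtype] at this
    exact this
  · refine (card_roots' _).trans ?_
    rw [LinearMap.charpoly_natDegree, Module.finrank_eq_card_basis b]
    simp

theorem exists_basis_isGenEig [FiniteDimensional ℂ V] (M : Module.End ℂ V) :
    ∃ (b : Module.Basis (Fin (Module.finrank ℂ V)) ℂ V) (μ : Fin (Module.finrank ℂ V) → ℂ),
      ∀ i, IsGenEig M ⊥ (μ i) (b i) := by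
  classical
  have hint : DirectSum.IsInternal fun μ => M.maxGenEigenspace μ :=
    DirectSum.isInternal_submodule_of_iSupIndep_of_iSup_eq_top M.independent_maxGenEigenspace
      M.iSup_maxGenEigenspace_eq_top
  let b := hint.collectedBasis fun μ => Module.finBasis ℂ (M.maxGenEigenspace μ)
  have : Finite (Σ μ : ℂ, Fin (Module.finrank ℂ (M.maxGenEigenspace μ))) := Module.Finite.finite_basis b
  have := Fintype.ofFinite (Σ μ : ℂ, Fin (Module.finrank ℂ (M.maxGenEigenspace μ)))
  let e := Fintype.equivFinOfCardEq (Module.finrank_eq_card_basis b).symm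
  refine ⟨b.reindex e, fun i => (e.symm i).1, fun i => ?_⟩
  rw [isGenEig_bot_iff, Module.Basis.reindex_apply]
  exact hint.collectedBasis_mem _ _

/-- The partial sum over eigenvalues other than `lam` is killed by a product of powers of the
corresponding `X - μ i`, and also by a power of `X - lam`. These are coprime, so it vanishes. -/
theorem LinearIndependent.eq_zero_of_isGenEig_sum {ι : Type*} [Fintype ι] {M : Module.End ℂ V}
    {b : ι → V} (hb : LinearIndependent ℂ b) {μ : ι → ℂ} (h : ∀ i, IsGenEig M ⊥ (μ i) (b i))
    {lam : ℂ} {a : ι → ℂ} (hx : IsGenEig M ⊥ lam (∑ i, a i • b i)) {i : ι} (hi : μ i ≠ lam) :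
    a i = 0 := by
  classical
  choose m hm using h
  obtain ⟨n, hn⟩ := hx
  set s := Finset.univ.filter fun i => μ i ≠ lam with hs
  have hsplit : ∑ i, a i • b i = ∑ i ∈ s, a i • b i + ∑ i ∈ sᶜ, a i • b i :=
    (Finset.sum_add_sum_compl s _).symm
  have hcop : IsCoprime (∏ i ∈ s, (X - Polynomial.C (μ i)) ^ m i)
      ((X - Polynomial.C lam) ^ (n + ∑ i, m i)) := by
    refine IsCoprime.prod_left fun i hi => IsCoprime.pow ?_
    rw [(irreducible_X_sub_C (μ i)).coprime_iff_not_dvd, dvd_iff_isRoot, root_X_sub_C]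
    exact (Finset.mem_filter.1 hi).2.symm
  have h0 : ∑ i ∈ s, a i • b i ∈ (⊥ : Submodule ℂ V) := by
    refine mem_of_aeval_mem_of_isCoprime (bot_invariant M) hcop ?_ ?_
    · rw [map_sum]
      refine Submodule.sum_mem _ fun i hi => ?_
      rw [map_smul]
      exact Submodule.smul_mem _ _ (aeval_mem_of_dvd (bot_invariant M)
        (Finset.dvd_prod_of_mem (fun i => (X - Polynomial.C (μ i)) ^ m i) hi) (hm i))
    · rw [← sub_eq_iff_eq_add] at hsplit
      rw [← hsplit, map_sub]
      refine Submodule.sub_mem _ (aeval_mem_of_dvd (bot_invariant M)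
        (pow_dvd_pow _ (Nat.le_add_right _ _)) hn) ?_
      rw [map_sum]
      refine Submodule.sum_mem _ fun j hj => ?_
      have hj' : μ j = lam := by
        by_contra hne
        exact (Finset.mem_compl.1 hj) (Finset.mem_filter.2 ⟨Finset.mem_univ _, hne⟩)
      rw [map_smul, ← hj']
      refine Submodule.smul_mem _ _ (aeval_mem_of_dvd (bot_invariant M) (pow_dvd_pow _ ?_) (hm j))
      exact (Finset.single_le_sum (f := m) (fun _ _ => Nat.zero_le _) (Finset.mem_univ j)).trans
        (Nat.le_add_left _ _)
  rw [Submodule.mem_bot] at h0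
  exact linearIndependent_iff'.1 hb s a h0 i (Finset.mem_filter.2 ⟨Finset.mem_univ _, hi⟩)

theorem Matrix.isNilpotent_of_forall_row {ι : Type*} [Fintype ι] [DecidableEq ι] {N : Matrix ι ι ℂ}
    (h : ∀ i, ∃ n : ℕ, ∀ j, (N ^ n) i j = 0) : IsNilpotent N := by
  choose n hn using h
  refine ⟨∑ i, n i, ?_⟩
  ext i j
  obtain ⟨k, hk⟩ := Nat.exists_eq_add_of_le
    (Finset.single_le_sum (f := n) (fun _ _ => Nat.zero_le _) (Finset.mem_univ i))
  rw [hk, pow_add, Matrix.mul_apply]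
  simp [hn i]

/-- A matrix that describes, on a linearly independent family of generalized eigenvectors, the
difference of an endomorphism and its diagonal part, is nilpotent. -/
theorem isNilpotent_of_isGenEig {ι : Type*} [Fintype ι] [DecidableEq ι] {M : Module.End ℂ V}
    {b : ι → V} (hb : LinearIndependent ℂ b) {μ : ι → ℂ} (h : ∀ i, IsGenEig M ⊥ (μ i) (b i))
    {N : Matrix ι ι ℂ} (hN : ∀ k, M (b k) = μ k • b k + ∑ l, N k l • b l) : IsNilpotent N := by
  -- `M` preserves generalized eigenspaces, so `N` does not mix different eigenvalues.
  have hblock : ∀ k l, μ l ≠ μ k → N k l = 0 := by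
    intro k l hkl
    refine hb.eq_zero_of_isGenEig_sum h (lam := μ k) (a := fun l => N k l) ?_ hkl
    have : ∑ l, N k l • b l = M (b k) + (-μ k) • b k := by rw [hN k, neg_smul]; abel
    rw [this]
    exact ((h k).apply (bot_invariant M)).add (bot_invariant M) ((h k).smul _)
  refine Matrix.isNilpotent_of_forall_row fun k => ?_
  -- On the block of `μ k`, `N` is the matrix of `M - μ k`. The `k`-th row of `N ^ n` thus expresses
  -- `(M - μ k) ^ n (b k)`, which vanishes for large `n`.
  have hpow : ∀ n, (∀ l, μ l ≠ μ k → (N ^ n) k l = 0) ∧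
      aeval M ((X - Polynomial.C (μ k)) ^ n) (b k) = ∑ l, (N ^ n) k l • b l := by
    intro n
    induction n with
    | zero =>
      refine ⟨fun l hl => ?_, ?_⟩
      · rw [pow_zero, Matrix.one_apply_ne]
        rintro rfl
        exact hl rfl
      · simp [Matrix.one_apply]
    | succ n ih =>
      refine ⟨fun l hl => ?_, ?_⟩
      · rw [pow_succ, Matrix.mul_apply]
        refine Finset.sum_eq_zero fun j _ => ?_
        by_cases hj : μ j = μ k
        · rw [hblock j l (by rwa [hj]), mul_zero]
        · rw [ih.1 j hj, zero_mul]
      · rw [pow_succ', map_mul, Module.End.mul_apply, ih.2, map_sum]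
        have h1 : ∀ j, aeval M (X - Polynomial.C (μ k)) ((N ^ n) k j • b j) =
            ∑ l, ((N ^ n) k j * N j l) • b l := by
          intro j
          by_cases hj : μ j = μ k
          · rw [map_smul, map_sub, aeval_X, aeval_C, LinearMap.sub_apply,
              Module.algebraMap_end_apply, hN j, hj, add_sub_cancel_left, Finset.smul_sum]
            simp only [smul_smul]
          · simp [ih.1 j hj]
        simp only [h1]
        rw [Finset.sum_comm]
        refine Finset.sum_congr rfl fun l _ => ?_
        rw [← Finset.sum_smul, pow_succ, Matrix.mul_apply]
  obtain ⟨n, hn⟩ := h k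
  refine ⟨n, fun j => ?_⟩
  rw [Submodule.mem_bot, (hpow n).2] at hn
  exact Fintype.linearIndependent_iff.1 hb _ hn j

/-- Completion of an invariant independent family `u`, semisimple for a power of `M`, by
generalized eigenvectors. -/
theorem exists_adapted_eigenbasis [FiniteDimensional ℂ V] (M : Module.End ℂ V) {r : ℕ}
    {u : Fin r → V} (hu : LinearIndependent ℂ u)
    (hMu : ∀ i, M (u i) ∈ Submodule.span ℂ (Set.range u)) {η : ℕ} {c : Fin r → ℂ}
    (hc : ∀ i, (M ^ η) (u i) = c i • u i) (hc0 : ∀ i, c i ≠ 0) (hη : η ≠ 0) :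
    ∃ (e m : ℕ) (lam : Fin r ⊕ Fin e → ℂ) (b : Fin e ⊕ Fin m → V),
      LinearIndependent ℂ (Sum.elim u b) ∧ ⊤ ≤ Submodule.span ℂ (Set.range (Sum.elim u b)) ∧
      (∀ i, lam i ≠ 0) ∧ (∀ i, lam (Sum.inl i) ^ η = c i) ∧
      (∀ k, IsGenEig M ⊥ (lam (Sum.inr k)) (b (Sum.inl k))) ∧
      (∀ j, IsGenEig M ⊥ 0 (b (Sum.inr j))) ∧
      Multiset.map lam Finset.univ.val = M.charpoly.roots.filter (fun c => c ≠ 0) ∧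
      ∀ N : Matrix (Fin e) (Fin e) ℂ,
        (∀ k, M (b (Sum.inl k)) - lam (Sum.inr k) • b (Sum.inl k) - ∑ l, N k l • b (Sum.inl l) ∈
          Submodule.span ℂ (Set.range u)) → IsNilpotent N := by
  classical
  set W := Submodule.span ℂ (Set.range u) with hW
  have hMW : ∀ x ∈ W, M x ∈ W := by
    intro x hx
    have : W ≤ W.comap M := by
      rw [hW, Submodule.span_le]
      rintro _ ⟨i, rfl⟩
      exact hMu i
    exact this hx
  have hWr : Module.finrank ℂ W = r := by
    rw [hW, finrank_span_eq_card hu, Fintype.card_fin]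
  -- the restriction of `M` to the span of `u`
  let MW : Module.End ℂ W := M.restrict hMW
  obtain ⟨bW, μW, hbW⟩ := exists_basis_isGenEig MW
  let uW : Module.Basis (Fin r) ℂ W := Module.Basis.span hu
  have huW : ∀ i, (uW i : V) = u i := fun i =>
    congrArg Subtype.val (Module.Basis.span_apply hu i)
  have hMWpow : ∀ n (x : W), (((MW ^ n) x : W) : V) = (M ^ n) x := by
    intro n x
    induction n with
    | zero => rfl
    | succ n ih => rw [pow_succ', pow_succ', Module.End.mul_apply, Module.End.mul_apply, ← ih]; rfl
  -- Both sides list the eigenvalues of `MW ^ η`, once in the basis `u` and once in a basis of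
  -- generalized eigenvectors of `MW`.
  have hroots : Multiset.map c Finset.univ.val =
      Multiset.map (fun i => μW i ^ η) Finset.univ.val := by
    rw [← roots_charpoly_of_isGenEig (M := MW ^ η) bW fun i => (hbW i).pow (bot_invariant MW) η]
    refine (roots_charpoly_of_isGenEig (M := MW ^ η) uW fun i => ⟨1, ?_⟩).symm
    rw [Submodule.mem_bot, pow_one, map_sub, aeval_X, aeval_C, LinearMap.sub_apply,
      Module.algebraMap_end_apply, sub_eq_zero]
    refine Subtype.ext ?_
    rw [hMWpow, huW, hc, Submodule.coe_smul, huW]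
  -- The `u i` need not be generalized eigenvectors of `M`. The eigenvalues on their span are
  -- attached to them through `π`, so that the `η`-th powers are the `c i`.
  obtain ⟨π, hπ⟩ := Multiset.exists_equiv_of_map_univ_eq hroots
  -- the endomorphism of the quotient
  let MQ : Module.End ℂ (V ⧸ W) := W.mapQ W M hMW
  obtain ⟨bQ, μQ, hbQ⟩ := exists_basis_isGenEig MQ
  -- Non-zero eigenvalues on the quotient come first and will index `v`; the zero ones come last.
  let ε : Fin (Fintype.card {j // μQ j ≠ 0}) ⊕ Fin (Fintype.card {j // ¬ μQ j ≠ 0}) ≃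
      Fin (Module.finrank ℂ (V ⧸ W)) :=
    (Equiv.sumCongr (Fintype.equivFin _).symm (Fintype.equivFin _).symm).trans
      (Equiv.sumCompl fun j => μQ j ≠ 0)
  have hεl : ∀ k, μQ (ε (Sum.inl k)) ≠ 0 := fun k =>
    ((Fintype.equivFin {j // μQ j ≠ 0}).symm k).2
  have hεr : ∀ k, μQ (ε (Sum.inr k)) = 0 := fun k =>
    not_not.1 ((Fintype.equivFin {j // ¬ μQ j ≠ 0}).symm k).2
  have hlift : ∀ j, ∃ x : V, IsGenEig M ⊥ (μQ j) x ∧ W.mkQ x = bQ j := by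
    intro j
    obtain ⟨x₀, hx₀⟩ := W.mkQ_surjective (bQ j)
    obtain ⟨k, hk⟩ := hbQ j
    obtain ⟨x, hx, hxx⟩ := exists_isGenEig_of_intertwining (C := M) (bot_invariant M)
      M.charpoly_monic.ne_zero (fun a => by rw [LinearMap.aeval_self_charpoly]; simp)
      (M := MQ) (δ := W.mkQ) (fun a => rfl) (a₀ := x₀) (μ := μQ j) (k := k)
      (by rw [hx₀]; simpa using hk)
    exact ⟨x, hx, hxx.trans hx₀⟩
  choose x hx hxQ using hlift
  have hbx : LinearIndependent ℂ fun s => (Submodule.Quotient.mk (x (ε s)) : V ⧸ W) := by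
    have : (fun s => (Submodule.Quotient.mk (x (ε s)) : V ⧸ W)) = bQ ∘ ε := funext fun s => hxQ (ε s)
    rw [this]
    exact bQ.linearIndependent.comp _ ε.injective
  have hli : ∀ {ι : Type} (y : Module.Basis ι ℂ W),
      LinearIndependent ℂ (Sum.elim (fun i => (y i : V)) fun s => x (ε s)) := fun y =>
    LinearIndependent.sumElim_of_quotient y.linearIndependent _ hbx
  have hcard : Fintype.card (Fin (Module.finrank ℂ W) ⊕ (Fin (Fintype.card {j // μQ j ≠ 0}) ⊕
      Fin (Fintype.card {j // ¬ μQ j ≠ 0}))) = Module.finrank ℂ V := by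
    rw [Fintype.card_sum, Fintype.card_congr ε, Fintype.card_fin, Fintype.card_fin, add_comm]
    exact W.finrank_quotient_add_finrank
  have hliu : LinearIndependent ℂ (Sum.elim u fun s => x (ε s)) := by
    have := hli uW
    simpa only [huW] using this
  refine ⟨Fintype.card {j // μQ j ≠ 0}, Fintype.card {j // ¬ μQ j ≠ 0},
    Sum.elim (fun i => μW (π i)) fun k => μQ (ε (Sum.inl k)), fun s => x (ε s), hliu, ?_, ?_, ?_,
    ?_, ?_, ?_, ?_⟩
  · refine (hliu.span_eq_top_of_card_eq_finrank' ?_).ge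
    rw [← hcard]
    simp only [Fintype.card_sum, Fintype.card_fin, hWr]
  · rintro (i | k)
    · intro h0
      have h1 := hπ i
      simp only [Sum.elim_inl] at h0
      rw [h0, zero_pow hη] at h1
      exact hc0 i h1.symm
    · exact hεl k
  · exact hπ
  · exact fun k => hx _
  · intro j
    have := hx (ε (Sum.inr j))
    rwa [hεr] at this
  -- Multiplicities are counted in the basis `bW` of the span of `u`, since it consists of
  -- generalized eigenvectors.
  · have hfull := roots_charpoly_of_isGenEig (M := M)
      (basisOfLinearIndependentOfCardEqFinrank' _ (hli bW) hcard)
      (μ := Sum.elim μW fun s => μQ (ε s)) (by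
        rw [coe_basisOfLinearIndependentOfCardEqFinrank']
        rintro (i | s)
        · obtain ⟨k, hk⟩ := hbW i
          refine ⟨k, ?_⟩
          have hint : ∀ (χ : ℂ[X]) (y : W), ((aeval MW χ y : W) : V) = aeval M χ (y : V) := by
            intro χ y
            rw [aeval_eq_sum_range, aeval_eq_sum_range, LinearMap.sum_apply, LinearMap.sum_apply,
              AddSubmonoidClass.coe_finsetSum]
            refine Finset.sum_congr rfl fun j _ => ?_
            rw [LinearMap.smul_apply, LinearMap.smul_apply, Submodule.coe_smul, hMWpow]
          rw [Submodule.mem_bot] at hk ⊢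
          simp only [Sum.elim_inl]
          rw [← hint, hk]
          rfl
        · exact hx (ε s))
    rw [hfull]
    have hsum : ∀ {α β : Type} [Fintype α] [Fintype β] (F : α ⊕ β → ℂ),
        Multiset.map F Finset.univ.val = Multiset.map (fun a => F (Sum.inl a)) Finset.univ.val +
          Multiset.map (fun b => F (Sum.inr b)) Finset.univ.val := by
      intro α β _ _ F
      rw [← Finset.univ_disjSum_univ, Finset.val_disjSum, Multiset.disjSum, Multiset.map_add,
        Multiset.map_map, Multiset.map_map]
      rfl
    rw [hsum, hsum, hsum (fun s => _), Multiset.filter_add, Multiset.filter_add]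
    simp only [Sum.elim_inl, Sum.elim_inr]
    have h1 : Multiset.filter (fun c => c ≠ 0) (Multiset.map μW Finset.univ.val) =
        Multiset.map (fun i => μW (π i)) Finset.univ.val := by
      rw [Multiset.filter_eq_self.2]
      · have := Multiset.map_univ_val_equiv π
        rw [← this, Multiset.map_map]
        rfl
      · intro a ha h0
        obtain ⟨i, -, rfl⟩ := Multiset.mem_map.1 ha
        have h1 := hπ (π.symm i)
        rw [Equiv.apply_symm_apply, h0, zero_pow hη] at h1
        exact hc0 _ h1.symm
    have h2 : Multiset.filter (fun c => c ≠ 0)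
        (Multiset.map (fun k => μQ (ε (Sum.inl k))) Finset.univ.val) =
        Multiset.map (fun k => μQ (ε (Sum.inl k))) Finset.univ.val := by
      rw [Multiset.filter_eq_self]
      intro a ha
      obtain ⟨i, -, rfl⟩ := Multiset.mem_map.1 ha
      exact hεl i
    have h3 : Multiset.filter (fun c => c ≠ 0)
        (Multiset.map (fun k => μQ (ε (Sum.inr k))) Finset.univ.val) = 0 := by
      rw [Multiset.filter_eq_nil]
      intro a ha
      obtain ⟨i, -, rfl⟩ := Multiset.mem_map.1 ha
      exact not_not.2 (hεr i)
    rw [h1, h2, h3, add_zero]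
  -- Modulo the span of `u`, `N` describes `MQ` minus its diagonal part on generalized eigenvectors.
  · intro N hN
    refine isNilpotent_of_isGenEig (M := MQ) (b := fun k => bQ (ε (Sum.inl k)))
      (bQ.linearIndependent.comp _ (ε.injective.comp Sum.inl_injective))
      (fun k => hbQ (ε (Sum.inl k))) fun k => ?_
    have h1 := (Submodule.Quotient.mk_eq_zero W).2 (hN k)
    rw [← Submodule.mkQ_apply, map_sub, map_sub, sub_eq_zero, map_sum, sub_eq_iff_eq_add',
      map_smul] at h1
    simp only [map_smul, hxQ] at h1
    rw [Sum.elim_inr] at h1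
    refine Eq.trans ?_ h1
    change MQ (bQ _) = _
    rw [← hxQ]
    rfl

end Eigenbasis

/-! ### Combinatorics of the internal action -/

section InternalAction

/-- After a renumbering, an injective internal action is block triangular, with a permutation block
and a complementary block whose columns of sum one lower a height function. -/
theorem exists_block_decomposition {q : ℕ} (A : Matrix (Fin q) (Fin q) ℕ)
    (hdet : (A.map (Nat.cast : ℕ → ℤ)).det ≠ 0) :
    ∃ (r p : ℕ) (ε : Fin r ⊕ Fin p ≃ Fin q) (τ : Equiv.Perm (Fin r)) (Cm : Matrix (Fin r) (Fin p) ℕ)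
      (D : Matrix (Fin p) (Fin p) ℕ) (ht : Fin p → ℕ),
      (∀ l i, A (ε l) (ε (Sum.inl i)) = if l = Sum.inl (τ i) then 1 else 0) ∧
      (∀ i k, A (ε (Sum.inl i)) (ε (Sum.inr k)) = Cm i k) ∧
      (∀ l k, A (ε (Sum.inr l)) (ε (Sum.inr k)) = D l k) ∧
      (D.map (Nat.cast : ℕ → ℤ)).det ≠ 0 ∧
      ∀ k, 2 ≤ ∑ i, Cm i k + ∑ l, D l k ∨
        ∃ l, ht l < ht k ∧ (∀ i, Cm i k = 0) ∧ ∀ j, D j k = if j = l then 1 else 0 := by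
  classical
  -- A column equal to the unit vector of `l` sends `k` to `l`. `S n` consists of the indices from
  -- which `n` such moves are possible. The permuted indices are those in every `S n`, and the
  -- height of any other is the first `n` at which it drops out.
  obtain ⟨S, hS0, hSs⟩ : ∃ S : ℕ → Set (Fin q), S 0 = Set.univ ∧
      ∀ n, S (n + 1) = {k | ∃ l ∈ S n, ∀ j, A j k = if j = l then 1 else 0} :=
    ⟨fun n => Nat.rec Set.univ (fun _ T => {k | ∃ l ∈ T, ∀ j, A j k = if j = l then 1 else 0}) n,
      rfl, fun _ => rfl⟩
  let Rec : Fin q → Prop := fun k => ∀ n, k ∈ S n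
  have hRec : ∀ k, Rec k → ∃ l, Rec l ∧ ∀ j, A j k = if j = l then 1 else 0 := by
    intro k hk
    have h1 := hk 1
    rw [hSs] at h1
    obtain ⟨l, -, hl⟩ := h1
    refine ⟨l, fun n => ?_, hl⟩
    have h2 := hk (n + 1)
    rw [hSs] at h2
    obtain ⟨l', hl', hl'2⟩ := h2
    have : l = l' := by
      by_contra hne
      have h3 := hl l
      rw [hl'2 l, if_neg hne, if_pos rfl] at h3
      exact zero_ne_one h3
    rwa [this]
  let ε : Fin (Fintype.card {k // Rec k}) ⊕ Fin (Fintype.card {k // ¬ Rec k}) ≃ Fin q :=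
    (Equiv.sumCongr (Fintype.equivFin _).symm (Fintype.equivFin _).symm).trans
      (Equiv.sumCompl Rec)
  have hεl : ∀ i, Rec (ε (Sum.inl i)) := fun i => ((Fintype.equivFin {k // Rec k}).symm i).2
  have hεr : ∀ k, ¬ Rec (ε (Sum.inr k)) := fun k => ((Fintype.equivFin {k // ¬ Rec k}).symm k).2
  have hεl' : ∀ k, Rec k → ∃ i, ε (Sum.inl i) = k := by
    intro k hk
    obtain ⟨s, rfl⟩ := ε.surjective k
    rcases s with i | j
    · exact ⟨i, rfl⟩
    · exact absurd hk (hεr j)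
  have hτ : ∀ i, ∃ i', ∀ l, A (ε l) (ε (Sum.inl i)) = if l = Sum.inl i' then 1 else 0 := by
    intro i
    obtain ⟨l, hl, hcol⟩ := hRec _ (hεl i)
    obtain ⟨i', rfl⟩ := hεl' l hl
    exact ⟨i', fun l => by rw [hcol]; simp only [ε.injective.eq_iff]⟩
  choose t ht using hτ
  -- Two indices with the same image would give two equal columns. Being injective on a finite set,
  -- `t` is a permutation.
  have htinj : Function.Injective t := by
    intro i i' h
    by_contra hne
    refine hdet (Matrix.det_zero_of_column_eq
      (i := ε (Sum.inl i)) (j := ε (Sum.inl i')) (fun h => hne ?_) fun l => ?_)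
    · exact Sum.inl_injective (ε.injective h)
    · obtain ⟨l, rfl⟩ := ε.surjective l
      rw [Matrix.map_apply, Matrix.map_apply, ht, ht, h]
  have hex : ∀ k, ¬ Rec k → ∃ n, k ∉ S n := fun k hk => not_forall.1 hk
  refine ⟨_, _, ε, Equiv.ofBijective t (Finite.injective_iff_bijective.1 htinj),
    Matrix.of fun i k => A (ε (Sum.inl i)) (ε (Sum.inr k)),
    Matrix.of fun l k => A (ε (Sum.inr l)) (ε (Sum.inr k)),
    fun k => Nat.find (hex _ (hεr k)), fun l i => ht i l, fun _ _ => rfl, fun _ _ => rfl, ?_, ?_⟩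
  · intro h0
    refine hdet ?_
    rw [← Matrix.det_submatrix_equiv_self ε]
    have hblock : (A.map (Nat.cast : ℕ → ℤ)).submatrix ε ε = Matrix.fromBlocks
        ((A.map (Nat.cast : ℕ → ℤ)).submatrix (ε ∘ Sum.inl) (ε ∘ Sum.inl))
        ((A.map (Nat.cast : ℕ → ℤ)).submatrix (ε ∘ Sum.inl) (ε ∘ Sum.inr)) 0
        ((Matrix.of fun l k => A (ε (Sum.inr l)) (ε (Sum.inr k))).map (Nat.cast : ℕ → ℤ)) := by
      ext (i | l) (j | k)
      · rfl
      · rfl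
      · simp [ht]
      · rfl
    rw [hblock, Matrix.det_fromBlocks_zero₂₁, h0, mul_zero]
  · intro k
    have hsum : ∑ i, A (ε (Sum.inl i)) (ε (Sum.inr k)) + ∑ l, A (ε (Sum.inr l)) (ε (Sum.inr k)) =
        ∑ j, A j (ε (Sum.inr k)) := by
      rw [← Fintype.sum_sum_type (fun s => A (ε s) (ε (Sum.inr k)))]
      exact ε.sum_comp fun j => A j (ε (Sum.inr k))
    simp only [Matrix.of_apply]
    rw [hsum]
    by_cases hunit : ∃ l, ∀ j, A j (ε (Sum.inr k)) = if j = l then 1 else 0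
    · right
      obtain ⟨l, hl⟩ := hunit
      have hspec := Nat.find_spec (hex _ (hεr k))
      obtain ⟨n, hn⟩ : ∃ n, Nat.find (hex _ (hεr k)) = n + 1 := by
        refine Nat.exists_eq_succ_of_ne_zero fun h0 => ?_
        rw [h0, hS0] at hspec
        exact hspec (Set.mem_univ _)
      rw [hn, hSs] at hspec
      have hln : l ∉ S n := fun hmem => hspec ⟨l, hmem, hl⟩
      obtain ⟨l', rfl⟩ : ∃ l', ε (Sum.inr l') = l := by
        obtain ⟨s, rfl⟩ := ε.surjective l
        rcases s with i | j
        · exact absurd (hεl i n) hln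
        · exact ⟨j, rfl⟩
      -- If `k` drops out at stage `n + 1`, its image is already missing from `S n`, so it is not
      -- permuted and has smaller height.
      refine ⟨l', ?_, fun i => ?_, fun j => ?_⟩
      · rw [hn]
        exact Nat.lt_succ_of_le (Nat.find_min' _ hln)
      · rw [hl, if_neg]
        exact fun h => by simpa using ε.injective h
      · rw [hl]
        exact if_congr ⟨fun h => Sum.inr_injective (ε.injective h), fun h => by rw [h]⟩ rfl rfl
    -- The column is non-zero since the determinant is. As it is not a unit vector, it has an entry
    -- at least two or two non-zero entries.
    · left
      push Not at hunit
      obtain ⟨l, hl⟩ : ∃ l, A l (ε (Sum.inr k)) ≠ 0 := by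
        by_contra hall
        push Not at hall
        exact hdet (Matrix.det_eq_zero_of_column_eq_zero (ε (Sum.inr k)) fun j => by simp [hall])
      obtain ⟨j, hj⟩ := hunit l
      by_cases hjl : j = l
      · subst hjl
        rw [if_pos rfl] at hj
        have : A j (ε (Sum.inr k)) ≤ ∑ j, A j (ε (Sum.inr k)) := Finset.single_le_sum (f := fun j => A j (ε (Sum.inr k))) (fun _ _ => Nat.zero_le _)
          (Finset.mem_univ j)
        omega
      · rw [if_neg hjl] at hj
        have := Finset.sum_le_univ_sum_of_nonneg (f := fun j => A j (ε (Sum.inr k)))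
          (fun _ => Nat.zero_le _) (s := {l, j})
        rw [Finset.sum_pair (Ne.symm hjl)] at this
        omega

end InternalAction

/-! ### Resonant polynomials in the presence of nilpotent generators -/

section ResonantPolynomials

open Polynomial

variable {K A : Type*} [Field K] [CommRing A] [Algebra K A]

theorem IsGenEig.aeval {C : A →ₐ[K] A} {I : Ideal A} (hI : ∀ a ∈ I, C a ∈ I) {ι : Type*}
    {ω : ι → K} {ξ : ι → A}
    (h : ∀ i, IsGenEig C.toLinearMap (I.restrictScalars K) (ω i) (ξ i)) {μ : K}
    {P : MvPolynomial ι K} (hP : ∀ n ∈ P.support, (n.prod fun i k => ω i ^ k) = μ) :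
    IsGenEig C.toLinearMap (I.restrictScalars K) μ (MvPolynomial.aeval ξ P) := by
  rw [P.as_sum, map_sum]
  refine IsGenEig.sum hI _ fun n hn => ?_
  rw [MvPolynomial.aeval_monomial, ← Algebra.smul_def, ← hP n hn]
  exact (IsGenEig.prod hI h n).smul _

/-- A variant of `exists_mvPolynomial_of_aeval_mem` in which the generators with eigenvalue zero do
not occur in the result. -/
theorem exists_mvPolynomial_of_aeval_mem' {C : A →ₐ[K] A} {I : Ideal A} (hI : ∀ a ∈ I, C a ∈ I)
    {ι κ : Type*} {ω : ι → K} {ξ : ι → A} {ζ : κ → A}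
    (h : ∀ i, IsGenEig C.toLinearMap (I.restrictScalars K) (ω i) (ξ i))
    (hζ : ∀ j, IsGenEig C.toLinearMap (I.restrictScalars K) 0 (ζ j)) {a : A}
    (hgen : ∃ P₀ : MvPolynomial (ι ⊕ κ) K, a - MvPolynomial.aeval (Sum.elim ξ ζ) P₀ ∈ I) {χ : K[X]}
    (hχ : χ.eval 0 ≠ 0) (ha : aeval C.toLinearMap χ a ∈ I) :
    ∃ P : MvPolynomial ι K, a - MvPolynomial.aeval ξ P ∈ I ∧
      ∀ n ∈ P.support, χ.eval (n.prod fun i k => ω i ^ k) = 0 := by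
  classical
  have hsum : ∀ s, IsGenEig C.toLinearMap (I.restrictScalars K)
      ((Sum.elim ω 0 : ι ⊕ κ → K) s) (Sum.elim ξ ζ s) := by
    rintro (i | j)
    · exact h i
    · exact hζ j
  obtain ⟨P, hP, hPn⟩ := exists_mvPolynomial_of_aeval_mem hI hsum hgen ha
  -- A monomial containing some `ζ j` has eigenvalue zero, which is not a root of `χ`.
  have hvars : (P.vars : Set (ι ⊕ κ)) ⊆ Set.range Sum.inl := by
    intro s hs
    obtain ⟨n, hn, hns⟩ := (MvPolynomial.mem_vars_iff_mem_support s).1 hs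
    rcases s with i | j
    · exact ⟨i, rfl⟩
    · refine absurd (hPn n hn) ?_
      have : (n.prod fun s k => (Sum.elim ω 0 : ι ⊕ κ → K) s ^ k) = 0 := by
        refine Finset.prod_eq_zero hns ?_
        simp only [Sum.elim_inr, Pi.zero_apply]
        exact zero_pow (Finsupp.mem_support_iff.1 hns)
      rwa [this]
  obtain ⟨Q, rfl⟩ := MvPolynomial.exists_rename_eq_of_vars_subset_range P Sum.inl
    Sum.inl_injective hvars
  refine ⟨Q, ?_, fun n hn => ?_⟩
  · rwa [MvPolynomial.aeval_rename, Sum.elim_comp_inl] at hP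
  · have h1 : n.mapDomain Sum.inl ∈ (MvPolynomial.rename (Sum.inl : ι → ι ⊕ κ) Q).support := by
      rw [MvPolynomial.support_rename_of_injective Sum.inl_injective]
      exact Finset.mem_image_of_mem _ hn
    have h2 := hPn _ h1
    rwa [Finsupp.prod_mapDomain_index_inj Sum.inl_injective] at h2

end ResonantPolynomials

/-! ### Scalar and multiplicative equations for germs -/

section GermEquations

variable {E : Type*} [NormedAddCommGroup E] [NormedSpace ℂ E] {f : E → E} {c : ℝ}

theorem germAlg.exists_log (v : germAlg E) (hv : (v : E → ℂ) 0 ≠ 0) :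
    ∃ Φ : germAlg E, (Φ : E → ℂ) 0 = 0 ∧
      ∀ᶠ w in 𝓝 0, (v : E → ℂ) w = (v : E → ℂ) 0 * Complex.exp ((Φ : E → ℂ) w) := by
  have h1 : AnalyticAt ℂ (fun w => (v : E → ℂ) w / (v : E → ℂ) 0) 0 :=
    (germAlg.analyticAt v).div analyticAt_const hv
  have h2 : (v : E → ℂ) 0 / (v : E → ℂ) 0 = 1 := div_self hv
  refine ⟨⟨fun w => Complex.log ((v : E → ℂ) w / (v : E → ℂ) 0),
    h1.clog (by simp [h2, Complex.one_mem_slitPlane])⟩, by simp [h2], ?_⟩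
  have h3 : ∀ᶠ w in 𝓝 (0 : E), (v : E → ℂ) w / (v : E → ℂ) 0 ≠ 0 :=
    h1.continuousAt.eventually_ne (by simp [h2])
  filter_upwards [h3] with w hw
  simp only [Complex.exp_log hw]
  field_simp

theorem germAlg.pi_analyticAt {κ : Type*} [Fintype κ] (φ : κ → germAlg E) :
    AnalyticAt ℂ (fun w k => (φ k : E → ℂ) w) 0 :=
  analyticAt_pi_iff.2 fun k => germAlg.analyticAt (φ k)

/-- Solution of the cohomological equation `C L = T L - e` in the algebra of germs. -/
theorem IsContractingGerm.exists_germ_solution {κ : Type*} [Fintype κ] (hf : IsContractingGerm f c)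
    (T : (κ → ℂ) ≃L[ℂ] (κ → ℂ)) {N : ℕ} (hT : ‖(T.symm : (κ → ℂ) →L[ℂ] (κ → ℂ))‖ * c ^ N < 1)
    (e : κ → germAlg E) (he : ∀ k, e k ∈ ordIdeal E N) :
    ∃ L : κ → germAlg E, (∀ k, L k ∈ ordIdeal E N) ∧
      ∀ᶠ w in 𝓝 0, ∀ k, (L k : E → ℂ) (f w) =
        T (fun l => (L l : E → ℂ) w) k - (e k : E → ℂ) w := by
  obtain ⟨L, hL, hLN, hLeq⟩ := hf.exists_comp_eq T hT (germAlg.pi_analyticAt e)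
    (Asymptotics.isBigO_pi.2 fun k => mem_ordIdeal.1 (he k))
  refine ⟨fun k => ⟨fun w => L w k, analyticAt_pi_iff.1 hL k⟩,
    fun k => mem_ordIdeal.2 (Asymptotics.isBigO_pi.1 hLN k), ?_⟩
  filter_upwards [hLeq] with w hw k
  exact congrFun hw k

/-- The surjectivity of `C - μ` on functions of high order that `IsGenEig.exists_sub_mem` requires.
-/
theorem IsContractingGerm.exists_germ_solution_scalar (hf : IsContractingGerm f c)
    {μ : ℂ} (hμ : μ ≠ 0) {N : ℕ} (hN : ‖μ⁻¹‖ * c ^ N < 1) (e : germAlg E)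
    (he : e ∈ ordIdeal E N) :
    ∃ L ∈ ordIdeal E N,
      germPullback f hf.analyticAt hf.map_zero L - μ • L - e ∈ nullIdeal E := by
  let T : ℂ ≃L[ℂ] ℂ := ContinuousLinearEquiv.unitsEquivAut ℂ (Units.mk0 μ hμ)
  have hT : ‖(T.symm : ℂ →L[ℂ] ℂ)‖ * c ^ N < 1 := by
    refine lt_of_le_of_lt ?_ hN
    refine mul_le_mul_of_nonneg_right ?_ (pow_nonneg hf.pos.le _)
    refine ContinuousLinearMap.opNorm_le_bound _ (norm_nonneg _) fun x => ?_
    have : (T.symm : ℂ →L[ℂ] ℂ) x = x * μ⁻¹ := by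
      rw [ContinuousLinearEquiv.coe_coe, ContinuousLinearEquiv.symm_apply_eq]
      change x = x * μ⁻¹ * μ
      field_simp
    rw [this, norm_mul, mul_comm]
  have hTx : ∀ x, T x = μ * x := fun x => mul_comm _ _
  obtain ⟨L, hL, hLN, hLeq⟩ := hf.exists_comp_eq T hT (err := -(e : E → ℂ))
    (germAlg.analyticAt e).neg (mem_ordIdeal.1 he).neg_left
  refine ⟨⟨L, hL⟩, hLN, ?_⟩
  rw [mem_nullIdeal]
  filter_upwards [hLeq] with w hw
  simp only [AddSubgroupClass.coe_sub, Pi.sub_apply, germPullback_apply, Subalgebra.coe_smul,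
    Pi.smul_apply, smul_eq_mul, hw, hTx, Pi.neg_apply]
  ring

/-- The injectivity of `C ^ η - μ` on functions of high order that `IsGenEig.mem_of_injective`
requires. It follows from uniqueness for the contraction `f^[η]`. -/
theorem IsContractingGerm.mem_nullIdeal_of_eq (hf : IsContractingGerm f c) {η : ℕ} (hη : η ≠ 0)
    {μ : ℂ} (hμ : μ ≠ 0) {N : ℕ} (hN : ‖μ⁻¹‖ * (c ^ η) ^ N < 1) {φ : germAlg E}
    (hφ : φ ∈ ordIdeal E N)
    (h : (germPullback f hf.analyticAt hf.map_zero ^ η) φ - μ • φ ∈ nullIdeal E) :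
    φ ∈ nullIdeal E := by
  let T : ℂ ≃L[ℂ] ℂ := ContinuousLinearEquiv.unitsEquivAut ℂ (Units.mk0 μ hμ)
  have hT : ‖(T.symm : ℂ →L[ℂ] ℂ)‖ * (c ^ η) ^ N < 1 := by
    refine lt_of_le_of_lt ?_ hN
    refine mul_le_mul_of_nonneg_right ?_ (pow_nonneg (pow_nonneg hf.pos.le _) _)
    refine ContinuousLinearMap.opNorm_le_bound _ (norm_nonneg _) fun x => ?_
    have : (T.symm : ℂ →L[ℂ] ℂ) x = x * μ⁻¹ := by
      rw [ContinuousLinearEquiv.coe_coe, ContinuousLinearEquiv.symm_apply_eq]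
      change x = x * μ⁻¹ * μ
      field_simp
    rw [this, norm_mul, mul_comm]
  refine mem_nullIdeal.2 ((hf.contractsWith.iterate η).eventually_eq_zero (pow_nonneg hf.pos.le _)
    (pow_lt_one₀ hf.pos.le hf.lt_one hη) T hT (mem_ordIdeal.1 hφ) ?_)
  filter_upwards [mem_nullIdeal.1 h] with w hw
  simp only [AddSubgroupClass.coe_sub, Pi.sub_apply, germPullback_pow_apply, Subalgebra.coe_smul,
    Pi.smul_apply, smul_eq_mul, sub_eq_zero] at hw
  rw [hw]
  exact mul_comm _ _

/-- Germs permuted up to units by a contracting germ are, after multiplication by units, permuted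
up to constants. -/
theorem IsContractingGerm.exists_unit_of_perm (hf : IsContractingGerm f c) {r : ℕ}
    (τ : Equiv.Perm (Fin r)) (U v : Fin r → germAlg E) (hv : ∀ i, (v i : E → ℂ) 0 ≠ 0)
    (h : ∀ i, ∀ᶠ w in 𝓝 0, (U i : E → ℂ) (f w) = (v i : E → ℂ) w * (U (τ i) : E → ℂ) w) :
    ∃ ψ : Fin r → germAlg E, (∀ i, (ψ i : E → ℂ) 0 ≠ 0) ∧
      ∀ i, germPullback f hf.analyticAt hf.map_zero (ψ i * U i) -
        (v i : E → ℂ) 0 • (ψ (τ i) * U (τ i)) ∈ nullIdeal E := by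
  choose Φ hΦ0 hΦ using fun i => germAlg.exists_log (v i) (hv i)
  -- Taking logarithms of the factors makes the problem additive. The operator permutes coordinates
  -- and so preserves the sup norm; vanishing to order one is therefore enough to solve it.
  let T : (Fin r → ℂ) ≃L[ℂ] (Fin r → ℂ) := (LinearEquiv.funCongrLeft ℂ ℂ τ).toContinuousLinearEquiv
  have hT : ‖(T.symm : (Fin r → ℂ) →L[ℂ] (Fin r → ℂ))‖ * c ^ 1 < 1 := by
    have h1 : ‖(T.symm : (Fin r → ℂ) →L[ℂ] (Fin r → ℂ))‖ ≤ 1 := by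
      refine ContinuousLinearMap.opNorm_le_bound _ zero_le_one fun x => ?_
      rw [one_mul]
      exact (pi_norm_le_iff_of_nonneg (norm_nonneg _)).2 fun i => norm_le_pi_norm x (τ.symm i)
    calc _ ≤ 1 * c ^ 1 := mul_le_mul_of_nonneg_right h1 (pow_nonneg hf.pos.le _)
      _ < 1 := by simpa using hf.lt_one
  obtain ⟨L, -, hLeq⟩ := hf.exists_germ_solution T hT Φ fun k => mem_ordIdeal_one.2 (hΦ0 k)
  -- Since `L i ∘ f = L (τ i) - Φ i`, the factor `exp (L i) ∘ f` cancels the non-constant part of `v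
  -- i`.
  refine ⟨fun i => ⟨fun w => Complex.exp ((L i : E → ℂ) w), (germAlg.analyticAt (L i)).cexp⟩,
    fun i => Complex.exp_ne_zero _, fun i => ?_⟩
  rw [mem_nullIdeal]
  filter_upwards [hLeq, hΦ i, h i] with w h1 h2 h3
  have h4 : (L i : E → ℂ) (f w) = (L (τ i) : E → ℂ) w - (Φ i : E → ℂ) w := h1 i
  simp only [AddSubgroupClass.coe_sub, Pi.sub_apply, germPullback_apply, Subalgebra.coe_smul,
    Pi.smul_apply, smul_eq_mul, MulMemClass.coe_mul, Pi.mul_apply]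
  rw [h3, h4, h2, sub_eq_zero, Complex.exp_sub]
  have := Complex.exp_ne_zero ((Φ i : E → ℂ) w)
  field_simp

end GermEquations

/-! ### The primary normal form -/

section Primary

open Polynomial

variable {E : Type*} [NormedAddCommGroup E] [NormedSpace ℂ E] {f : E → E} {c : ℝ}

theorem charpoly_dual_transpose [FiniteDimensional ℂ E] (T : E →ₗ[ℂ] E) :
    LinearMap.charpoly (Module.Dual.transpose (R := ℂ) T) = T.charpoly := by
  classical
  let b := Module.finBasis ℂ E
  rw [← LinearMap.charpoly_toMatrix _ b.dualBasis, LinearMap.toMatrix_transpose,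
    Matrix.charpoly_transpose, LinearMap.charpoly_toMatrix]

theorem germDeriv_surjective [FiniteDimensional ℂ E] (l : Module.Dual ℂ E) :
    ∃ φ : germAlg E, (φ : E → ℂ) 0 = 0 ∧ germDeriv E φ = l := by
  refine ⟨⟨l.toContinuousLinearMap, l.toContinuousLinearMap.analyticAt 0⟩, map_zero _, ?_⟩
  ext v
  rw [germDeriv_apply]
  simp only [ContinuousLinearMap.fderiv]
  rfl

theorem germDeriv_eq_of_sub_mem {φ ψ : germAlg E} (h : φ - ψ ∈ ordIdeal E 2) :
    germDeriv E φ = germDeriv E ψ := by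
  rw [← sub_eq_zero, ← map_sub, germDeriv_eq_zero h]

theorem germDeriv_eq_of_sub_mem_null {φ ψ : germAlg E} (h : φ - ψ ∈ nullIdeal E) :
    germDeriv E φ = germDeriv E ψ :=
  germDeriv_eq_of_sub_mem (nullIdeal_le_ordIdeal 2 h)

theorem germDeriv_germPullback_pow (hf : AnalyticAt ℂ f 0) (hf0 : f 0 = 0) (n : ℕ) (φ : germAlg E) :
    germDeriv E ((germPullback f hf hf0 ^ n) φ) =
      ((Module.Dual.transpose (R := ℂ) (fderiv ℂ f 0 : E →ₗ[ℂ] E) : Module.End ℂ (Module.Dual ℂ E))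
        ^ n) (germDeriv E φ) := by
  induction n with
  | zero => rfl
  | succ n ih =>
    rw [pow_succ', pow_succ', AlgHom.mul_apply, germDeriv_germPullback, ih]
    rfl

theorem aeval_germPullback_apply_zero (hf : AnalyticAt ℂ f 0) (hf0 : f 0 = 0) (χ : ℂ[X])
    (φ : germAlg E) :
    ((aeval (germPullback f hf hf0).toLinearMap χ φ : germAlg E) : E → ℂ) 0 =
      χ.eval 1 * (φ : E → ℂ) 0 := by
  induction χ using Polynomial.induction_on' with
  | add p q hp hq => simp [hp, hq, add_mul]
  | monomial n a =>
    rw [aeval_monomial, Module.End.mul_apply, Module.algebraMap_end_apply, ← AlgHom.toLinearMap_pow,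
      AlgHom.toLinearMap_apply]
    change a * ((germPullback f hf hf0 ^ n) φ : germAlg E).1 0 = _
    rw [germPullback_pow_apply, Function.iterate_fixed hf0, eval_monomial, one_pow, mul_one]

/-- Evaluation at the fixed point intertwines the pullback with the identity, so only the eigenvalue
one allows a non-zero value. -/
theorem IsGenEig.germ_apply_zero (hf : AnalyticAt ℂ f 0) (hf0 : f 0 = 0) {N : ℕ} (hN : 1 ≤ N)
    {μ : ℂ} (hμ : μ ≠ 1) {φ : germAlg E}
    (h : IsGenEig (germPullback f hf hf0).toLinearMap ((ordIdeal E N).restrictScalars ℂ) μ φ) :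
    (φ : E → ℂ) 0 = 0 := by
  obtain ⟨n, hn⟩ := h
  have h1 := mem_ordIdeal_one.1 (ordIdeal_anti hN hn)
  rw [aeval_germPullback_apply_zero] at h1
  refine (mul_eq_zero.1 h1).resolve_left ?_
  simp only [eval_pow, eval_sub, eval_X, eval_C]
  exact pow_ne_zero _ (sub_ne_zero.2 hμ.symm)

/-- A vector killed by a spanning family of covectors is zero. This gives injectivity of the
differential, and the count of dimensions gives bijectivity. -/
theorem isLocalBiholomorphism_of_linearIndependent [FiniteDimensional ℂ E] {ι : Type*} [Fintype ι]
    {ξ : ι → germAlg E} (h0 : ∀ i, (ξ i : E → ℂ) 0 = 0)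
    (hli : LinearIndependent ℂ fun i => germDeriv E (ξ i))
    (hspan : ⊤ ≤ Submodule.span ℂ (Set.range fun i => germDeriv E (ξ i))) :
    IsLocalBiholomorphism fun w i => (ξ i : E → ℂ) w := by
  classical
  refine isLocalBiholomorphism_of_bijective (germAlg.pi_analyticAt ξ) (funext h0) ?_
  have hd : ∀ v i, fderiv ℂ (fun w i => (ξ i : E → ℂ) w) 0 v i = germDeriv E (ξ i) v := by
    intro v i
    rw [germDeriv_apply, fderiv_pi fun i => (germAlg.analyticAt (ξ i)).differentiableAt]
    rfl
  have hinj : Function.Injective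
      (fderiv ℂ (fun w i => (ξ i : E → ℂ) w) 0 : E →ₗ[ℂ] ι → ℂ) := by
    rw [injective_iff_map_eq_zero]
    intro v hv
    have h1 : ∀ l : Module.Dual ℂ E, l v = 0 := by
      intro l
      have hl : l ∈ Submodule.span ℂ (Set.range fun i => germDeriv E (ξ i)) := hspan trivial
      induction hl using Submodule.span_induction with
      | mem x hx =>
        obtain ⟨i, rfl⟩ := hx
        exact (hd v i).symm.trans (congrFun hv i)
      | zero => rfl
      | add x y _ _ hx hy => rw [LinearMap.add_apply, hx, hy, add_zero]
      | smul a x _ hx => rw [LinearMap.smul_apply, hx, smul_zero]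
    exact (Module.forall_dual_apply_eq_zero_iff ℂ v).1 h1
  have hcard : Module.finrank ℂ E = Module.finrank ℂ (ι → ℂ) := by
    rw [Module.finrank_fintype_fun_eq_card, ← Subspace.dual_finrank_eq (K := ℂ) (V := E),
      Module.finrank_eq_card_basis (Module.Basis.mk hli hspan)]
  exact ⟨hinj, (LinearMap.injective_iff_surjective_of_finrank_eq_finrank hcard).1 hinj⟩

theorem IsContracting.norm_lt_one_of_mem_roots [FiniteDimensional ℂ E] (h : IsContracting f) {μ : ℂ}
    (hμ : μ ∈ (fderiv ℂ f 0 : E →ₗ[ℂ] E).charpoly.roots) : ‖μ‖ < 1 :=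
  h μ ((Module.End.hasEigenvalue_iff_isRoot_charpoly _ _).2 (mem_roots'.1 hμ).2)

theorem exists_pow_mul_lt_one {ι : Type*} [Finite ι] {c : ℝ} (hc0 : 0 < c) (hc1 : c < 1)
    (a : ι → ℝ) (N₁ : ℕ) : ∃ N, N₁ ≤ N ∧ ∀ i, a i * c ^ N < 1 := by
  have h : ∀ i, ∀ᶠ N : ℕ in atTop, a i * c ^ N < 1 := by
    intro i
    have := (tendsto_pow_atTop_nhds_zero_of_lt_one hc0.le hc1).const_mul (a i)
    rw [mul_zero] at this
    exact this.eventually_lt_const one_pos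
  obtain ⟨N, hN1, hN2⟩ := ((eventually_ge_atTop N₁).and (eventually_all.2 h)).exists
  exact ⟨N, hN1, hN2⟩

/-- The primary normal form: coordinates `x = (U, v)` on which a contracting germ acts through a
polynomial map with resonant monomials, and complementary coordinates `z` that are nilpotent at the
level of jets. -/
theorem IsContractingGerm.exists_primary_normal_form [FiniteDimensional ℂ E]
    (hf : IsContractingGerm f c) (hcontr : IsContracting f) (N₁ : ℕ) {r : ℕ}
    (τ : Equiv.Perm (Fin r)) {γ : Fin r → ℂ} (hγ : ∀ i, γ i ≠ 0) {U : Fin r → germAlg E}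
    (hU0 : ∀ i, (U i : E → ℂ) 0 = 0)
    (hU : ∀ i, germPullback f hf.analyticAt hf.map_zero (U i) - γ i • U (τ i) ∈ nullIdeal E)
    (hUli : LinearIndependent ℂ fun i => germDeriv E (U i)) {η : ℕ} (hη : η ≠ 0) (hτ : τ ^ η = 1) :
    ∃ (e m : ℕ) (lam : Fin r ⊕ Fin e → ℂ) (v : Fin e → germAlg E) (z : Fin m → germAlg E)
      (σ : Fin e → MvPolynomial (Fin r ⊕ Fin e) ℂ) (N : ℕ),
      N₁ ≤ N ∧ (∀ k, (v k : E → ℂ) 0 = 0) ∧ (∀ j, (z j : E → ℂ) 0 = 0) ∧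
      LinearIndependent ℂ (fun s => germDeriv E (Sum.elim (Sum.elim U v) z s)) ∧
      ⊤ ≤ Submodule.span ℂ (Set.range fun s => germDeriv E (Sum.elim (Sum.elim U v) z s)) ∧
      (∀ i, lam i ≠ 0) ∧
      (∀ i, lam (Sum.inl i) ^ η = ∏ j ∈ Finset.range η, γ ((τ ^ j) i)) ∧
      ListsNonzeroEigenvalues (fderiv ℂ f 0 : E →ₗ[ℂ] E) lam ∧
      (∀ i, IsGenEig (germPullback f hf.analyticAt hf.map_zero ^ η).toLinearMap
        ((ordIdeal E N).restrictScalars ℂ) (lam i ^ η) (Sum.elim U v i)) ∧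
      (∀ j, IsGenEig (germPullback f hf.analyticAt hf.map_zero ^ η).toLinearMap
        ((ordIdeal E N).restrictScalars ℂ) 0 (z j)) ∧
      (∀ k, germPullback f hf.analyticAt hf.map_zero (v k) - lam (Sum.inr k) • v k -
        MvPolynomial.aeval (Sum.elim U v) (σ k) ∈ nullIdeal E) ∧
      (∀ k, MvPolynomial.constantCoeff (σ k) = 0) ∧
      (∀ k, ∀ n ∈ (σ k).support, IsPrimaryResonant lam η n (Sum.inr k)) ∧
      IsNilpotent (Matrix.of fun k l : Fin e =>
        MvPolynomial.coeff (Finsupp.single (Sum.inr l) 1) (σ k)) := by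
  classical
  set C := germPullback f hf.analyticAt hf.map_zero with hC
  set M : Module.End ℂ (Module.Dual ℂ E) :=
    Module.Dual.transpose (R := ℂ) (fderiv ℂ f 0 : E →ₗ[ℂ] E) with hM
  have hδC : ∀ φ, germDeriv E (C.toLinearMap φ) = M (germDeriv E φ) := fun φ =>
    germDeriv_germPullback hf.analyticAt hf.map_zero φ
  have hCnull : ∀ a ∈ nullIdeal E, C a ∈ nullIdeal E :=
    fun a ha => germPullback_mem_nullIdeal hf.analyticAt hf.map_zero a ha
  have hCord : ∀ N, ∀ a ∈ ordIdeal E N, C a ∈ ordIdeal E N :=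
    fun N a ha => germPullback_mem_ordIdeal hf.analyticAt hf.map_zero a ha
  have hCpow : ∀ (I : Ideal (germAlg E)), (∀ a ∈ I, C a ∈ I) → ∀ a ∈ I, (C ^ η) a ∈ I := by
    intro I hI
    induction η with
    | zero => exact fun a ha => ha
    | succ n ih =>
      intro a ha
      rw [pow_succ', AlgHom.mul_apply]
      clear hη hτ
      refine hI _ ?_
      have : ∀ n, (C ^ n) a ∈ I := by
        intro n
        induction n with
        | zero => exact ha
        | succ n ih => rw [pow_succ', AlgHom.mul_apply]; exact hI _ ih
      exact this n
  -- the `η`-th iterate on `U`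
  have hUpow : ∀ n i, (C ^ n) (U i) - (∏ j ∈ Finset.range n, γ ((τ ^ j) i)) • U ((τ ^ n) i) ∈
      nullIdeal E := by
    intro n i
    induction n with
    | zero => simp
    | succ n ih =>
      have h1 := hCnull _ ih
      have h2 := (nullIdeal E).restrictScalars ℂ |>.smul_mem
        (∏ j ∈ Finset.range n, γ ((τ ^ j) i)) (hU ((τ ^ n) i))
      have h3 := (nullIdeal E).add_mem h1 h2
      refine (congrArg (· ∈ nullIdeal E) ?_).mp h3
      rw [map_sub, map_smul, pow_succ', AlgHom.mul_apply, Finset.prod_range_succ, smul_sub, smul_smul,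
        pow_succ' τ, Equiv.Perm.mul_apply]
      abel
  set cc : Fin r → ℂ := fun i => ∏ j ∈ Finset.range η, γ ((τ ^ j) i) with hcc
  have hcc0 : ∀ i, cc i ≠ 0 := fun i => Finset.prod_ne_zero_iff.2 fun j _ => hγ _
  have hUη : ∀ i, (C ^ η) (U i) - cc i • U i ∈ nullIdeal E := by
    intro i
    have := hUpow η i
    rwa [hτ] at this
  have hMu : ∀ i, M (germDeriv E (U i)) = γ i • germDeriv E (U (τ i)) := by
    intro i
    rw [← hδC, ← map_smul]
    exact germDeriv_eq_of_sub_mem_null (hU i)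
  have hMη : ∀ i, (M ^ η) (germDeriv E (U i)) = cc i • germDeriv E (U i) := by
    intro i
    rw [hM, ← germDeriv_germPullback_pow hf.analyticAt hf.map_zero, ← map_smul]
    exact germDeriv_eq_of_sub_mem_null (hUη i)
  obtain ⟨e, m, lam, b, hbli, hbspan, hlam0, hlamc, hbl, hbr, hroots, hnil⟩ :=
    exists_adapted_eigenbasis M hUli (fun i => by
      rw [hMu]
      exact Submodule.smul_mem _ _ (Submodule.subset_span ⟨τ i, rfl⟩)) hMη hcc0 hη
  rw [hM, charpoly_dual_transpose] at hroots
  have hlam1 : ∀ i, lam i ≠ 1 := by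
    intro i h1
    have h2 : lam i ∈ Multiset.map lam Finset.univ.val :=
      Multiset.mem_map_of_mem _ (Finset.mem_univ i)
    rw [hroots] at h2
    have h3 := hcontr.norm_lt_one_of_mem_roots (Multiset.mem_filter.1 h2).1
    rw [h1, norm_one] at h3
    exact lt_irrefl _ h3
  -- `N ≥ 2` ensures that corrections of order `N` do not affect differentials. The inequality makes
  -- the equations for every `lam i` uniquely solvable at order `N`.
  obtain ⟨N, hN, hNlam⟩ := exists_pow_mul_lt_one hf.pos hf.lt_one (fun i => ‖(lam i)⁻¹‖) (max 2 N₁)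
  have hN2 : 2 ≤ N := (le_max_left _ _).trans hN
  -- lifting the eigenbasis to jets
  obtain ⟨P, hP0, hP⟩ := exists_aeval_mem_ordIdeal C.toLinearMap N (hCord N)
  have hlift : ∀ (μ : ℂ) (y : Module.Dual ℂ E), IsGenEig M ⊥ μ y →
      ∃ a : germAlg E, IsGenEig C.toLinearMap ((ordIdeal E N).restrictScalars ℂ) μ a ∧
        germDeriv E a = y := by
    rintro μ y ⟨k, hk⟩
    obtain ⟨a₀, -, rfl⟩ := germDeriv_surjective y
    exact exists_isGenEig_of_intertwining (C := C.toLinearMap) (I := (ordIdeal E N).restrictScalars ℂ) (hCord N) hP0 hP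
      (M := M) (δ := germDeriv E) hδC (Submodule.mem_bot ℂ |>.1 hk)
  choose z hz hzδ using fun j => hlift 0 _ (hbr j)
  -- The jets are corrected to generalized eigenvectors modulo functions vanishing near 0. This
  -- needs a non-zero eigenvalue, so the `z j` remain generalized eigenvectors only at the level of
  -- jets.
  have hv : ∀ k, ∃ a : germAlg E,
      IsGenEig C.toLinearMap ((nullIdeal E).restrictScalars ℂ) (lam (Sum.inr k)) a ∧
        germDeriv E a = b (Sum.inl k) := by
    intro k
    obtain ⟨a, ha, haδ⟩ := hlift _ _ (hbl k)
    obtain ⟨a', ha', haa'⟩ := ha.exists_sub_mem (C := C.toLinearMap) (J := (nullIdeal E).restrictScalars ℂ) hCnull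
      fun e he => hf.exists_germ_solution_scalar (hlam0 _) (hNlam _) e he
    refine ⟨a', ha', ?_⟩
    rw [← haδ]
    exact (germDeriv_eq_of_sub_mem (ordIdeal_anti hN2 haa')).symm
  choose v hv hvδ using hv
  have hnullord : (nullIdeal E).restrictScalars ℂ ≤ (ordIdeal E N).restrictScalars ℂ :=
    fun a ha => nullIdeal_le_ordIdeal N ha
  have hv0 : ∀ k, (v k : E → ℂ) 0 = 0 := fun k =>
    ((hv k).mono hnullord).germ_apply_zero hf.analyticAt hf.map_zero (one_le_two.trans hN2) (hlam1 _)
  have hz0 : ∀ j, (z j : E → ℂ) 0 = 0 := fun j =>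
    (hz j).germ_apply_zero hf.analyticAt hf.map_zero (one_le_two.trans hN2) zero_ne_one
  have hδ : (fun s => germDeriv E (Sum.elim (Sum.elim U v) z s)) =
      Sum.elim (fun i => germDeriv E (U i)) b ∘ Equiv.sumAssoc (Fin r) (Fin e) (Fin m) := by
    funext s
    rcases s with (i | k) | j
    · rfl
    · exact hvδ k
    · exact hzδ j
  have hli : LinearIndependent ℂ (fun s => germDeriv E (Sum.elim (Sum.elim U v) z s)) := by
    rw [hδ]
    exact hbli.comp _ (Equiv.injective _)
  have hspan : ⊤ ≤ Submodule.span ℂ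
      (Set.range fun s => germDeriv E (Sum.elim (Sum.elim U v) z s)) := by
    rw [hδ, EquivLike.range_comp]
    exact hbspan
  have hcoord : IsLocalBiholomorphism
      fun w s => (Sum.elim (Sum.elim U v) z s : germAlg E).1 w := by
    refine isLocalBiholomorphism_of_linearIndependent ?_ hli hspan
    rintro ((i | k) | j)
    exacts [hU0 i, hv0 k, hz0 j]
  have hpowlin : (C ^ η).toLinearMap = C.toLinearMap ^ η := AlgHom.toLinearMap_pow C η
  -- The `U i` are permuted up to constants and become eigenvectors only for the `η`-th power.
  have hxnull : ∀ i, IsGenEig (C ^ η).toLinearMap ((nullIdeal E).restrictScalars ℂ)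
      (lam i ^ η) (Sum.elim U v i) := by
    rintro (i | k)
    · refine ⟨1, ?_⟩
      rw [pow_one, map_sub, aeval_X, aeval_C, LinearMap.sub_apply, Module.algebraMap_end_apply,
        hlamc]
      exact hUη i
    · rw [hpowlin]
      exact (hv k).pow hCnull η
  have hxord := fun i => (hxnull i).mono hnullord
  have hzord : ∀ j, IsGenEig (C ^ η).toLinearMap ((ordIdeal E N).restrictScalars ℂ) 0 (z j) := by
    intro j
    have := (hz j).pow (hCord N) η
    rwa [zero_pow hη, ← hpowlin] at this
  -- the resonant polynomials
  have hQ : ∀ k, ∃ Q : MvPolynomial (Fin r ⊕ Fin e) ℂ,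
      C (v k) - MvPolynomial.aeval (Sum.elim U v) Q ∈ nullIdeal E ∧
      ∀ n ∈ Q.support, (n.prod fun i j => (lam i ^ η) ^ j) = lam (Sum.inr k) ^ η := by
    intro k
    have hCv : IsGenEig (C ^ η).toLinearMap ((nullIdeal E).restrictScalars ℂ)
        (lam (Sum.inr k) ^ η) (C (v k)) := by
      rw [hpowlin]
      exact ((hv k).apply hCnull).pow hCnull η
    obtain ⟨n, hn⟩ := hCv.mono hnullord
    obtain ⟨Q, hQ, hQn⟩ := exists_mvPolynomial_of_aeval_mem' (hCpow _ (hCord N)) hxord hzord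
      (exists_aeval_sub_mem_ordIdeal hcoord (C (v k)) N)
      (by
        simp only [eval_pow, eval_sub, eval_X, eval_C]
        exact pow_ne_zero _ (by simpa using pow_ne_zero η (hlam0 _))) hn
    have hQn' : ∀ n ∈ Q.support, (n.prod fun i j => (lam i ^ η) ^ j) = lam (Sum.inr k) ^ η := by
      intro n' hn'
      have h1 := hQn n' hn'
      simp only [eval_pow, eval_sub, eval_X, eval_C] at h1
      exact sub_eq_zero.1 (eq_zero_of_pow_eq_zero h1)
    refine ⟨Q, ?_, hQn'⟩
    -- `C (v k)` and its resonant polynomial are generalized eigenvectors for the same eigenvalue,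
    -- and their difference has order `N`. By injectivity it vanishes near 0, so the polynomial is
    -- exact and not just a jet.
    have hgen : IsGenEig (C ^ η).toLinearMap ((nullIdeal E).restrictScalars ℂ)
        (lam (Sum.inr k) ^ η) (C (v k) - MvPolynomial.aeval (Sum.elim U v) Q) := by
      have h2 := (IsGenEig.aeval (hCpow _ hCnull) hxnull hQn').smul (-1)
      rw [neg_one_smul] at h2
      rw [sub_eq_add_neg]
      exact hCv.add (hCpow _ hCnull) h2
    refine hgen.mem_of_injective (C := (C ^ η).toLinearMap) (I := (ordIdeal E N).restrictScalars ℂ) (hCpow _ (hCord N)) ?_ hQ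
    intro a ha hinj
    refine hf.mem_nullIdeal_of_eq hη (pow_ne_zero η (hlam0 (Sum.inr k))) (N := N) ?_ ha hinj
    have h3 : ‖(lam (Sum.inr k) ^ η)⁻¹‖ * (c ^ η) ^ N = (‖(lam (Sum.inr k))⁻¹‖ * c ^ N) ^ η := by
      rw [← inv_pow, norm_pow, mul_pow, ← pow_mul, ← pow_mul, mul_comm η]
    rw [h3]
    exact pow_lt_one₀ (mul_nonneg (norm_nonneg _) (pow_nonneg hf.pos.le _)) (hNlam _) hη
  choose Q hQ hQn using hQ
  have hx0 : ∀ i, (Sum.elim U v i : germAlg E).1 0 = 0 := by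
    rintro (i | k)
    exacts [hU0 i, hv0 k]
  have hσeq : ∀ k, C (v k) - lam (Sum.inr k) • v k - MvPolynomial.aeval (Sum.elim U v)
      (Q k - MvPolynomial.C (lam (Sum.inr k)) * MvPolynomial.X (Sum.inr k)) ∈ nullIdeal E := by
    intro k
    refine (congrArg (· ∈ nullIdeal E) ?_).mp (hQ k)
    rw [map_sub, map_mul, MvPolynomial.aeval_C, MvPolynomial.aeval_X, ← Algebra.smul_def,
      Sum.elim_inr]
    abel
  refine ⟨e, m, lam, v, z, fun k => Q k - MvPolynomial.C (lam (Sum.inr k)) *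
    MvPolynomial.X (Sum.inr k), N, (le_max_right _ _).trans hN, hv0, hz0, hli, hspan, hlam0, hlamc,
    hroots, hxord, hzord, hσeq, fun k => ?_, fun k n hn => ?_, ?_⟩
  · have h1 := (mem_nullIdeal.1 (hσeq k)).self_of_nhds
    have h2 : (C (v k) : germAlg E).1 0 = 0 := by
      rw [hC, germPullback_apply, hf.map_zero, hv0]
    have h3 := germAlg.aeval_apply (Sum.elim U v)
      (Q k - MvPolynomial.C (lam (Sum.inr k)) * MvPolynomial.X (Sum.inr k)) 0
    have h4 : (fun i => (Sum.elim U v i : germAlg E).1 0) = 0 := funext hx0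
    rw [h4, MvPolynomial.eval_zero] at h3
    rw [← h3]
    have h5 : (C (v k) : germAlg E).1 0 - lam (Sum.inr k) * (v k).1 0 -
        (MvPolynomial.aeval (Sum.elim U v) (Q k - MvPolynomial.C (lam (Sum.inr k)) *
          MvPolynomial.X (Sum.inr k)) : germAlg E).1 0 = 0 := h1
    rw [h2, hv0, mul_zero, sub_zero, zero_sub, neg_eq_zero] at h5
    exact h5
  -- Splitting off the term `lam v_k` introduces at most the monomial `v_k`, which is itself
  -- resonant.
  · have hn' : n ∈ (Q k).support ∨ n = Finsupp.single (Sum.inr k) 1 := by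
      by_contra hcon
      push Not at hcon
      refine (MvPolynomial.mem_support_iff.1 hn) ?_
      rw [MvPolynomial.coeff_sub, MvPolynomial.notMem_support_iff.1 hcon.1,
        MvPolynomial.coeff_C_mul, MvPolynomial.coeff_X, if_neg (Ne.symm hcon.2)]
      simp
    have hprod : ∏ i, lam i ^ (η * n i) = n.prod fun i j => (lam i ^ η) ^ j := by
      rw [Finsupp.prod_fintype _ _ fun i => pow_zero _]
      simp only [pow_mul]
    rw [IsPrimaryResonant, hprod]
    rcases hn' with h | rfl
    · exact hQn k n h
    · exact (Finsupp.prod_single_index (h := fun i j => (lam i ^ η) ^ j) (pow_zero _)).trans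
        (pow_one _)
  -- The differential of `C (v k)` is read off from the linear coefficients of `Q k`. Modulo the
  -- span of the `dU i`, those of `σ k` give the nilpotent part.
  · refine hnil _ fun k => ?_
    have h1 : M (b (Sum.inl k)) =
        ∑ i, (Q k).coeff (Finsupp.single i 1) • germDeriv E (Sum.elim U v i) := by
      rw [← hvδ, ← hδC, ← germDeriv_aeval hx0]
      exact germDeriv_eq_of_sub_mem_null (hQ k)
    have h2 : ∑ l, (Matrix.of fun k l : Fin e => MvPolynomial.coeff (Finsupp.single (Sum.inr l) 1)
          (Q k - MvPolynomial.C (lam (Sum.inr k)) * MvPolynomial.X (Sum.inr k))) k l •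
          b (Sum.inl l) =
        ∑ l, (Q k).coeff (Finsupp.single (Sum.inr l) 1) • b (Sum.inl l) -
          lam (Sum.inr k) • b (Sum.inl k) := by
      have h3 : ∀ l, (Matrix.of fun k l : Fin e => MvPolynomial.coeff (Finsupp.single (Sum.inr l) 1)
          (Q k - MvPolynomial.C (lam (Sum.inr k)) * MvPolynomial.X (Sum.inr k))) k l •
          b (Sum.inl l) = (Q k).coeff (Finsupp.single (Sum.inr l) 1) • b (Sum.inl l) -
            if l = k then lam (Sum.inr k) • b (Sum.inl k) else 0 := by
        intro l
        rw [Matrix.of_apply, MvPolynomial.coeff_sub, MvPolynomial.coeff_C_mul,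
          MvPolynomial.coeff_X, sub_smul]
        congr 1
        by_cases hlk : l = k
        · subst hlk
          simp
        · rw [if_neg hlk, if_neg, mul_zero, zero_smul]
          intro h
          exact hlk (Sum.inr_injective
            ((Finsupp.single_left_inj one_ne_zero).1 h)).symm
      simp only [h3, Finset.sum_sub_distrib, Finset.sum_ite_eq', Finset.mem_univ, if_true]
    rw [h2, h1, Fintype.sum_sum_type]
    simp only [Sum.elim_inl, Sum.elim_inr, hvδ]
    have h4 : ∀ x y l : Module.Dual ℂ E, x + y - l - (y - l) = x := by
      intros; abel
    rw [h4]
    exact Submodule.sum_mem _ fun i _ => Submodule.smul_mem _ _ (Submodule.subset_span ⟨i, rfl⟩)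

end Primary

/-! ### The secondary normal form -/

section Secondary

open Polynomial

variable {E : Type*} [NormedAddCommGroup E] [NormedSpace ℂ E] {f : E → E} {c : ℝ}

/-- Multiplicative correction of a unit, in logarithmic form. -/
theorem germAlg.exists_log_add {a G : germAlg E} {j : ℕ} (hj : 1 ≤ j) (ha : a ∈ ordIdeal E 1)
    (hG : G ∈ ordIdeal E j) :
    ∃ Λ : germAlg E, Λ - G ∈ ordIdeal E (j + 1) ∧ ∀ᶠ w in 𝓝 0,
      Complex.exp (Λ.1 w) * (1 + a.1 w) = 1 + a.1 w + G.1 w := by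
  have ha0 : a.1 0 = 0 := mem_ordIdeal_one.1 ha
  have hG0 : G.1 0 = 0 := mem_ordIdeal_one.1 (ordIdeal_anti hj hG)
  have hinv : AnalyticAt ℂ (fun w => (1 + a.1 w)⁻¹) 0 :=
    (analyticAt_const.add (germAlg.analyticAt a)).inv (by simp [ha0])
  -- The solution is `Λ = log (1 + H)` with `H = G / (1 + a)`. It agrees with `G` to higher order
  -- because `log (1 + H) - H` is quadratic in `H` and `H - G = -H a`.
  let H : germAlg E := G * ⟨_, hinv⟩
  have hHw : ∀ w, H.1 w = G.1 w * (1 + a.1 w)⁻¹ := fun w => rfl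
  have hH : H ∈ ordIdeal E j := Ideal.mul_mem_right _ _ hG
  have hH0 : H.1 0 = 0 := by rw [hHw, hG0, zero_mul]
  have hlog : AnalyticAt ℂ (fun w => Complex.log (1 + H.1 w)) 0 :=
    (analyticAt_const.add (germAlg.analyticAt H)).clog
      (by change 1 + H.1 0 ∈ _; rw [hH0, add_zero]; exact Complex.one_mem_slitPlane)
  have hane : ∀ᶠ w in 𝓝 (0 : E), 1 + a.1 w ≠ 0 :=
    (analyticAt_const.add (germAlg.analyticAt a)).continuousAt.eventually_ne (by simp [ha0])
  have hHne : ∀ᶠ w in 𝓝 (0 : E), 1 + H.1 w ≠ 0 :=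
    (analyticAt_const.add (germAlg.analyticAt H)).continuousAt.eventually_ne (by simp [hH0])
  have hsmall : ∀ᶠ w in 𝓝 (0 : E), ‖H.1 w‖ < 1 / 2 :=
    (germAlg.analyticAt H).continuousAt.norm.eventually_lt_const (by simp [hH0])
  let Λ : germAlg E := ⟨_, hlog⟩
  refine ⟨Λ, ?_, ?_⟩
  · have h1 : Λ - H ∈ ordIdeal E (j + 1) := by
      refine ordIdeal_anti (add_le_add_right hj j) ?_
      have h2 := mem_ordIdeal.1 (mul_mem_ordIdeal hH hH)
      refine mem_ordIdeal.2 (Asymptotics.IsBigO.trans (Asymptotics.IsBigO.of_bound 1 ?_) h2)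
      filter_upwards [hsmall] with w hw
      have h3 := Complex.norm_log_one_add_sub_self_le (hw.trans (by norm_num))
      have h4 : (1 - ‖H.1 w‖)⁻¹ ≤ 2 := by
        rw [inv_le_comm₀ (by linarith) two_pos]
        linarith
      have h5 : ((Λ - H : germAlg E) : E → ℂ) w = Complex.log (1 + H.1 w) - H.1 w := rfl
      have h6 : ((H * H : germAlg E) : E → ℂ) w = H.1 w * H.1 w := rfl
      rw [h5, h6, norm_mul, one_mul]
      refine h3.trans ?_
      nlinarith [mul_self_nonneg ‖H.1 w‖]
    have h2 : H - G ∈ ordIdeal E (j + 1) := by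
      have h3 : -(H * a) ∈ ordIdeal E (j + 1) := neg_mem (mul_mem_ordIdeal hH ha)
      have h4 : H - G - -(H * a) ∈ nullIdeal E := by
        rw [mem_nullIdeal]
        filter_upwards [hane] with w hw
        change H.1 w - G.1 w - -(H.1 w * a.1 w) = 0
        rw [hHw]
        field_simp
        ring
      have := add_mem (nullIdeal_le_ordIdeal (j + 1) h4) h3
      rwa [sub_add_cancel] at this
    have := add_mem h1 h2
    rwa [sub_add_sub_cancel] at this
  · filter_upwards [hane, hHne] with w hw hw'
    change Complex.exp (Complex.log (1 + H.1 w)) * _ = _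
    rw [Complex.exp_log hw', hHw]
    field_simp

/-- Take the product of `X - a ^ η` over the eigenvalues `a` of `D`, using that `X - a` divides `X ^
η - a ^ η`. It converts annihilation by the characteristic polynomial in `C` into annihilation by a
polynomial in `C ^ η`. The value at zero does not vanish, which excludes monomials containing
nilpotent coordinates. -/
theorem Matrix.exists_polynomial_pow {κ : Type*} [Fintype κ] [DecidableEq κ] {D : Matrix κ κ ℂ}
    (hD : D.det ≠ 0) (η : ℕ) :
    ∃ Q : ℂ[X], Q.eval 0 ≠ 0 ∧ D.charpoly ∣ expand ℂ η Q ∧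
      ∀ μ, Q.eval μ = 0 → μ ∈ spectrum ℂ (D ^ η) := by
  have hroot : ∀ a ∈ D.charpoly.roots, a ∈ spectrum ℂ D := fun a ha =>
    Matrix.mem_spectrum_iff_isRoot_charpoly.2 (mem_roots'.1 ha).2
  have heval : ∀ μ : ℂ, ((D.charpoly.roots.map fun a => X - Polynomial.C (a ^ η)).prod).eval μ = 0 →
      ∃ a ∈ D.charpoly.roots, μ = a ^ η := by
    intro μ hμ
    rw [eval_multiset_prod, Multiset.map_map, Multiset.prod_eq_zero_iff, Multiset.mem_map] at hμ
    obtain ⟨a, ha, h⟩ := hμ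
    refine ⟨a, ha, ?_⟩
    simpa [sub_eq_zero] using h
  refine ⟨(D.charpoly.roots.map fun a => X - Polynomial.C (a ^ η)).prod, fun h => ?_, ?_, ?_⟩
  · obtain ⟨a, ha, h0⟩ := heval 0 h
    have ha0 : a = 0 := eq_zero_of_pow_eq_zero h0.symm
    have := hroot a ha
    rw [ha0, spectrum.zero_mem_iff, Matrix.isUnit_iff_isUnit_det] at this
    exact this (isUnit_iff_ne_zero.2 hD)
  · have h1 : D.charpoly = (D.charpoly.roots.map fun a => X - Polynomial.C a).prod :=
      (IsAlgClosed.splits _).eq_prod_roots_of_monic D.charpoly_monic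
    refine (dvd_of_eq h1).trans ?_
    rw [map_multiset_prod, Multiset.map_map]
    refine Multiset.prod_dvd_prod_of_dvd _ _ fun a _ => ?_
    simp only [Function.comp, map_sub, expand_X, expand_C, map_pow]
    exact sub_dvd_pow_sub_pow _ _ _
  · intro μ hμ
    obtain ⟨a, ha, rfl⟩ := heval μ hμ
    exact spectrum.pow_mem_pow _ _ (hroot a ha)

/-- The secondary normal form, at the level of jets. -/
theorem IsContractingGerm.exists_secondary_jet [FiniteDimensional ℂ E]
    (hf : IsContractingGerm f c) {ι ν κ : Type*} [Fintype ι] [Fintype ν] [Fintype κ]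
    [DecidableEq κ] {D : Matrix κ κ ℂ}
    (hD : D.det ≠ 0) {η N : ℕ} {ω : ι → ℂ} {x : ι → germAlg E} {z : ν → germAlg E}
    (hx0 : ∀ i, (x i : E → ℂ) 0 = 0)
    (hcoord : IsLocalBiholomorphism fun w s => (Sum.elim x z s : germAlg E).1 w)
    (hx : ∀ i, IsGenEig (germPullback f hf.analyticAt hf.map_zero ^ η).toLinearMap
        ((ordIdeal E N).restrictScalars ℂ) (ω i) (x i))
    (hz : ∀ j, IsGenEig (germPullback f hf.analyticAt hf.map_zero ^ η).toLinearMap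
        ((ordIdeal E N).restrictScalars ℂ) 0 (z j))
    (Φ : κ → germAlg E) (hΦ : ∀ k, (Φ k : E → ℂ) 0 = 0) {j : ℕ} (hj : 1 ≤ j) (hjN : j ≤ N) :
    ∃ (L Ψ : κ → germAlg E) (g : κ → MvPolynomial ι ℂ),
      (∀ k, MvPolynomial.constantCoeff (g k) = 0) ∧
      (∀ k, ∀ n ∈ (g k).support, (n.prod fun i s => ω i ^ s) ∈ spectrum ℂ (D ^ η)) ∧
      (∀ k, ∀ᶠ w in 𝓝 0, Complex.exp ((Ψ k).1 w) = 1 + (MvPolynomial.aeval x (g k)).1 w) ∧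
      ∀ k, germPullback f hf.analyticAt hf.map_zero (L k) - ∑ l, D l k • L l + (Φ k - Ψ k) ∈
        ordIdeal E j := by
  classical
  set C := germPullback f hf.analyticAt hf.map_zero with hC
  have hCord : ∀ N, ∀ a ∈ ordIdeal E N, C a ∈ ordIdeal E N :=
    fun N a ha => germPullback_mem_ordIdeal hf.analyticAt hf.map_zero a ha
  have hCη : ∀ a ∈ ordIdeal E N, (C ^ η) a ∈ ordIdeal E N := by
    have : ∀ n, ∀ a ∈ ordIdeal E N, (C ^ n) a ∈ ordIdeal E N := by
      intro n a ha
      induction n with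
      | zero => exact ha
      | succ n ih => rw [pow_succ', AlgHom.mul_apply]; exact hCord N _ ih
    exact this η
  -- The error is improved by one order at a time. The spectral analysis is always done modulo the
  -- fixed order `N`.
  induction j, hj using Nat.le_induction with
  | base =>
    refine ⟨0, 0, 0, by simp, by simp, fun k => Eventually.of_forall fun w => ?_, fun k => ?_⟩
    · simp
    · simpa using mem_ordIdeal_one.2 (hΦ k)
  | succ j hj ih =>
    obtain ⟨L, Ψ, g, hg0, hgres, hΨ, herr⟩ := ih (Nat.le_of_succ_le hjN)
    obtain ⟨P₀, hP₀, hP⟩ := exists_aeval_mem_ordIdeal C.toLinearMap N (hCord N)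
    -- The current error is replaced by a part `b` of the same order `j` whose jet is resonant.
    obtain ⟨L', b, hLb, ⟨n, hn⟩, hJ⟩ := exists_cohomological_solution
      (C := C.toLinearMap) (I := (ordIdeal E N).restrictScalars ℂ) (hCord N) hP₀ hP D
      (fun k => C (L k) - ∑ l, D l k • L l + (Φ k - Ψ k))
    obtain ⟨-, hb⟩ := hJ ((ordIdeal E j).restrictScalars ℂ) (hCord j) herr
    obtain ⟨Q, hQ0, hQdvd, hQspec⟩ := Matrix.exists_polynomial_pow hD η
    have hQb : ∀ k, Polynomial.aeval (C ^ η).toLinearMap (Q ^ n) (b k) ∈ ordIdeal E N := by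
      intro k
      rw [AlgHom.toLinearMap_pow, ← expand_aeval, map_pow (expand ℂ η)]
      exact aeval_mem_of_dvd (C := C.toLinearMap) (I := (ordIdeal E N).restrictScalars ℂ)
        (hCord N) (pow_dvd_pow_of_dvd hQdvd n) (hn k)
    choose P hPb hPn using fun k => exists_mvPolynomial_of_aeval_mem' hCη hx hz
      (exists_aeval_sub_mem_ordIdeal hcoord (b k) N)
      (by rw [eval_pow]; exact pow_ne_zero n hQ0) (hQb k)
    have hPord : ∀ k, MvPolynomial.aeval x (P k) ∈ ordIdeal E j := by
      intro k
      have := sub_mem (show b k ∈ ordIdeal E j from hb k)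
        (ordIdeal_anti (Nat.le_of_succ_le hjN) (hPb k))
      rwa [sub_sub_cancel] at this
    have hconst : ∀ Q : MvPolynomial ι ℂ, (MvPolynomial.aeval x Q : germAlg E).1 0 =
        MvPolynomial.constantCoeff Q := by
      intro Q
      rw [germAlg.aeval_apply, ← MvPolynomial.eval_zero]
      congr 2
      exact funext hx0
    choose Λ hΛ hΛexp using fun k => germAlg.exists_log_add hj
      (a := MvPolynomial.aeval x (g k)) (mem_ordIdeal_one.2 ((hconst _).trans (hg0 k))) (hPord k)
    refine ⟨L + L', Ψ + Λ, g + P, fun k => ?_, fun k m hm => ?_, fun k => ?_, fun k => ?_⟩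
    · rw [Pi.add_apply, map_add, hg0, zero_add, ← hconst]
      exact mem_ordIdeal_one.1 (ordIdeal_anti hj (hPord k))
    · rcases Finset.mem_union.1 (MvPolynomial.support_add hm) with h | h
      · exact hgres k m h
      · have := hPn k m h
        rw [eval_pow] at this
        exact hQspec _ (eq_zero_of_pow_eq_zero this)
    · filter_upwards [hΨ k, hΛexp k] with w h1 h2
      change Complex.exp ((Ψ k).1 w + (Λ k).1 w) = _
      rw [Complex.exp_add, h1, mul_comm, h2, Pi.add_apply, map_add, add_assoc]
      rfl
    -- The new error is `b - Λ = (b - P(x)) - (Λ - P(x))`: the first term has order `N`, the second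
    -- order `j + 1`.
    · have h1 := sub_mem (ordIdeal_anti hjN (hPb k)) (hΛ k)
      refine (congrArg (· ∈ ordIdeal E (j + 1)) ?_).mp h1
      rw [← hLb k]
      simp only [Pi.add_apply, map_add, smul_add, Finset.sum_add_distrib, AlgHom.toLinearMap_apply]
      abel

/-- The secondary normal form. -/
theorem IsContractingGerm.exists_secondary_normal_form [FiniteDimensional ℂ E]
    (hf : IsContractingGerm f c) {κ : Type*} [Fintype κ]
    [DecidableEq κ] {D : Matrix κ κ ℂ} (hD : D.det ≠ 0) (η : ℕ) :
    ∃ N₁ : ℕ, ∀ N ≥ N₁, ∀ {ι ν : Type} [Fintype ι] [Fintype ν] {ω : ι → ℂ} {x : ι → germAlg E}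
      {z : ν → germAlg E}, (∀ i, (x i : E → ℂ) 0 = 0) →
      (IsLocalBiholomorphism fun w s => (Sum.elim x z s : germAlg E).1 w) →
      (∀ i, IsGenEig (germPullback f hf.analyticAt hf.map_zero ^ η).toLinearMap
        ((ordIdeal E N).restrictScalars ℂ) (ω i) (x i)) →
      (∀ j, IsGenEig (germPullback f hf.analyticAt hf.map_zero ^ η).toLinearMap
        ((ordIdeal E N).restrictScalars ℂ) 0 (z j)) →
      ∀ (Φ : κ → germAlg E), (∀ k, (Φ k : E → ℂ) 0 = 0) →
      ∃ (L : κ → germAlg E) (g : κ → MvPolynomial ι ℂ),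
        (∀ k, MvPolynomial.constantCoeff (g k) = 0) ∧
        (∀ k, ∀ n ∈ (g k).support, (n.prod fun i s => ω i ^ s) ∈ spectrum ℂ (D ^ η)) ∧
        ∀ᶠ w in 𝓝 0, ∀ k, Complex.exp ((Φ k).1 w + (L k).1 (f w) - ∑ l, D l k * (L l).1 w) =
          1 + MvPolynomial.eval (fun i => (x i).1 w) (g k) := by
  have hu : IsUnit D.transpose.det := by
    rw [Matrix.det_transpose]; exact isUnit_iff_ne_zero.2 hD
  let T : (κ → ℂ) ≃L[ℂ] (κ → ℂ) :=
    (Matrix.toLinearEquiv' D.transpose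
      (Matrix.invertibleOfIsUnitDet _ hu)).toContinuousLinearEquiv
  have hT : ∀ y k, T y k = ∑ l, D l k * y l := fun y k => rfl
  -- The threshold involves only `D` and the contraction rate, so it can be fixed before the
  -- coordinates `x` are constructed.
  obtain ⟨N₁, hN₁, hTN⟩ := exists_pow_mul_lt_one (ι := Unit) hf.pos hf.lt_one
    (fun _ => ‖(T.symm : (κ → ℂ) →L[ℂ] (κ → ℂ))‖) 1
  refine ⟨N₁, fun N hN ι ν _ _ ω x z hx0 hcoord hx hz Φ hΦ => ?_⟩
  have hTN' : ‖(T.symm : (κ → ℂ) →L[ℂ] (κ → ℂ))‖ * c ^ N < 1 :=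
    (mul_le_mul_of_nonneg_left (pow_le_pow_of_le_one hf.pos.le hf.lt_one.le hN)
      (norm_nonneg _)).trans_lt (hTN ())
  obtain ⟨L, Ψ, g, hg0, hgres, hΨ, herr⟩ := hf.exists_secondary_jet hD hx0 hcoord hx hz Φ hΦ
    (hN₁.trans hN) le_rfl
  -- The jet problem leaves an error of order `N`, which a convergent solution with `T = Dᵀ` removes
  -- without changing `g`.
  obtain ⟨L', -, hL'⟩ := hf.exists_germ_solution T hTN' _ herr
  refine ⟨L + L', g, hg0, hgres, ?_⟩
  filter_upwards [hL', eventually_all.2 hΨ] with w h1 h2 k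
  rw [← germAlg.aeval_apply, ← h2 k]
  congr 1
  have h3 := h1 k
  rw [hT] at h3
  have h4 : ((germPullback f hf.analyticAt hf.map_zero (L k) - ∑ l, D l k • L l + (Φ k - Ψ k) :
      germAlg E) : E → ℂ) w = (L k).1 (f w) - ∑ l, D l k * (L l).1 w +
        ((Φ k).1 w - (Ψ k).1 w) := by
    have h5 : ((∑ l, D l k • L l : germAlg E) : E → ℂ) w = ∑ l, D l k * (L l).1 w := by
      rw [AddSubmonoidClass.coe_finsetSum, Finset.sum_apply]
      rfl
    rw [← h5]
    rfl
  rw [h4] at h3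
  have h6 : ((L + L') k).1 (f w) = (L k).1 (f w) + (L' k).1 (f w) := rfl
  have h7 : ∀ l, ((L + L') l).1 w = (L l).1 w + (L' l).1 w := fun l => rfl
  simp only [h6, h7, mul_add, Finset.sum_add_distrib, h3]
  ring

end Secondary

/-! ### Transport of the critical set, and the nilpotent fibre direction -/

section Transport

variable {E F : Type*} [NormedAddCommGroup E] [NormedSpace ℂ E]
  [NormedAddCommGroup F] [NormedSpace ℂ F] {f : E → E} {f' : F → F} {c : ℝ}

theorem LinearMap.det_eq_zero_iff_of_comp [FiniteDimensional ℂ E] [FiniteDimensional ℂ F]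
    {A : E →ₗ[ℂ] E} {A' : F →ₗ[ℂ] F} {S T : E →ₗ[ℂ] F} (hS : Function.Injective S)
    (hT : Function.Bijective T) (h : ∀ v, A' (T v) = S (A v)) :
    LinearMap.det A' = 0 ↔ LinearMap.det A = 0 := by
  rw [← not_iff_not, LinearMap.det_eq_zero_iff_ker_ne_bot, LinearMap.det_eq_zero_iff_ker_ne_bot,
    not_not, not_not, LinearMap.ker_eq_bot, LinearMap.ker_eq_bot,
    ← Function.Injective.of_comp_iff' A' hT, ← hS.of_comp_iff A]
  have : (A' ∘ T : E → F) = S ∘ A := funext h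
  rw [this]

theorem fderiv_injective_of_leftInverse {Φ : E → F} {Ψ : F → E} {w : E}
    (hΦ : DifferentiableAt ℂ Φ w) (hΨ : DifferentiableAt ℂ Ψ (Φ w))
    (h : ∀ᶠ u in 𝓝 w, Ψ (Φ u) = u) : Function.LeftInverse (fderiv ℂ Ψ (Φ w)) (fderiv ℂ Φ w) := by
  have h1 : HasFDerivAt (fun x => Ψ (Φ x)) ((fderiv ℂ Ψ (Φ w)).comp (fderiv ℂ Φ w)) w :=
    hΨ.hasFDerivAt.comp w hΦ.hasFDerivAt
  have h2 : HasFDerivAt (fun x => Ψ (Φ x)) (ContinuousLinearMap.id ℂ E) w :=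
    (hasFDerivAt_id w).congr_of_eventuallyEq h
  intro v
  exact congrArg (fun T : E →L[ℂ] E => T v) (h1.unique h2)

/-- The generalized critical set of a contracting germ is transported by conjugacies. -/
theorem ContractsWith.critInf_conj [FiniteDimensional ℂ E] [FiniteDimensional ℂ F]
    (hf : AnalyticAt ℂ f 0) (hf0 : f 0 = 0) (hfc : ContractsWith f c) (hc0 : 0 ≤ c) (hc1 : c ≤ 1)
    {Φ : E → F} {Ψ : F → E} (hΦ : AnalyticAt ℂ Φ 0) (hΦ0 : Φ 0 = 0) (hΨ : AnalyticAt ℂ Ψ 0)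
    (hΨ0 : Ψ 0 = 0) (hl : ∀ᶠ x in 𝓝 0, Ψ (Φ x) = x) (hr : ∀ᶠ y in 𝓝 0, Φ (Ψ y) = y)
    (hconj : ∀ᶠ x in 𝓝 0, Φ (f x) = f' (Φ x)) :
    ∀ᶠ t in 𝓝 0, t ∈ critInf f' ↔ Ψ t ∈ critInf f := by
  have tf := tendsto_zero_of_analyticAt hf hf0
  have tΦ := tendsto_zero_of_analyticAt hΦ hΦ0
  have tΨ := tendsto_zero_of_analyticAt hΨ hΨ0
  -- Near 0 the differential of `Φ` is injective at `f w` and bijective at `w`, so by the chain rule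
  -- `f` and `f'` are singular at corresponding points.
  have hgood : ∀ᶠ w in 𝓝 (0 : E), Φ (f w) = f' (Φ w) ∧
      (w ∈ critSet f ↔ Φ w ∈ critSet f') := by
    filter_upwards [hconj.eventually_nhds, hl.eventually_nhds, tΦ.eventually hr.eventually_nhds,
      tf.eventually hl.eventually_nhds, hf.eventually_analyticAt, hΦ.eventually_analyticAt,
      tf.eventually hΦ.eventually_analyticAt, tΦ.eventually hΨ.eventually_analyticAt,
      (tΦ.comp tf).eventually hΨ.eventually_analyticAt] with w h1 h2 h3 h4 h5 h6 h7 h8 h9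
    refine ⟨h1.self_of_nhds, ?_⟩
    have hw : Ψ (Φ w) = w := h2.self_of_nhds
    have hl1 := fderiv_injective_of_leftInverse h6.differentiableAt h8.differentiableAt h2
    have hl2 := fderiv_injective_of_leftInverse h7.differentiableAt h9.differentiableAt h4
    have hr1 := fderiv_injective_of_leftInverse (w := Φ w) (Φ := Ψ) (Ψ := Φ) h8.differentiableAt
      (by rw [hw]; exact h6.differentiableAt) h3
    rw [hw] at hr1
    have htend : Tendsto Ψ (𝓝 (Φ w)) (𝓝 w) := by
      have := h8.continuousAt.tendsto
      rwa [hw] at this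
    have heq : f' =ᶠ[𝓝 (Φ w)] fun y => Φ (f (Ψ y)) := by
      filter_upwards [htend.eventually h1, h3] with y hy1 hy2
      rw [hy1, hy2]
    have hder : HasFDerivAt f' ((fderiv ℂ Φ (f w)).comp ((fderiv ℂ f w).comp
        (fderiv ℂ Ψ (Φ w)))) (Φ w) := by
      refine HasFDerivAt.congr_of_eventuallyEq ?_ heq
      refine HasFDerivAt.comp (g := Φ) (Φ w) ?_ (HasFDerivAt.comp (g := f) (Φ w) ?_
        h8.differentiableAt.hasFDerivAt)
      · rw [hw]; exact h7.differentiableAt.hasFDerivAt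
      · rw [hw]; exact h5.differentiableAt.hasFDerivAt
    refine (LinearMap.det_eq_zero_iff_of_comp (S := (fderiv ℂ Φ (f w) : E →ₗ[ℂ] F))
      (T := (fderiv ℂ Φ w : E →ₗ[ℂ] F)) hl2.injective ⟨hl1.injective, hr1.surjective⟩ ?_).symm
    intro v
    rw [hder.fderiv]
    change fderiv ℂ Φ (f w) (fderiv ℂ f w (fderiv ℂ Ψ (Φ w) (fderiv ℂ Φ w v))) = _
    rw [hl1 v]
    rfl
  obtain ⟨δ', hδ', hball⟩ := Metric.eventually_nhds_iff.1 hgood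
  obtain ⟨K, hK, δ, hδ, H⟩ := hfc
  -- Contraction keeps entire orbits where the pointwise comparison holds. This uniformity in `n` is
  -- what the infinite union requires.
  have horb : ∀ᶠ w in 𝓝 (0 : E), ∀ n, dist (f^[n] w) 0 < δ' := by
    filter_upwards [Metric.ball_mem_nhds (0 : E) hδ,
      Metric.ball_mem_nhds (0 : E) (div_pos hδ' hK)] with w h1 h2 n
    rw [mem_ball_zero_iff] at h1 h2
    rw [dist_zero_right]
    refine (H n w h1).trans_lt ?_
    have h3 : c ^ n ≤ 1 := pow_le_one₀ hc0 hc1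
    calc K * c ^ n * ‖w‖ ≤ K * 1 * ‖w‖ := by gcongr
      _ = ‖w‖ * K := by ring
      _ < δ' := (lt_div_iff₀ hK).1 h2
  filter_upwards [tΨ.eventually horb, hr] with t h1 h2
  have hit : ∀ n, f'^[n] t = Φ (f^[n] (Ψ t)) := by
    intro n
    induction n with
    | zero => exact h2.symm
    | succ n ih =>
      rw [Function.iterate_succ_apply', Function.iterate_succ_apply', ih]
      exact (hball (h1 n)).1.symm
  simp only [critInf, Set.mem_iUnion, Set.mem_preimage, hit]
  exact exists_congr fun n => (hball (h1 n)).2.symm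

theorem IsLocalBiholomorphism.continuousLinearEquiv_comp {G : Type*} [NormedAddCommGroup G]
    [NormedSpace ℂ G] {Φ : E → F} (h : IsLocalBiholomorphism Φ) (e : F ≃L[ℂ] G) :
    IsLocalBiholomorphism fun x => e (Φ x) := by
  obtain ⟨hΦ, h0, Ψ, hΨ, hΨ0, hl, hr⟩ := h
  refine ⟨(e.toContinuousLinearMap.analyticAt _).comp hΦ, by simp only [h0, map_zero],
    fun y => Ψ (e.symm y), ?_, by simp only [map_zero, hΨ0], ?_, ?_⟩
  · exact AnalyticAt.comp_of_eq hΨ (e.symm.toContinuousLinearMap.analyticAt 0) (map_zero _)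
  · filter_upwards [hl] with x hx
    rw [e.symm_apply_apply, hx]
  · have : Tendsto e.symm (𝓝 0) (𝓝 0) := by
      simpa using e.symm.continuous.tendsto 0
    filter_upwards [this.eventually hr] with y hy
    rw [hy, e.apply_symm_apply]

/-- The fibre direction of a skew product `(x, y, z) ↦ (…, …, h(x, y, z))` is nilpotent, as soon as
the differentials of iterates only involve the differentials of the coordinates `x`. -/
theorem isNilpotent_fderiv_of_conj [FiniteDimensional ℂ E] {X Y Z : Type*} [NormedAddCommGroup X]
    [NormedSpace ℂ X] [NormedAddCommGroup Y] [NormedSpace ℂ Y] [NormedAddCommGroup Z]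
    [NormedSpace ℂ Z] (hf : AnalyticAt ℂ f 0) {Φ : E → X × Y × Z}
    {Ψ : X × Y × Z → E} (hΦ : AnalyticAt ℂ Φ 0) (hΨ : AnalyticAt ℂ Ψ 0)
    (hΨ0 : Ψ 0 = 0) (hr : ∀ᶠ y in 𝓝 0, Φ (Ψ y) = y)
    {h : X × Y × Z → Z} (hh : AnalyticAt ℂ h 0) (hh0 : h 0 = 0)
    (heq : ∀ᶠ z in 𝓝 (0 : Z), f (Ψ (0, 0, z)) = Ψ (0, 0, h (0, 0, z))) {n : ℕ}
    (hn : ∀ v, (fderiv ℂ Φ 0 v).1 = 0 → ((fderiv ℂ f 0) ^ n) v = 0) :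
    IsNilpotent (fderiv ℂ (fun z : Z => h (0, 0, z)) 0) := by
  set ι : Z →L[ℂ] X × Y × Z := (ContinuousLinearMap.inr ℂ X (Y × Z)).comp
    (ContinuousLinearMap.inr ℂ Y Z) with hι
  have hι0 : ι 0 = 0 := map_zero ι
  set H := fderiv ℂ (fun z : Z => h (0, 0, z)) 0 with hH
  set J : Z →L[ℂ] E := (fderiv ℂ Ψ 0).comp ι with hJ
  have hhι : HasFDerivAt (fun z : Z => h (ι z)) H 0 := by
    refine DifferentiableAt.hasFDerivAt (f := fun z : Z => h (0, 0, z)) ?_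
    exact (AnalyticAt.comp_of_eq hh (ι.analyticAt 0) hι0).differentiableAt
  have hΨd : HasFDerivAt Ψ (fderiv ℂ Ψ 0) 0 := hΨ.differentiableAt.hasFDerivAt
  have hj : HasFDerivAt (fun z : Z => Ψ (ι z)) J 0 := by
    refine HasFDerivAt.comp (g := Ψ) (0 : Z) ?_ ι.hasFDerivAt
    rwa [hι0]
  have h1 : HasFDerivAt (fun z : Z => f (Ψ (ι z))) ((fderiv ℂ f 0).comp J) 0 := by
    refine HasFDerivAt.comp (g := f) (0 : Z) ?_ hj
    rw [hι0, hΨ0]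
    exact hf.differentiableAt.hasFDerivAt
  have h2 : HasFDerivAt (fun z : Z => Ψ (ι (h (ι z)))) (J.comp H) 0 := by
    refine HasFDerivAt.comp (g := fun z => Ψ (ι z)) (0 : Z) ?_ hhι
    rwa [hι0, hh0]
  -- `J` embeds the fibre direction and intertwines `H` with the differential of `f`. Its image has
  -- no `x`-component, so a power of that differential kills it, and `J` is injective.
  have h3 : (fderiv ℂ f 0).comp J = J.comp H := h1.unique (h2.congr_of_eventuallyEq heq)
  have h4 : ∀ n z, ((fderiv ℂ f 0) ^ n) (J z) = J ((H ^ n) z) := by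
    intro n
    induction n with
    | zero => exact fun z => rfl
    | succ n ih =>
      intro z
      rw [pow_succ, pow_succ, mul_apply_eq_comp, mul_apply_eq_comp, ← ih]
      exact congrArg _ (congrArg (fun T : Z →L[ℂ] E => T z) h3)
  have h5 : Function.LeftInverse (fderiv ℂ Φ 0) (fderiv ℂ Ψ 0) := by
    have := fderiv_injective_of_leftInverse (w := 0) (Φ := Ψ) (Ψ := Φ) hΨ.differentiableAt
      (by rw [hΨ0]; exact hΦ.differentiableAt) hr
    rwa [hΨ0] at this
  refine ⟨n, ?_⟩
  ext z
  have h6 : J ((H ^ n) z) = 0 := by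
    rw [← h4]
    refine hn _ ?_
    rw [hJ, ContinuousLinearMap.comp_apply, h5]
    rfl
  have h7 : ι ((H ^ n) z) = 0 := by
    have := h5 (ι ((H ^ n) z))
    rw [← this]
    exact (congrArg _ h6).trans (map_zero _)
  exact (Prod.ext_iff.1 (Prod.ext_iff.1 h7).2).2

theorem exists_complementary_family {V : Type*} [AddCommGroup V] [Module ℂ V]
    [FiniteDimensional ℂ V] {ι : Type*} [Fintype ι] {u : ι → V} (hu : LinearIndependent ℂ u) :
    ∃ (m : ℕ) (b : Fin m → V), LinearIndependent ℂ (Sum.elim u b) ∧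
      ⊤ ≤ Submodule.span ℂ (Set.range (Sum.elim u b)) := by
  obtain ⟨W, hW⟩ := Submodule.exists_isCompl (Submodule.span ℂ (Set.range u))
  let b := Module.finBasis ℂ W
  have hspan : Submodule.span ℂ (Set.range fun i => (b i : V)) = W := by
    have : (Set.range fun i => (b i : V)) = W.subtype '' Set.range b := by
      rw [← Set.range_comp]; rfl
    rw [this, Submodule.span_image, b.span_eq, Submodule.map_top, Submodule.range_subtype]
  refine ⟨_, fun i => (b i : V), hu.sum_type (b.linearIndependent.map' W.subtype
    W.ker_subtype) ?_, ?_⟩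
  · change Disjoint _ (Submodule.span ℂ (Set.range fun i => (b i : V)))
    rw [hspan]
    exact hW.disjoint
  · rw [Set.Sum.elim_range, Submodule.span_union, hspan, hW.sup_eq_top]

/-- A linearly independent family of generalized eigenvectors for non-zero eigenvalues together with
a linearly independent family of nilpotent vectors. -/
theorem LinearIndependent.sum_elim_of_isGenEig {V : Type*} [AddCommGroup V] [Module ℂ V]
    {M : Module.End ℂ V} {ι κ : Type*} [Fintype ι] [Fintype κ] {u : ι → V} {y : κ → V}
    (hu : LinearIndependent ℂ u) (hy : LinearIndependent ℂ y) {μ : ι → ℂ} (hμ : ∀ i, μ i ≠ 0)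
    (h : ∀ i, IsGenEig M ⊥ (μ i) (u i)) (h' : ∀ k, IsGenEig M ⊥ 0 (y k)) :
    LinearIndependent ℂ (Sum.elim u y) := by
  rw [Fintype.linearIndependent_iff] at hy ⊢
  intro a ha
  rw [Fintype.sum_sum_type] at ha
  simp only [Sum.elim_inl, Sum.elim_inr] at ha
  have h1 : ∑ i, a (Sum.inl i) • u i = ∑ k, (-a (Sum.inr k)) • y k := by
    rw [eq_neg_of_add_eq_zero_left ha, ← Finset.sum_neg_distrib]
    simp only [neg_smul]
  -- A relation identifies a combination of the `u i` with one of the `y k`, which is a generalized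
  -- eigenvector for zero; hence its `u`-coefficients vanish.
  have h2 : IsGenEig M ⊥ 0 (∑ i, a (Sum.inl i) • u i) := by
    rw [h1]
    exact IsGenEig.sum (bot_invariant M) _ fun k _ => (h' k).smul _
  have h3 : ∀ i, a (Sum.inl i) = 0 := fun i => hu.eq_zero_of_isGenEig_sum h h2 (hμ i)
  simp only [h3, zero_smul, Finset.sum_const_zero, zero_add] at ha
  rintro (i | k)
  exacts [h3 i, hy _ ha k]

end Transport

/-! ### Differentials of generalized eigenvectors and of contracted components -/

section Coordinates

open Polynomial

variable {E : Type*} [NormedAddCommGroup E] [NormedSpace ℂ E] {f : E → E} {c : ℝ}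

theorem map_aeval_of_intertwining {K A V : Type*} [Field K] [AddCommGroup A] [Module K A]
    [AddCommGroup V] [Module K V] {C : A →ₗ[K] A} {M : V →ₗ[K] V} {δ : A →ₗ[K] V}
    (h : ∀ a, δ (C a) = M (δ a)) (χ : K[X]) (a : A) :
    δ (Polynomial.aeval C χ a) = Polynomial.aeval M χ (δ a) := by
  induction χ using Polynomial.induction_on generalizing a with
  | C k => simp only [aeval_C, Module.algebraMap_end_apply, map_smul]
  | add p q hp hq => simp only [map_add, LinearMap.add_apply, hp, hq]
  | monomial n k ih =>
    rw [pow_succ, ← mul_assoc, map_mul (Polynomial.aeval C) _ X, map_mul (Polynomial.aeval M) _ X, aeval_X, aeval_X, Module.End.mul_apply,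
      Module.End.mul_apply, ih, h]

theorem IsGenEig.germDeriv (hf : AnalyticAt ℂ f 0) (hf0 : f 0 = 0) {η N : ℕ} (hN : 2 ≤ N) {μ : ℂ}
    {φ : germAlg E} (h : IsGenEig (germPullback f hf hf0 ^ η).toLinearMap
      ((ordIdeal E N).restrictScalars ℂ) μ φ) :
    IsGenEig ((Module.Dual.transpose (R := ℂ) (fderiv ℂ f 0 : E →ₗ[ℂ] E) :
      Module.End ℂ (Module.Dual ℂ E)) ^ η) ⊥ μ (_root_.germDeriv E φ) := by
  obtain ⟨n, hn⟩ := h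
  refine ⟨n, ?_⟩
  rw [← map_aeval_of_intertwining (C := (germPullback f hf hf0 ^ η).toLinearMap)
    (germDeriv_germPullback_pow hf hf0 η)]
  exact germDeriv_eq_zero (ordIdeal_anti hN hn)

theorem exists_pow_apply_mem_of_span {K V : Type*} [Field K] [AddCommGroup V] [Module K V]
    [FiniteDimensional K V] {M : Module.End K V} {S : Submodule K V} (hS : ∀ a ∈ S, M a ∈ S)
    {s : Set V} (hs : ⊤ ≤ Submodule.span K s) (h : ∀ a ∈ s, ∃ n : ℕ, (M ^ n) a ∈ S) :
    ∃ n : ℕ, ∀ a, (M ^ n) a ∈ S := by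
  have hpow : ∀ n, ∀ a ∈ S, (M ^ n) a ∈ S := by
    intro n a ha
    induction n with
    | zero => exact ha
    | succ n ih => rw [pow_succ', Module.End.mul_apply]; exact hS _ ih
  have hle : ∀ {n m : ℕ} {a : V}, n ≤ m → (M ^ n) a ∈ S → (M ^ m) a ∈ S := by
    intro n m a hnm ha
    obtain ⟨k, rfl⟩ := Nat.exists_eq_add_of_le hnm
    rw [add_comm, pow_add, Module.End.mul_apply]
    exact hpow k _ ha
  have h1 : ∀ a, ∃ n : ℕ, (M ^ n) a ∈ S := by
    intro a
    have ha : a ∈ Submodule.span K s := hs trivial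
    induction ha using Submodule.span_induction with
    | mem x hx => exact h x hx
    | zero => exact ⟨0, by rw [map_zero]; exact S.zero_mem⟩
    | add x y _ _ hx hy =>
      obtain ⟨n, hn⟩ := hx
      obtain ⟨m, hm⟩ := hy
      refine ⟨n + m, ?_⟩
      rw [map_add]
      exact S.add_mem (hle (Nat.le_add_right _ _) hn) (hle (Nat.le_add_left _ _) hm)
    | smul k x _ hx =>
      obtain ⟨n, hn⟩ := hx
      exact ⟨n, by rw [map_smul]; exact S.smul_mem k hn⟩
  choose n hn using h1
  let b := Module.finBasis K V
  refine ⟨∑ i, n (b i), fun a => ?_⟩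
  rw [← b.sum_repr a, map_sum]
  refine S.sum_mem fun i _ => ?_
  rw [map_smul]
  exact S.smul_mem _ (hle (Finset.single_le_sum (f := fun i => n (b i)) (fun _ _ => Nat.zero_le _)
    (Finset.mem_univ i)) (hn _))

theorem IsGenEig.exists_pow_apply_mem {K V : Type*} [Field K] [AddCommGroup V] [Module K V]
    {M : Module.End K V} {η : ℕ} {a : V} (h : IsGenEig (M ^ η) ⊥ 0 a) : ∃ n, (M ^ n) a = 0 := by
  obtain ⟨n, hn⟩ := h
  refine ⟨η * n, ?_⟩
  rw [pow_mul]
  simpa using hn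

/-- The differentials of components that are contracted by the germ are nilpotent. -/
theorem isGenEig_germDeriv_of_monomial (hf : AnalyticAt ℂ f 0) (hf0 : f 0 = 0) {r p : ℕ}
    {Cm : Matrix (Fin r) (Fin p) ℕ} {D : Matrix (Fin p) (Fin p) ℕ} {ht : Fin p → ℕ}
    (hcol : ∀ k, 2 ≤ ∑ i, Cm i k + ∑ l, D l k ∨
      ∃ l, ht l < ht k ∧ (∀ i, Cm i k = 0) ∧ ∀ j, D j k = if j = l then 1 else 0)
    {U : Fin r → germAlg E} {Y : Fin p → germAlg E} (hU0 : ∀ i, (U i).1 0 = 0)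
    (hY0 : ∀ k, (Y k).1 0 = 0) {v : Fin p → germAlg E}
    (hY : ∀ k, ∀ᶠ w in 𝓝 0, (Y k).1 (f w) =
      (v k).1 w * ((∏ i, (U i).1 w ^ Cm i k) * ∏ l, (Y l).1 w ^ D l k)) (k : Fin p) :
    IsGenEig (Module.Dual.transpose (R := ℂ) (fderiv ℂ f 0 : E →ₗ[ℂ] E) :
      Module.End ℂ (Module.Dual ℂ E)) ⊥ 0 (germDeriv E (Y k)) := by
  set M : Module.End ℂ (Module.Dual ℂ E) :=
    Module.Dual.transpose (R := ℂ) (fderiv ℂ f 0 : E →ₗ[ℂ] E) with hM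
  have hC : ∀ k, germPullback f hf hf0 (Y k) -
      v k * ((∏ i, U i ^ Cm i k) * ∏ l, Y l ^ D l k) ∈ nullIdeal E := by
    intro k
    rw [mem_nullIdeal]
    filter_upwards [hY k] with w hw
    have h1 : ((v k * ((∏ i, U i ^ Cm i k) * ∏ l, Y l ^ D l k) : germAlg E) : E → ℂ) w =
        (v k).1 w * ((∏ i, (U i).1 w ^ Cm i k) * ∏ l, (Y l).1 w ^ D l k) := by
      simp only [MulMemClass.coe_mul, SubmonoidClass.coe_finsetProd, SubmonoidClass.coe_pow,
        Pi.mul_apply, Finset.prod_apply, Pi.pow_apply]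
    change (Y k).1 (f w) - _ = 0
    rw [h1, hw, sub_self]
  have hMd : ∀ k, M (germDeriv E (Y k)) =
      germDeriv E (v k * ((∏ i, U i ^ Cm i k) * ∏ l, Y l ^ D l k)) := fun k => by
    rw [hM, ← germDeriv_germPullback hf hf0]
    exact germDeriv_eq_of_sub_mem_null (hC k)
  -- Induction on the height. A column of sum at least two makes the pullback of `Y k` vanish to
  -- second order. Otherwise the differential of `Y k` is sent to a multiple of that of a component
  -- of smaller height.
  have key : ∀ n k, ht k = n → ∃ j, (M ^ j) (germDeriv E (Y k)) = 0 := by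
    intro n
    induction n using Nat.strong_induction_on with
    | _ n ih =>
      rintro k rfl
      rcases hcol k with h | ⟨l, hl, hCm, hD⟩
      · refine ⟨1, ?_⟩
        rw [pow_one, hMd]
        refine germDeriv_eq_zero (Ideal.mul_mem_left _ _ (ordIdeal_anti h ?_))
        exact mul_mem_ordIdeal
          (prod_pow_mem_ordIdeal _ (fun i => mem_ordIdeal_one.2 (hU0 i)) fun i => Cm i k)
          (prod_pow_mem_ordIdeal _ (fun l => mem_ordIdeal_one.2 (hY0 l)) fun l => D l k)
      · obtain ⟨j, hj⟩ := ih _ hl l rfl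
        refine ⟨j + 1, ?_⟩
        have h1 : (∏ i, U i ^ Cm i k) * ∏ l, Y l ^ D l k = Y l := by
          simp only [hCm, hD, pow_zero, Finset.prod_const_one, one_mul]
          rw [Finset.prod_eq_single l (fun b _ hb => by rw [if_neg hb, pow_zero])
            fun h => absurd (Finset.mem_univ l) h, if_pos rfl, pow_one]
        rw [pow_succ, Module.End.mul_apply, hMd, h1, germDeriv_mul, hY0, zero_smul, add_zero,
          map_smul, hj, smul_zero]
  obtain ⟨j, hj⟩ := key _ k rfl
  refine ⟨j, ?_⟩
  simpa using hj

theorem germDeriv_unit_mul (ψ : germAlg E) {φ : germAlg E} (h : (φ : E → ℂ) 0 = 0) :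
    germDeriv E (ψ * φ) = (ψ : E → ℂ) 0 • germDeriv E φ := by
  rw [germDeriv_mul, h, zero_smul, add_zero]

theorem linearIndependent_unit_mul {ι : Type*} {ψ φ : ι → germAlg E}
    (hψ : ∀ i, (ψ i : E → ℂ) 0 ≠ 0) (hφ : ∀ i, (φ i : E → ℂ) 0 = 0)
    (h : LinearIndependent ℂ fun i => germDeriv E (φ i)) :
    LinearIndependent ℂ fun i => germDeriv E (ψ i * φ i) := by
  have := h.units_smul fun i => Units.mk0 _ (hψ i)
  have heq : (fun i => germDeriv E (ψ i * φ i)) =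
      (fun i => Units.mk0 _ (hψ i)) • fun i => germDeriv E (φ i) :=
    funext fun i => germDeriv_unit_mul (ψ i) (hφ i)
  rwa [heq]

end Coordinates

/-! ### Assembly of the normalizing coordinates -/

section NormalizingCoordinates

variable {E : Type*} [NormedAddCommGroup E] [NormedSpace ℂ E] {f : E → E} {c : ℝ}

/-- Coordinates in which a contracting germ with monomial components is in normal form. -/
theorem IsContractingGerm.exists_normalizing_coordinates [FiniteDimensional ℂ E]
    (hf : IsContractingGerm f c) (hcontr : IsContracting f) {r p : ℕ} (τ : Equiv.Perm (Fin r))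
    {Cm : Matrix (Fin r) (Fin p) ℕ} {D : Matrix (Fin p) (Fin p) ℕ}
    (hD : (D.map (Nat.cast : ℕ → ℤ)).det ≠ 0) {ht : Fin p → ℕ}
    (hcol : ∀ k, 2 ≤ ∑ i, Cm i k + ∑ l, D l k ∨
      ∃ l, ht l < ht k ∧ (∀ i, Cm i k = 0) ∧ ∀ j, D j k = if j = l then 1 else 0)
    {U : Fin r → germAlg E} {Y : Fin p → germAlg E} (hU0 : ∀ i, (U i).1 0 = 0)
    (hY0 : ∀ k, (Y k).1 0 = 0)
    (hUli : LinearIndependent ℂ fun i => germDeriv E (U i))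
    (hYli : LinearIndependent ℂ fun k => germDeriv E (Y k))
    {vU : Fin r → germAlg E} (hvU : ∀ i, (vU i).1 0 ≠ 0)
    (hU : ∀ i, ∀ᶠ w in 𝓝 0, (U i).1 (f w) = (vU i).1 w * (U (τ i)).1 w)
    {vY : Fin p → germAlg E} (hvY : ∀ k, (vY k).1 0 ≠ 0)
    (hY : ∀ k, ∀ᶠ w in 𝓝 0, (Y k).1 (f w) =
      (vY k).1 w * ((∏ i, (U i).1 w ^ Cm i k) * ∏ l, (Y l).1 w ^ D l k))
    {η : ℕ} (hη : η ≠ 0) (hτ : τ ^ η = 1) :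
    ∃ (e m : ℕ) (γ : Fin r → ℂ) (β : Fin p → ℂ) (lam : Fin r ⊕ Fin e → ℂ)
      (x : Fin r ⊕ Fin e → germAlg E) (y : Fin p → germAlg E) (z : Fin m → germAlg E)
      (σ : Fin e → MvPolynomial (Fin r ⊕ Fin e) ℂ) (g : Fin p → MvPolynomial (Fin r ⊕ Fin e) ℂ),
      ((∀ i, γ i ≠ 0) ∧ (∀ k, β k ≠ 0) ∧ (∀ i, lam i ≠ 0) ∧
        ∀ i, lam (Sum.inl i) ^ η = ∏ j ∈ Finset.range η, γ ((τ ^ j) i)) ∧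
      (∀ s, (Sum.elim x (Sum.elim y z) s : germAlg E).1 0 = 0) ∧
      LinearIndependent ℂ (fun s => germDeriv E (Sum.elim x (Sum.elim y z) s)) ∧
      ⊤ ≤ Submodule.span ℂ (Set.range fun s => germDeriv E (Sum.elim x (Sum.elim y z) s)) ∧
      ListsNonzeroEigenvalues (fderiv ℂ f 0 : E →ₗ[ℂ] E) lam ∧
      (∀ᶠ w in 𝓝 0, (∀ i, (x (Sum.inl i)).1 (f w) = γ i * (x (Sum.inl (τ i))).1 w) ∧
        (∀ k, (x (Sum.inr k)).1 (f w) = lam (Sum.inr k) * (x (Sum.inr k)).1 w +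
          MvPolynomial.eval (fun i => (x i).1 w) (σ k)) ∧
        ∀ k, (y k).1 (f w) = β k * (∏ i, (x (Sum.inl i)).1 w ^ Cm i k) *
          (∏ l, (y l).1 w ^ D l k) * (1 + MvPolynomial.eval (fun i => (x i).1 w) (g k))) ∧
      (∀ᶠ w in 𝓝 0, (∀ i, (x (Sum.inl i)).1 w = 0 ↔ (U i).1 w = 0) ∧
        ∀ k, (y k).1 w = 0 ↔ (Y k).1 w = 0) ∧
      ((∀ k, MvPolynomial.constantCoeff (σ k) = 0) ∧
        (∀ k, ∀ n ∈ (σ k).support, IsPrimaryResonant lam η n (Sum.inr k)) ∧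
        IsNilpotent (Matrix.of fun k l : Fin e =>
          MvPolynomial.coeff (Finsupp.single (Sum.inr l) 1) (σ k))) ∧
      ((∀ k, MvPolynomial.constantCoeff (g k) = 0) ∧
        ∀ k, ∀ n ∈ (g k).support, IsSecondaryResonant lam η D n) ∧
      ∃ n : ℕ, ∀ l : Module.Dual ℂ E,
        ((Module.Dual.transpose (R := ℂ) (fderiv ℂ f 0 : E →ₗ[ℂ] E) :
          Module.End ℂ (Module.Dual ℂ E)) ^ n) l ∈
        Submodule.span ℂ (Set.range fun i => germDeriv E (x i)) := by
  classical
  set M : Module.End ℂ (Module.Dual ℂ E) :=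
    Module.Dual.transpose (R := ℂ) (fderiv ℂ f 0 : E →ₗ[ℂ] E) with hM
  -- the determinant over the complex numbers
  have hDdet : (D.map (Nat.cast : ℕ → ℂ)).det ≠ 0 := by
    have h1 : D.map (Nat.cast : ℕ → ℂ) = (Int.castRingHom ℂ).mapMatrix (D.map (Nat.cast : ℕ → ℤ)) := by
      ext i j
      simp
    rw [h1, ← RingHom.map_det]
    simpa using hD
  -- multiplicative normalization of the periodic components
  obtain ⟨ψ, hψ0, hψ⟩ := hf.exists_unit_of_perm τ U vU hvU hU
  set U' : Fin r → germAlg E := fun i => ψ i * U i with hU'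
  have hU'w : ∀ i w, (U' i).1 w = (ψ i).1 w * (U i).1 w := fun i w => rfl
  have hU'0 : ∀ i, (U' i).1 0 = 0 := fun i => by rw [hU'w, hU0, mul_zero]
  have hU'li : LinearIndependent ℂ fun i => germDeriv E (U' i) :=
    linearIndependent_unit_mul (ψ := ψ) (φ := U) hψ0 hU0 hUli
  have hψne : ∀ᶠ w in 𝓝 0, ∀ i, (ψ i).1 w ≠ 0 :=
    eventually_all.2 fun i => (germAlg.analyticAt (ψ i)).continuousAt.eventually_ne (hψ0 i)
  -- the units of the other components
  set ψ' : Fin r → germAlg E := fun i => ⟨fun w => ((ψ i).1 w)⁻¹,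
    (germAlg.analyticAt (ψ i)).inv (hψ0 i)⟩ with hψ'
  set v : Fin p → germAlg E := fun k => vY k * ∏ i, ψ' i ^ Cm i k with hv
  have hvw : ∀ k w, (v k).1 w = (vY k).1 w * ∏ i, ((ψ i).1 w)⁻¹ ^ Cm i k := by
    intro k w
    simp only [hv, hψ', MulMemClass.coe_mul, SubmonoidClass.coe_finsetProd, SubmonoidClass.coe_pow,
      Pi.mul_apply, Finset.prod_apply, Pi.pow_apply]
  have hv0 : ∀ k, (v k).1 0 ≠ 0 := fun k => by
    rw [hvw]
    exact mul_ne_zero (hvY k) (Finset.prod_ne_zero_iff.2 fun i _ =>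
      pow_ne_zero _ (inv_ne_zero (hψ0 i)))
  choose Φ hΦ0 hΦ using fun k => germAlg.exists_log (v k) (hv0 k)
  -- the normal forms
  obtain ⟨N₁, hN₁⟩ := hf.exists_secondary_normal_form hDdet η
  -- The secondary threshold `N₁` enters here so that one order `N` serves both normal forms.
  obtain ⟨e, m₀, lam, u, z₀, σ, N, hN, hu0, hz0, hli, hspan, hlam0, hlam, hlist, hxgen, hzgen, hσeq,
    hσ0, hσres, hσnil⟩ := hf.exists_primary_normal_form hcontr (max 2 N₁) τ hvU hU'0
      (fun i => hψ i) hU'li hη hτ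
  have hN2 : 2 ≤ N := (le_max_left _ _).trans hN
  set x : Fin r ⊕ Fin e → germAlg E := Sum.elim U' u with hx
  have hx0 : ∀ i, (x i).1 0 = 0 := by
    rintro (i | k)
    exacts [hU'0 i, hu0 k]
  have hcoord : IsLocalBiholomorphism fun w s => (Sum.elim x z₀ s : germAlg E).1 w := by
    refine isLocalBiholomorphism_of_linearIndependent ?_ hli hspan
    rintro (i | j)
    exacts [hx0 i, hz0 j]
  obtain ⟨L, g, hg0, hgres, hLeq⟩ := hN₁ N ((le_max_right _ _).trans hN) hx0 hcoord hxgen hzgen Φ hΦ0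
  set χ : Fin p → germAlg E := fun k => ⟨fun w => Complex.exp ((L k).1 w),
    (germAlg.analyticAt (L k)).cexp⟩ with hχ
  set y : Fin p → germAlg E := fun k => χ k * Y k with hy
  have hyw : ∀ k w, (y k).1 w = Complex.exp ((L k).1 w) * (Y k).1 w := fun k w => rfl
  have hy0 : ∀ k, (y k).1 0 = 0 := fun k => by rw [hyw, hY0, mul_zero]
  have hχ0 : ∀ k, (χ k).1 0 ≠ 0 := fun k => Complex.exp_ne_zero _
  -- linear independence of the differentials
  have hyli : LinearIndependent ℂ fun k => germDeriv E (y k) := 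
    linearIndependent_unit_mul (ψ := χ) (φ := Y) hχ0 hY0 hYli
  have hxli : LinearIndependent ℂ fun i => germDeriv E (x i) :=
    hli.comp Sum.inl Sum.inl_injective
  have hxM := fun i => (hxgen i).germDeriv hf.analyticAt hf.map_zero hN2
  have hzM := fun j => (hzgen j).germDeriv hf.analyticAt hf.map_zero hN2
  have hyM : ∀ k, IsGenEig (M ^ η) ⊥ 0 (germDeriv E (y k)) := by
    intro k
    have h1 := (isGenEig_germDeriv_of_monomial hf.analyticAt hf.map_zero hcol hU0 hY0 hY k).pow
      (bot_invariant _) η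
    rw [zero_pow hη] at h1
    have h2 : germDeriv E (y k) = (χ k).1 0 • germDeriv E (Y k) := germDeriv_unit_mul (χ k) (hY0 k)
    rw [h2]
    exact h1.smul _
  -- Eigenvalues separate `x` from `y`. The functions `z₀` have served as auxiliary coordinates for
  -- jets. They are now replaced by a complement to both `x` and `y`, on which nothing further is
  -- required.
  have hxyli := hxli.sum_elim_of_isGenEig hyli (fun i => pow_ne_zero η (hlam0 i)) hxM hyM
  obtain ⟨m, b, hbli, hbspan⟩ := exists_complementary_family hxyli
  choose z hz0' hzb using fun j => germDeriv_surjective (b j)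
  have hδ : (fun s => germDeriv E (Sum.elim x (Sum.elim y z) s)) =
      Sum.elim (Sum.elim (fun i => germDeriv E (x i)) fun k => germDeriv E (y k)) b ∘
        (Equiv.sumAssoc (Fin r ⊕ Fin e) (Fin p) (Fin m)).symm := by
    funext s
    rcases s with i | k | j
    · rfl
    · rfl
    · exact hzb j
  refine ⟨e, m, fun i => (vU i).1 0, fun k => (v k).1 0, lam, x, y, z, σ, g,
    ⟨hvU, hv0, hlam0, hlam⟩, ?_, ?_, ?_, hlist, ?_, ?_, ⟨hσ0, hσres, hσnil⟩, ⟨hg0, ?_⟩, ?_⟩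
  · rintro (i | k | j)
    exacts [hx0 i, hy0 k, hz0' j]
  · rw [hδ]
    exact hbli.comp _ (Equiv.injective _)
  · rw [hδ, EquivLike.range_comp]
    exact hbspan
  · filter_upwards [eventually_all.2 fun i => mem_nullIdeal.1 (hψ i),
      eventually_all.2 fun k => mem_nullIdeal.1 (hσeq k), hψne, eventually_all.2 hΦ,
      eventually_all.2 hY, hLeq] with w h1 h2 h3 h4 h5 h6
    refine ⟨fun i => sub_eq_zero.1 (h1 i), fun k => ?_, fun k => ?_⟩
    · have h7 : (u k).1 (f w) - lam (Sum.inr k) * (u k).1 w -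
          (MvPolynomial.aeval x (σ k) : germAlg E).1 w = 0 := h2 k
      rw [germAlg.aeval_apply, sub_eq_zero, sub_eq_iff_eq_add'] at h7
      exact h7
    · have hYv : (Y k).1 (f w) = (v k).1 w * ((∏ i, (x (Sum.inl i)).1 w ^ Cm i k) *
          ∏ l, (Y l).1 w ^ D l k) := by
        rw [h5 k, hvw, mul_assoc, ← mul_assoc (∏ i, ((ψ i).1 w)⁻¹ ^ Cm i k), ← Finset.prod_mul_distrib]
        congr 2
        refine Finset.prod_congr rfl fun i _ => ?_
        rw [← mul_pow]
        change _ = (((ψ i).1 w)⁻¹ * ((ψ i).1 w * (U i).1 w)) ^ _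
        rw [inv_mul_cancel_left₀ (h3 i)]
      have hprod : ∏ l, (y l).1 w ^ D l k = Complex.exp (∑ l, (D l k : ℂ) * (L l).1 w) *
          ∏ l, (Y l).1 w ^ D l k := by
        rw [Complex.exp_sum, ← Finset.prod_mul_distrib]
        refine Finset.prod_congr rfl fun l _ => ?_
        rw [hyw, mul_pow, Complex.exp_nat_mul]
      -- The exponent collects the logarithm of the unit, the factor gained in `y k ∘ f` and the
      -- factor absorbed into the monomial `y ^ D`.
      have h6' : Complex.exp ((Φ k).1 w + (L k).1 (f w) - ∑ l, (D l k : ℂ) * (L l).1 w) =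
          1 + MvPolynomial.eval (fun i => (x i).1 w) (g k) := h6 k
      rw [hyw, hYv, h4 k, hprod, ← h6', Complex.exp_sub, Complex.exp_add]
      have := Complex.exp_ne_zero (∑ l, (D l k : ℂ) * (L l).1 w)
      field_simp
  · filter_upwards [hψne] with w hw
    refine ⟨fun i => ?_, fun k => ?_⟩
    · change (ψ i).1 w * (U i).1 w = 0 ↔ _
      simp [hw i]
    · rw [hyw]
      simp [Complex.exp_ne_zero]
  · intro k n hn
    have h1 := hgres k n hn
    rw [IsSecondaryResonant]
    have h2 : ∏ i, lam i ^ (η * n i) = n.prod fun i s => (lam i ^ η) ^ s := by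
      rw [Finsupp.prod_fintype _ _ fun i => pow_zero _]
      simp only [pow_mul]
    have h3 : (D ^ η).map (Nat.cast : ℕ → ℂ) = (D.map (Nat.cast : ℕ → ℂ)) ^ η :=
      map_pow (Nat.castRingHom ℂ).mapMatrix D η
    rw [h2, h3]
    exact h1
  · have hinv : ∀ a ∈ Submodule.span ℂ (Set.range fun i => germDeriv E (x i)),
        M a ∈ Submodule.span ℂ (Set.range fun i => germDeriv E (x i)) := by
      intro a ha
      have hmem : ∀ i, germDeriv E (x i) ∈
          Submodule.span ℂ (Set.range fun i => germDeriv E (x i)) :=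
        fun i => Submodule.subset_span ⟨i, rfl⟩
      induction ha using Submodule.span_induction with
      | mem a ha =>
        obtain ⟨i, rfl⟩ := ha
        change M (germDeriv E (x i)) ∈ _
        rw [hM, ← germDeriv_germPullback hf.analyticAt hf.map_zero]
        rcases i with i | k
        · have h1 := germDeriv_eq_of_sub_mem_null (hψ i)
          rw [map_smul] at h1
          exact h1 ▸ Submodule.smul_mem _ _ (hmem (Sum.inl (τ i)))
        · have h1 := hσeq k
          rw [sub_sub] at h1
          have h2 := germDeriv_eq_of_sub_mem_null h1
          rw [map_add, map_smul, germDeriv_aeval (ξ := x) hx0] at h2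
          refine h2 ▸ Submodule.add_mem _ (Submodule.smul_mem _ _ (hmem (Sum.inr k))) ?_
          exact Submodule.sum_mem _ fun i _ => Submodule.smul_mem _ _ (hmem i)
      | zero => rw [_root_.map_zero]; exact Submodule.zero_mem _
      | add a b _ _ ha hb => rw [map_add]; exact Submodule.add_mem _ ha hb
      | smul k a _ ha => rw [map_smul]; exact Submodule.smul_mem _ _ ha
    -- The span of the `dx_i` is invariant, and the `dz₀` completing them are nilpotent.
    refine exists_pow_apply_mem_of_span hinv hspan ?_
    rintro _ ⟨i | j, rfl⟩
    · exact ⟨0, Submodule.subset_span ⟨i, rfl⟩⟩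
    · obtain ⟨n, hn⟩ := (hzM j).exists_pow_apply_mem
      exact ⟨n, by change (M ^ n) (germDeriv E (z₀ j)) ∈ _; rw [hn]; exact Submodule.zero_mem _⟩

end NormalizingCoordinates

/-! ### The permutation block and its iterates -/

section PermutationBlock

variable {r e p : ℕ}

/-- The matrix of exponents of the map `(u, v) ↦ (u ∘ τ, v)`. -/
def permBlock (e : ℕ) (τ : Equiv.Perm (Fin r)) : Matrix (Fin r ⊕ Fin e) (Fin r ⊕ Fin e) ℕ :=
  Matrix.fromBlocks (Matrix.of fun l i => if l = τ i then 1 else 0) 0 0 1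

/-- The inverse appears because `permMatrix` has its ones at `(l, τ l)`, whereas here they are at
`(τ i, i)`. -/
theorem isPermMatrix_of_perm (τ : Equiv.Perm (Fin r)) :
    IsPermMatrix (Matrix.of fun l i : Fin r => if l = τ i then 1 else 0) := by
  refine ⟨τ⁻¹, ?_⟩
  ext l i
  simp [Equiv.Perm.permMatrix, PEquiv.toMatrix_apply, Equiv.toPEquiv_apply, Equiv.symm_apply_eq]

theorem permBlock_pow (τ : Equiv.Perm (Fin r)) (n : ℕ) :
    permBlock e τ ^ n = permBlock e (τ ^ n) := by
  induction n with
  | zero =>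
    rw [pow_zero, pow_zero, permBlock, ← Matrix.fromBlocks_one]
    rfl
  | succ n ih =>
    rw [pow_succ, ih, permBlock, permBlock, permBlock, Matrix.fromBlocks_multiply]
    simp only [Matrix.mul_zero, Matrix.zero_mul, add_zero, zero_add, Matrix.mul_one]
    congr 1
    ext l i
    simp [Matrix.mul_apply, pow_succ]

theorem permBlock_eq_one {τ : Equiv.Perm (Fin r)} : permBlock e τ = 1 ↔ τ = 1 := by
  refine ⟨fun h => Equiv.ext fun i => ?_, fun h => ?_⟩
  · have h1 := congrFun (congrFun h (Sum.inl (τ i))) (Sum.inl i)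
    by_contra hne
    have hne' : τ i ≠ i := hne
    simp [permBlock, hne'] at h1
  · rw [h]
    exact (permBlock_pow (1 : Equiv.Perm (Fin r)) 0).symm

theorem orderOf_permBlock (τ : Equiv.Perm (Fin r)) : orderOf (permBlock e τ) = orderOf τ :=
  orderOf_eq_orderOf_iff.2 fun n => by rw [permBlock_pow, permBlock_eq_one]

theorem matPow_permBlock_inl (τ : Equiv.Perm (Fin r)) (x : Fin r ⊕ Fin e → ℂ) (i : Fin r) :
    matPow x (permBlock e τ) (Sum.inl i) = x (Sum.inl (τ i)) := by
  rw [matPow, Fintype.prod_sum_type]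
  simp [permBlock, Finset.prod_ite_eq']

theorem matPow_permBlock_inr (τ : Equiv.Perm (Fin r)) (x : Fin r ⊕ Fin e → ℂ) (k : Fin e) :
    matPow x (permBlock e τ) (Sum.inr k) = x (Sum.inr k) := by
  rw [matPow, Fintype.prod_sum_type]
  simp [permBlock, Matrix.one_apply]

theorem matPow_fromRows_zero (C : Matrix (Fin r) (Fin p) ℕ) (x : Fin r ⊕ Fin e → ℂ) (k : Fin p) :
    matPow x (Matrix.fromRows C 0) k = ∏ i, x (Sum.inl i) ^ C i k := by
  rw [matPow, Fintype.prod_sum_type]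
  simp

theorem isCompatible_permBlock {τ : Equiv.Perm (Fin r)} {γ : Fin r → ℂ} {lam : Fin r ⊕ Fin e → ℂ}
    {η : ℕ} (hτ : τ ^ η = 1)
    (h : ∀ i, lam (Sum.inl i) ^ η = ∏ j ∈ Finset.range η, γ ((τ ^ j) i)) :
    IsCompatible (Sum.elim γ fun k => lam (Sum.inr k)) (permBlock e τ) η lam := by
  set T : (Fin r ⊕ Fin e → ℂ) → (Fin r ⊕ Fin e → ℂ) := fun t =>
    (Sum.elim γ fun k => lam (Sum.inr k)) * matPow t (permBlock e τ) with hT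
  have hTl : ∀ t i, T t (Sum.inl i) = γ i * t (Sum.inl (τ i)) := fun t i => by
    rw [← matPow_permBlock_inl (e := e) τ t i]
    rfl
  have hTr : ∀ t k, T t (Sum.inr k) = lam (Sum.inr k) * t (Sum.inr k) := fun t k => by
    rw [← matPow_permBlock_inr τ t k]
    rfl
  have key : ∀ n x, (∀ i, T^[n] x (Sum.inl i) =
      (∏ j ∈ Finset.range n, γ ((τ ^ j) i)) * x (Sum.inl ((τ ^ n) i))) ∧
      ∀ k, T^[n] x (Sum.inr k) = lam (Sum.inr k) ^ n * x (Sum.inr k) := by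
    intro n
    induction n with
    | zero => simp
    | succ n ih =>
      intro x
      rw [Function.iterate_succ_apply]
      refine ⟨fun i => ?_, fun k => ?_⟩
      · rw [(ih _).1, hTl, Finset.prod_range_succ, pow_succ' τ, Equiv.Perm.mul_apply, mul_assoc]
      · rw [(ih _).2, hTr, pow_succ, mul_assoc]
  rintro x (i | k)
  · rw [h]
    have := (key η x).1 i
    rwa [hτ] at this
  · exact (key η x).2 k

end PermutationBlock

/-! ### Duality and coordinate differentials -/

section NormalForm

variable {E : Type*} [NormedAddCommGroup E] [NormedSpace ℂ E]

theorem Module.Dual.transpose_pow_apply (A : E →L[ℂ] E) (n : ℕ) (l : Module.Dual ℂ E) (v : E) :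
    ((Module.Dual.transpose (R := ℂ) (A : E →ₗ[ℂ] E) : Module.End ℂ (Module.Dual ℂ E)) ^ n) l v =
      l ((A ^ n) v) := by
  induction n generalizing l with
  | zero => rfl
  | succ n ih =>
    rw [pow_succ, Module.End.mul_apply, ih, pow_succ', mul_apply_eq_comp]
    rfl

theorem linearIndependent_germDeriv_of_isLocalBiholomorphism {d : ℕ}
    {w : (Fin d → ℂ) → (Fin d → ℂ)} (hw : IsLocalBiholomorphism w)
    {ξ : Fin d → germAlg (Fin d → ℂ)} (hξ : ∀ i t, (ξ i).1 t = w t i) :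
    LinearIndependent ℂ fun i => germDeriv (Fin d → ℂ) (ξ i) := by
  classical
  have hd : ∀ i v, germDeriv (Fin d → ℂ) (ξ i) v = fderiv ℂ w 0 v i := by
    intro i v
    have h1 : (ξ i).1 = fun t => w t i := funext (hξ i)
    rw [germDeriv_apply, h1,
      ((hasFDerivAt_pi'.1 hw.1.differentiableAt.hasFDerivAt) i).fderiv]
    rfl
  have hsurj : Function.Surjective (fderiv ℂ w 0 : (Fin d → ℂ) →ₗ[ℂ] (Fin d → ℂ)) :=
    LinearMap.injective_iff_surjective.1 hw.fderiv_injective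
  rw [Fintype.linearIndependent_iff]
  intro a ha i
  obtain ⟨v, hv⟩ := hsurj (Pi.single i 1)
  have h1 := congrArg (fun l : Module.Dual ℂ (Fin d → ℂ) => l v) ha
  simp only [LinearMap.sum_apply, LinearMap.smul_apply, hd, smul_eq_mul, LinearMap.zero_apply] at h1
  have hv' : fderiv ℂ w 0 v = Pi.single i 1 := hv
  simpa [hv', Pi.single_apply] using h1

end NormalForm

/-! ### Conjugation to the normal form -/

theorem mainTheorem2 {d : ℕ} (f : (Fin d → ℂ) → (Fin d → ℂ))
    (hf : AnalyticAt ℂ f 0) (hf0 : f 0 = 0) (hcontr : IsContracting f)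
    (hrigid : IsRigid f) (hinj : HasInjectiveInternalAction f) :
    ∃ (r e p m : ℕ)
      (γ : Fin r ⊕ Fin e → ℂ) (P : Matrix (Fin r ⊕ Fin e) (Fin r ⊕ Fin e) ℕ)
      (σ : Fin r ⊕ Fin e → MvPolynomial (Fin r ⊕ Fin e) ℂ)
      (β : Fin p → ℂ) (E : Matrix (Fin r ⊕ Fin e) (Fin p) ℕ) (D : Matrix (Fin p) (Fin p) ℕ)
      (g : Fin p → MvPolynomial (Fin r ⊕ Fin e) ℂ)
      (h : (Fin r ⊕ Fin e → ℂ) × (Fin p → ℂ) × (Fin m → ℂ) → (Fin m → ℂ))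
      (lam : Fin r ⊕ Fin e → ℂ),
      r + e + p + m = d ∧
      AnalyticallyConjugate f (normalForm γ P σ β E D g h) ∧
      -- the coefficients and the exponents
      (∀ i, γ i ≠ 0) ∧ (∀ k, β k ≠ 0) ∧
      (∃ B : Matrix (Fin r) (Fin r) ℕ, IsPermMatrix B ∧ P = Matrix.fromBlocks B 0 0 1) ∧
      (∃ C : Matrix (Fin r) (Fin p) ℕ, E = Matrix.fromRows C 0) ∧
      (D.map (Nat.cast : ℕ → ℤ)).det ≠ 0 ∧
      -- the generalized critical set of the normal form is `{u₁ ⋯ u_r y₁ ⋯ y_p = 0}`, `x = (u, v)`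
      (∀ᶠ t in 𝓝 (0 : (Fin r ⊕ Fin e → ℂ) × (Fin p → ℂ) × (Fin m → ℂ)),
        t ∈ critInf (normalForm γ P σ β E D g h) ↔
          (∏ i, t.1 (Sum.inl i)) * ∏ k, t.2.1 k = 0) ∧
      -- the non-zero eigenvalues of the differential
      ListsNonzeroEigenvalues (fderiv ℂ f 0 : (Fin d → ℂ) →ₗ[ℂ] (Fin d → ℂ)) lam ∧
      IsCompatible γ P (orderOf P) lam ∧
      (∀ k, γ (Sum.inr k) = lam (Sum.inr k)) ∧
      -- `σ = (0, ρ)` has only primary resonant monomials, and `ρ(0, v)` has nilpotent linear part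
      (∀ i, σ (Sum.inl i) = 0) ∧
      (∀ i, MvPolynomial.constantCoeff (σ i) = 0) ∧
      (∀ k, ∀ n ∈ (σ (Sum.inr k)).support,
        IsPrimaryResonant lam (orderOf P) n (Sum.inr k)) ∧
      IsNilpotent (Matrix.of fun k l : Fin e =>
        MvPolynomial.coeff (Finsupp.single (Sum.inr l) 1) (σ (Sum.inr k))) ∧
      -- `g` has only secondary resonant monomials
      (∀ k, MvPolynomial.constantCoeff (g k) = 0) ∧
      (∀ k, ∀ n ∈ (g k).support, IsSecondaryResonant lam (orderOf P) D n) ∧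
      -- `h` is holomorphic, and its restriction to `{x = y = 0}` has nilpotent linear part
      AnalyticAt ℂ h 0 ∧ h 0 = 0 ∧
      IsNilpotent (fderiv ℂ (fun z : Fin m → ℂ => h (0, 0, z)) 0) := by
  classical
  obtain ⟨c, hc0, hc1, hcm⟩ := hcontr.exists_norm_pow_lt
  have hfc : IsContractingGerm f c := ⟨hf, hf0, hc0, hc1, hcm⟩
  obtain ⟨q, hq, w, A, ⟨hw, hcrit⟩, hact, hdet⟩ := hinj
  obtain ⟨r, p, ε, τ, Cm, D, ht, hA1, hA2, hA3, hD, hcol⟩ := exists_block_decomposition A hdet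
  -- the components of the generalized critical set
  set ξ : Fin d → germAlg (Fin d → ℂ) := fun i => ⟨fun t => w t i, analyticAt_pi_iff.1 hw.1 i⟩ with hξ
  have hξ0 : ∀ i, (ξ i).1 0 = 0 := fun i => congrFun hw.2.1 i
  have hξli := linearIndependent_germDeriv_of_isLocalBiholomorphism hw (ξ := ξ) fun _ _ => rfl
  set W : Fin r ⊕ Fin p → germAlg (Fin d → ℂ) := fun s => ξ (Fin.castLE hq (ε s)) with hW
  have hWw : ∀ s t, (W s).1 t = w t (Fin.castLE hq (ε s)) := fun _ _ => rfl
  have hW0 : ∀ s, (W s).1 0 = 0 := fun s => hξ0 _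
  have hWli : LinearIndependent ℂ fun s => germDeriv (Fin d → ℂ) (W s) :=
    hξli.comp (fun s => Fin.castLE hq (ε s)) ((Fin.castLE_injective hq).comp ε.injective)
  choose v hv hv0 hvw using fun s => hact (ε s)
  have hact' : ∀ s, ∀ᶠ t in 𝓝 0, (W s).1 (f t) =
      v s t * ∏ l, (W l).1 t ^ A (ε l) (ε s) := by
    intro s
    filter_upwards [hvw s] with t h1
    rw [hWw, h1, ← ε.prod_comp]
  have hη : orderOf τ ≠ 0 := (orderOf_pos τ).ne'
  obtain ⟨e, m, γ, β, lam, x, y, z, σ, g, ⟨hγ, hβ, hlam0, hlamη⟩, hxyz0, hli, hspan, hlist, heq, hzero,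
    ⟨hσ0, hσres, hσnil⟩, ⟨hg0, hgres⟩, n, hn⟩ :=
    hfc.exists_normalizing_coordinates hcontr τ (Cm := Cm) hD hcol (U := fun i => W (Sum.inl i))
      (Y := fun k => W (Sum.inr k)) (fun i => hW0 _) (fun k => hW0 _)
      (hWli.comp Sum.inl Sum.inl_injective) (hWli.comp Sum.inr Sum.inr_injective)
      (vU := fun i => ⟨v (Sum.inl i), hv _⟩) (fun i => hv0 _)
      (fun i => by
        filter_upwards [hact' (Sum.inl i)] with t h1
        rw [h1]
        simp only [hA1]
        rw [Finset.prod_eq_single (Sum.inl (τ i)) (fun b _ hb => by rw [if_neg hb, pow_zero])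
          fun h => absurd (Finset.mem_univ _) h, if_pos rfl, pow_one])
      (vY := fun k => ⟨v (Sum.inr k), hv _⟩) (fun k => hv0 _)
      (fun k => by
        filter_upwards [hact' (Sum.inr k)] with t h1
        rw [h1, Fintype.prod_sum_type]
        simp only [hA2, hA3])
      hη (pow_orderOf_eq_one τ)
  -- the conjugacy
  have hΦlb : IsLocalBiholomorphism fun t =>
      ((fun i => (x i).1 t, fun k => (y k).1 t, fun j => (z j).1 t) :
        (Fin r ⊕ Fin e → ℂ) × (Fin p → ℂ) × (Fin m → ℂ)) :=
    (isLocalBiholomorphism_of_linearIndependent hxyz0 hli hspan).continuousLinearEquiv_comp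
      ((LinearEquiv.sumArrowLequivProdArrow (Fin r ⊕ Fin e) (Fin p ⊕ Fin m) ℂ ℂ).trans
        ((LinearEquiv.refl ℂ _).prodCongr
          (LinearEquiv.sumArrowLequivProdArrow (Fin p) (Fin m) ℂ ℂ))).toContinuousLinearEquiv
  set Φ : (Fin d → ℂ) → (Fin r ⊕ Fin e → ℂ) × (Fin p → ℂ) × (Fin m → ℂ) := fun t =>
    (fun i => (x i).1 t, fun k => (y k).1 t, fun j => (z j).1 t) with hΦdef
  have hΦlb' := hΦlb
  obtain ⟨hΦ, hΦ0, Ψ, hΨ, hΨ0, hl, hr⟩ := hΦlb'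
  have tΨ := tendsto_zero_of_analyticAt hΨ hΨ0
  have tf := tendsto_zero_of_analyticAt hf hf0
  -- Nothing is normalized in the `z`-direction: `h` is the `z`-component of `Φ ∘ f ∘ Ψ`.
  set h : (Fin r ⊕ Fin e → ℂ) × (Fin p → ℂ) × (Fin m → ℂ) → (Fin m → ℂ) := fun t j =>
    (z j).1 (f (Ψ t)) with hh
  have hhan : AnalyticAt ℂ h 0 := by
    refine analyticAt_pi_iff.2 fun j => ?_
    have h1 : AnalyticAt ℂ (fun t => f (Ψ t)) 0 := hf.comp_of_eq hΨ hΨ0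
    exact (germAlg.analyticAt (z j)).comp_of_eq h1 (by rw [hΨ0, hf0])
  have hh0 : h 0 = 0 := by
    funext j
    rw [hh]
    simp only [hΨ0, hf0]
    exact hxyz0 (Sum.inr (Sum.inr j))
  set σ' : Fin r ⊕ Fin e → MvPolynomial (Fin r ⊕ Fin e) ℂ := Sum.elim 0 σ with hσ'
  set γ' : Fin r ⊕ Fin e → ℂ := Sum.elim γ fun k => lam (Sum.inr k) with hγ'
  have hconj : ∀ᶠ t in 𝓝 0, Φ (f t) =
      normalForm γ' (permBlock e τ) σ' β (Matrix.fromRows Cm 0) D g h (Φ t) := by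
    filter_upwards [heq, hl] with t ⟨h1, h2, h3⟩ h4
    refine Prod.ext (funext ?_) (Prod.ext (funext fun k => ?_) (funext fun j => ?_))
    · rintro (i | k)
      · change (x (Sum.inl i)).1 (f t) = γ i * matPow (Φ t).1 _ (Sum.inl i) +
          MvPolynomial.eval (Φ t).1 0
        rw [h1, matPow_permBlock_inl, _root_.map_zero, add_zero]
      · change (x (Sum.inr k)).1 (f t) = lam (Sum.inr k) * matPow (Φ t).1 _ (Sum.inr k) +
          MvPolynomial.eval (Φ t).1 (σ k)
        rw [h2, matPow_permBlock_inr]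
    · change (y k).1 (f t) = β k * matPow (Φ t).1 _ k * matPow (Φ t).2.1 D k *
          (1 + MvPolynomial.eval (Φ t).1 (g k))
      rw [h3, matPow_fromRows_zero]
      rfl
    · change (z j).1 (f t) = (z j).1 (f (Ψ (Φ t)))
      rw [h4]
  -- The fibre `x = y = 0` is invariant: `σ` has no constant term, and every column of `D` is
  -- non-zero, so each monomial `y ^ D` vanishes there.
  have hzeroNF : ∀ ζ : Fin m → ℂ,
      normalForm γ' (permBlock e τ) σ' β (Matrix.fromRows Cm 0) D g h (0, 0, ζ) =
        (0, 0, h (0, 0, ζ)) := by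
    intro ζ
    refine Prod.ext (funext ?_) (Prod.ext (funext fun k => ?_) rfl)
    · rintro (i | k)
      · change γ i * matPow (0 : Fin r ⊕ Fin e → ℂ) _ (Sum.inl i) + MvPolynomial.eval 0 0 = 0
        rw [matPow_permBlock_inl, _root_.map_zero, Pi.zero_apply, mul_zero, add_zero]
      · change lam (Sum.inr k) * matPow (0 : Fin r ⊕ Fin e → ℂ) _ (Sum.inr k) +
          MvPolynomial.eval 0 (σ k) = 0
        rw [matPow_permBlock_inr, MvPolynomial.eval_zero, hσ0, Pi.zero_apply, mul_zero, add_zero]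
    · have h1 : matPow (0 : Fin p → ℂ) D k = 0 := by
        obtain ⟨l, hl⟩ : ∃ l, D l k ≠ 0 := by
          by_contra! hcon
          exact hD (Matrix.det_eq_zero_of_column_eq_zero k fun l => by simp [hcon l])
        exact Finset.prod_eq_zero (Finset.mem_univ l) (zero_pow hl)
      change β k * _ * matPow (0 : Fin p → ℂ) D k * _ = 0
      rw [h1, mul_zero, zero_mul]
  refine ⟨r, e, p, m, γ', permBlock e τ, σ', β, Matrix.fromRows Cm 0, D, g, h, lam, ?_,
    ⟨Φ, hΦlb, hconj⟩, ?_, hβ, ⟨_, isPermMatrix_of_perm τ, rfl⟩, ⟨Cm, rfl⟩, hD, ?_, hlist, ?_,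
    fun _ => rfl, fun _ => rfl, ?_, ?_, hσnil, hg0, ?_, hhan, hh0, ?_⟩
  · have h1 := Module.finrank_eq_card_basis (Module.Basis.mk hli hspan)
    rw [Subspace.dual_finrank_eq, Module.finrank_fintype_fun_eq_card] at h1
    simp only [Fintype.card_fin, Fintype.card_sum] at h1
    rw [h1]
    ring
  · rintro (i | k)
    · exact hγ i
    · exact hlam0 _
  -- Only the original components are known to cut out the critical set; the new coordinates `u` and
  -- `y` have the same zero sets near 0.
  · filter_upwards [hfc.contractsWith.critInf_conj hf hf0 hc0.le hc1.le hΦ hΦ0 hΨ hΨ0 hl hr hconj,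
      tΨ.eventually hcrit, tΨ.eventually hzero, hr] with t h1 h2 h3 h4
    have h5 : ∀ i, t.1 i = (x i).1 (Ψ t) := fun i => congrFun (congrArg Prod.fst h4).symm i
    have h6 : ∀ k, t.2.1 k = (y k).1 (Ψ t) := fun k =>
      congrFun (congrArg (fun s => s.2.1) h4).symm k
    rw [h1, h2, mul_eq_zero, Finset.prod_eq_zero_iff, Finset.prod_eq_zero_iff, ε.surjective.exists,
      Sum.exists]
    simp only [h5, h6, h3.1, h3.2, Finset.mem_univ, true_and]
    rfl
  · rw [orderOf_permBlock]
    exact isCompatible_permBlock (pow_orderOf_eq_one τ) hlamη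
  · rintro (i | k)
    · exact _root_.map_zero _
    · exact hσ0 k
  · rw [orderOf_permBlock]
    exact hσres
  · rw [orderOf_permBlock]
    exact hgres
  · refine isNilpotent_fderiv_of_conj hf hΦ hΨ hΨ0 hr hhan hh0 (n := n) ?_ ?_
    · have t0 : Tendsto (fun ζ : Fin m → ℂ =>
          ((0, 0, ζ) : (Fin r ⊕ Fin e → ℂ) × (Fin p → ℂ) × (Fin m → ℂ))) (𝓝 0) (𝓝 0) := by
        refine Continuous.tendsto' ?_ _ _ rfl
        fun_prop
      filter_upwards [t0.eventually (tΨ.eventually hconj), t0.eventually hr,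
        t0.eventually (tΨ.eventually (tf.eventually hl))] with ζ h1 h2 h3
      rw [h2, hzeroNF] at h1
      rw [← h1, h3]
    · intro a ha
      have hdx : ∀ i, germDeriv (Fin d → ℂ) (x i) a = 0 := by
        intro i
        have h1 : HasFDerivAt (fun t => (x i).1 t)
            (((ContinuousLinearMap.proj i).comp (ContinuousLinearMap.fst ℂ (Fin r ⊕ Fin e → ℂ)
              ((Fin p → ℂ) × (Fin m → ℂ)))).comp (fderiv ℂ Φ 0)) 0 :=
          ((ContinuousLinearMap.proj i).comp (ContinuousLinearMap.fst ℂ (Fin r ⊕ Fin e → ℂ)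
            ((Fin p → ℂ) × (Fin m → ℂ)))).hasFDerivAt.comp (0 : Fin d → ℂ)
            hΦ.differentiableAt.hasFDerivAt
        rw [germDeriv_apply, h1.fderiv]
        exact congrFun ha i
      -- By duality, it suffices that every covector composed with the `n`-th power of the
      -- differential lies in the span of the `dx_i`, all of which kill `a`.
      refine (Module.forall_dual_apply_eq_zero_iff ℂ _).1 fun l => ?_
      rw [← Module.Dual.transpose_pow_apply]
      have h1 := hn l
      revert h1
      generalize ((Module.Dual.transpose (R := ℂ)
        (fderiv ℂ f 0 : (Fin d → ℂ) →ₗ[ℂ] (Fin d → ℂ)) : Module.End ℂ (Module.Dual ℂ (Fin d → ℂ))) ^ n)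
        l = l'
      intro h1
      induction h1 using Submodule.span_induction with
      | mem s hs =>
        obtain ⟨i, rfl⟩ := hs
        exact hdx i
      | zero => rfl
      | add s s' _ _ hs hs' => rw [LinearMap.add_apply, hs, hs', add_zero]
      | smul k s _ hs => rw [LinearMap.smul_apply, hs, smul_zero]
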